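/- **Convergence and asymptotic normality of the data-split (DS) estimator of $T(f,g)$.** *Densities.* Let $d\ge 1$, $s>0$, let $\mathcal X\subset\mathbb R^d$ be compact, and let $\mathcal S\supseteq\mathcal X$ be a closed set on which derivatives are well defined (every point of $\mathcal S$ is a point of unique differentiability). The main examples are $\mathcal S=\mathcal X$ and $\mathcal S=\mathbb R^d$. Let $f,g$ be probability densities with respect to Lebesgue measure on $\mathcal X$, extended by $0$ outside $\mathcal X$, which lie in the bounded Hölder class: with $k=\lfloor s\rfloor$ they are $k$ times continuously differentiable on $\mathcal S$, $|D^rf(x)-D^rf(y)|\le L\|x-y\|^{s-k}$ for all $x,y\in\mathcal S$ and all multi-indices $|r|=k$ (and likewise for $g$), and $B'<f,g<B$ on $\mathcal X$. *Density estimators.* From $k$ points $X_1,\dots,X_k$ form the kernel density estimate $\hat f(t)=\frac1{kh^d}\sum_i K_{h,t}\big(\frac{t-X_i}{h}\big)$ with a bandwidth $h\in\Theta(k^{-1/(2s+d)})$, or its truncation to $[B',B]$; similarly $\hat g$ (possibly with another kernel and bandwidth). The smoothing kernel $K_{h,t}(u)$, jointly measurable in $(t,u)$ for each $h$, may be adapted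 to the boundary of $\mathcal S$. For all $h>0$ and $t\in\mathcal X$ it satisfies $|K_{h,t}(u)|\le\kappa(u)$, where $\kappa$, $\kappa^2$ and $\|u\|^s\kappa(u)$ are integrable. For all small $h>0$ and all $t\in\mathcal X$, $\int_{\{u:\,t-hu\in\mathcal S\}}u^rK_{h,t}(u)\,du$ equals $1$ if $r=0$ and $0$ if $1\le|r|\le\lfloor s\rfloor$, and if $t-hu\in\mathcal S$ and $K_{h,t}(u)\ne0$ then the segment from $t$ to $t-hu$ lies in $\mathcal S$. For $\mathcal S=\mathbb R^d$ the ordinary kernels $K_{h,t}=K$ of order $\lfloor s\rfloor$ are included. *Functional.* Put $J=[B',B]$ if the density estimates are truncated and $J=\mathbb R$ otherwise, and let $\mathcal A$ be the set of measurable functions in $L^2(\mathcal X)$ with values in $J$ on $\mathcal X$. Let $T(p,q)=\phi\big(\int_{\mathcal X}\nu(p,q)\,dx\big)$, where $\nu$ is Lipschitz and twice differentiable with bounded second derivative on $J\times J$, and $\phi$ is so on an interval containing all $\int_{\mathcal X}\nu(p,q)$, $p,q\in\mathcal A$ (differentiability being understood on an open neighbourhood). Let $\psi_f,\psi_g$ be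 (jointly measurable versions of) the influence functions of $T$: for all $p_1,p_2\in\mathcal A$ and all probability densities $q\in\mathcal A$, $$\tfrac{\partial}{\partial t}T(p_1+t(q-p_1),p_2)\big|_{t=0}=\int\psi_f(x;p_1,p_2)q(x)\,dx,\qquad \tfrac{\partial}{\partial t}T(p_1,p_2+t(q-p_2))\big|_{t=0}=\int\psi_g(x;p_1,p_2)q(x)\,dx .$$ Assume that, for $f',g'\in\mathcal A$, $\mathbb E_f[(\psi_f(X;f',g')-\psi_f(X;f,g))^2]$ and $\mathbb E_g[(\psi_g(Y;f',g')-\psi_g(Y;f,g))^2]$ are $O(\|f-f'\|_2^2+\|g-g'\|_2^2)$ as $\|f-f'\|_2^2,\|g-g'\|_2^2\to0$. *Estimator.* Let $X_1,X_2,\dots\sim f$ and $Y_1,Y_2,\dots\sim g$ be independent. Given $n$ and $m$ observations, compute $\hat f^{(1)},\hat g^{(1)}$ from the first halves (the first $\lfloor n/2\rfloor$, respectively $\lfloor m/2\rfloor$ points) and let $$\hat T^{(1)}=T(\hat f^{(1)},\hat g^{(1)})+\operatorname{avg}_i\psi_f(X_i;\hat f^{(1)},\hat g^{(1)})+\operatorname{avg}_j\psi_g(Y_j;\hat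 f^{(1)},\hat g^{(1)}),$$ with averages over the second halves; let $\hat T^{(2)}$ be the same with the halves swapped, and $\hat T=(\hat T^{(1)}+\hat T^{(2)})/2$. *Conclusion.* As $n,m\to\infty$, $\mathbb E[(\hat T-T(f,g))^2]$ is $O\big(n^{-4s/(2s+d)}+m^{-4s/(2s+d)}\big)$ if $s<d/2$, and $O(n^{-1}+m^{-1})$ if $s\ge d/2$. If moreover $s>d/2$, $\psi_f(\cdot;f,g)$ and $\psi_g(\cdot;f,g)$ do not both vanish almost everywhere on $\mathcal X$, and $n,m\to\infty$ with $n/(n+m)\to\zeta\in(0,1)$, then, with $N=n+m$, $$\sqrt N\,\big(\hat T-T(f,g)\big)\ \xrightarrow{\ d\ }\ \mathcal N\Big(0,\ \tfrac1\zeta\operatorname{Var}_f[\psi_f(X;f,g)]+\tfrac1{1-\zeta}\operatorname{Var}_g[\psi_g(Y;f,g)]\Big).$$ -/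

import Mathlib

open MeasureTheory ProbabilityTheory Filter Topology
open scoped ENNReal NNReal

noncomputable section

namespace VonMises

/-- `ℝᵈ` with its Euclidean norm and Lebesgue measure. -/
abbrev E (d : ℕ) := EuclideanSpace ℝ (Fin d)

/-! ### Hölder classes -/

/-- The Hölder class `Σ(s, L)` on a set `𝒮 ⊆ ℝᵈ`: with `k = ⌊s⌋`, the functions that are `k` times
continuously differentiable on `𝒮` and all of whose partial derivatives of order `k` satisfy
`|Dʳ f x - Dʳ f y| ≤ L ‖x - y‖ ^ (s - k)` on `𝒮`. A partial derivative of order `k` is the `k`-th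
derivative applied to a `k`-tuple of standard basis vectors. -/
def HolderClass {d : ℕ} (s L : ℝ) (𝒮 : Set (E d)) : Set (E d → ℝ) :=
  {f | ContDiffOn ℝ (⌊s⌋₊ : ℕ) f 𝒮 ∧
    ∀ j : Fin ⌊s⌋₊ → Fin d, ∀ x ∈ 𝒮, ∀ y ∈ 𝒮,
      |iteratedFDerivWithin ℝ ⌊s⌋₊ f 𝒮 x (fun i => EuclideanSpace.single (j i) (1 : ℝ))
        - iteratedFDerivWithin ℝ ⌊s⌋₊ f 𝒮 y (fun i => EuclideanSpace.single (j i) (1 : ℝ))|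
        ≤ L * ‖x - y‖ ^ (s - (⌊s⌋₊ : ℝ))}

/-- The bounded Hölder class: Hölder on `𝒮`, with values strictly between `B'` and `B` on `𝒳`. -/
def BoundedHolderClass {d : ℕ} (s L B' B : ℝ) (𝒳 𝒮 : Set (E d)) : Set (E d → ℝ) :=
  {f | f ∈ HolderClass s L 𝒮 ∧ ∀ x ∈ 𝒳, B' < f x ∧ f x < B}

/-- `f` is a probability density with respect to Lebesgue measure on `𝒳`, extended by zero. -/
def IsDensity {d : ℕ} (𝒳 : Set (E d)) (f : E d → ℝ) : Prop :=
  (∀ x, 0 ≤ f x) ∧ (∀ x, x ∉ 𝒳 → f x = 0) ∧ ∫ x in 𝒳, f x = 1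

/-- The law on `𝒳` with Lebesgue density `f`. -/
def law {d : ℕ} (𝒳 : Set (E d)) (f : E d → ℝ) : Measure (E d) :=
  (volume.restrict 𝒳).withDensity (fun x => ENNReal.ofReal (f x))

/-- The squared `L²(𝒳)` distance. -/
def sqDist {d : ℕ} (𝒳 : Set (E d)) (p q : E d → ℝ) : ℝ := ∫ x in 𝒳, (p x - q x) ^ 2

/-! ### Functionals of two densities and their influence functions -/

/-- The functions in `L²(𝒳)` with values in `J` on `𝒳`: true densities and density estimates. -/
def Admissible {d : ℕ} (𝒳 : Set (E d)) (J : Set ℝ) : Set (E d → ℝ) :=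
  {p | Measurable p ∧ (∀ x ∈ 𝒳, p x ∈ J) ∧ MemLp p 2 (volume.restrict 𝒳)}

/-- The functional `T(p, q) = φ (∫ ν(p, q))`. -/
def T {d : ℕ} (𝒳 : Set (E d)) (φ : ℝ → ℝ) (ν : ℝ × ℝ → ℝ) (p q : E d → ℝ) : ℝ :=
  φ (∫ x in 𝒳, ν (p x, q x))

/-- `h` is Lipschitz and twice differentiable with bounded second derivative on `S`
(differentiability is understood on an open neighbourhood of `S`). -/
def IsRegularOn {V : Type*} [NormedAddCommGroup V] [NormedSpace ℝ V] (h : V → ℝ) (S : Set V) :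
    Prop :=
  (∃ C : ℝ≥0, LipschitzOnWith C h S) ∧
  (∃ U : Set V, IsOpen U ∧ S ⊆ U ∧ DifferentiableOn ℝ h U ∧ DifferentiableOn ℝ (fderiv ℝ h) U) ∧
  ∃ C : ℝ, ∀ z ∈ S, ‖fderiv ℝ (fderiv ℝ h) z‖ ≤ C

/-- `ν` is regular on the square of the value range `J` of the densities and their estimates,
and `φ` is regular on an interval which contains all the integrals `∫ ν(p, q)`. -/
def IsRegularFunctional {d : ℕ} (𝒳 : Set (E d)) (J : Set ℝ) (φ : ℝ → ℝ) (ν : ℝ × ℝ → ℝ) : Prop :=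
  IsRegularOn ν (J ×ˢ J) ∧
  ∃ I : Set ℝ, I.OrdConnected ∧ IsRegularOn φ I ∧
    ∀ p ∈ Admissible 𝒳 J, ∀ q ∈ Admissible 𝒳 J, ∫ x in 𝒳, ν (p x, q x) ∈ I

/-- `ψ` is the influence function of `T` in the first argument: for every probability density `q`
the Gateaux derivative of `T(·, p₂)` at `p₁` in the direction `q - p₁` is `∫ ψ(x; p₁, p₂) q(x) dx`.
(The base point `p₁` need not integrate to one, as is the case for density estimates.) -/
def IsInfluenceFst {d : ℕ} (𝒳 : Set (E d)) (J : Set ℝ) (φ : ℝ → ℝ) (ν : ℝ × ℝ → ℝ)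
    (ψ : (E d → ℝ) → (E d → ℝ) → E d → ℝ) : Prop :=
  ∀ p₁ ∈ Admissible 𝒳 J, ∀ p₂ ∈ Admissible 𝒳 J, ∀ q ∈ Admissible 𝒳 J, IsDensity 𝒳 q →
    IntegrableOn (fun x => ψ p₁ p₂ x * q x) 𝒳 ∧
    HasDerivAt (fun t : ℝ => T 𝒳 φ ν (p₁ + t • (q - p₁)) p₂) (∫ x in 𝒳, ψ p₁ p₂ x * q x) 0

/-- `ψ` is the influence function of `T` in the second argument. -/
def IsInfluenceSnd {d : ℕ} (𝒳 : Set (E d)) (J : Set ℝ) (φ : ℝ → ℝ) (ν : ℝ × ℝ → ℝ)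
    (ψ : (E d → ℝ) → (E d → ℝ) → E d → ℝ) : Prop :=
  ∀ p₁ ∈ Admissible 𝒳 J, ∀ p₂ ∈ Admissible 𝒳 J, ∀ q ∈ Admissible 𝒳 J, IsDensity 𝒳 q →
    IntegrableOn (fun x => ψ p₁ p₂ x * q x) 𝒳 ∧
    HasDerivAt (fun t : ℝ => T 𝒳 φ ν p₁ (p₂ + t • (q - p₂))) (∫ x in 𝒳, ψ p₁ p₂ x * q x) 0

/-- Influence functions are determined only up to null sets, so a choice of versions for all
`(p, q)` has to be measurable jointly in the point and in any parameter on which `p` and `q`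
depend measurably (here: the data). -/
def JointlyMeasurable {d : ℕ} (𝒳 : Set (E d)) (J : Set ℝ)
    (ψ : (E d → ℝ) → (E d → ℝ) → E d → ℝ) : Prop :=
  ∀ (Θ : Type) [MeasurableSpace Θ] (p q : Θ → E d → ℝ),
    Measurable (fun z : Θ × E d => p z.1 z.2) → Measurable (fun z : Θ × E d => q z.1 z.2) →
    (∀ θ, p θ ∈ Admissible 𝒳 J) → (∀ θ, q θ ∈ Admissible 𝒳 J) →
    Measurable (fun z : Θ × E d => ψ (p z.1) (q z.1) z.2)

/-- Regularity of an influence function at `(f, g)`, with the expectation under the density `e`: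
`𝔼ₑ[(ψ(X; f', g') - ψ(X; f, g))²] = O(‖f - f'‖² + ‖g - g'‖²)` as `‖f - f'‖², ‖g - g'‖² → 0`. -/
def InfluenceRegular {d : ℕ} (𝒳 : Set (E d)) (J : Set ℝ)
    (ψ : (E d → ℝ) → (E d → ℝ) → E d → ℝ) (f g e : E d → ℝ) : Prop :=
  ∃ C δ : ℝ, 0 < δ ∧ ∀ f' ∈ Admissible 𝒳 J, ∀ g' ∈ Admissible 𝒳 J,
    sqDist 𝒳 f f' < δ → sqDist 𝒳 g g' < δ →
    ∫⁻ x, ENNReal.ofReal ((ψ f' g' x - ψ f g x) ^ 2) ∂(law 𝒳 e)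
      ≤ ENNReal.ofReal (C * (sqDist 𝒳 f f' + sqDist 𝒳 g g'))

/-! ### Kernel density estimators -/

/-- A smoothing kernel of order `⌊s⌋` for functions on `𝒳` which are smooth on `𝒮 ⊇ 𝒳`.

The kernel `K h t u` may depend on the bandwidth `h` and on the point `t`, so that it can be adapted
to the boundary of `𝒮`. For `𝒮 = ℝᵈ` and `K h t u = K₀ u` these are the usual conditions on a
convolution kernel: `K₀ ∈ L¹ ∩ L²`, `∫ ‖u‖ˢ |K₀ u| < ∞`, `∫ K₀ = 1`, and the moments of orders
`1, …, ⌊s⌋` of `K₀` vanish. -/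
structure IsSmoothingKernel {d : ℕ} (s : ℝ) (𝒳 𝒮 : Set (E d)) (K : ℝ → E d → E d → ℝ) : Prop where
  measurable : ∀ h, Measurable (fun z : E d × E d => K h z.1 z.2)
  envelope : ∃ κ : E d → ℝ, Integrable κ ∧ Integrable (fun u => κ u ^ 2) ∧
    Integrable (fun u => ‖u‖ ^ s * κ u) ∧ ∀ h > 0, ∀ t ∈ 𝒳, ∀ u, |K h t u| ≤ κ u
  moments : ∃ h₀ > 0, ∀ h, 0 < h → h ≤ h₀ → ∀ t ∈ 𝒳,
    ∀ r : Fin d → ℕ, ∑ i, r i ≤ ⌊s⌋₊ →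
      ∫ u in {u | t - h • u ∈ 𝒮}, (∏ i, u i ^ r i) * K h t u = if r = 0 then 1 else 0
  /-- The kernel only joins points of `𝒮` that see each other inside `𝒮`
  (no condition if `𝒮` is convex). -/
  visible : ∃ h₀ > 0, ∀ h, 0 < h → h ≤ h₀ → ∀ t ∈ 𝒳, ∀ u,
    t - h • u ∈ 𝒮 → K h t u ≠ 0 → segment ℝ t (t - h • u) ⊆ 𝒮

/-- The bandwidth is of the exact order `n ^ (-1 / (2 s + d))`. -/
def IsOptimalBandwidth (d : ℕ) (s : ℝ) (b : ℕ → ℝ) : Prop :=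
  ∃ c C : ℝ, 0 < c ∧ ∀ n : ℕ, 1 ≤ n →
    c * (n : ℝ) ^ (-1 / (2 * s + d)) ≤ b n ∧ b n ≤ C * (n : ℝ) ^ (-1 / (2 * s + d))

/-- The kernel density estimate from the sample points `x i`, `i ∈ A`:
`t ↦ 1 / (k hᵈ) * ∑ i ∈ A, K ((t - x i) / h)`, where `k = #A` and `h = b k`. -/
def kde {d : ℕ} (K : ℝ → E d → E d → ℝ) (b : ℕ → ℝ) (A : Finset ℕ) (x : ℕ → E d) (t : E d) : ℝ :=
  1 / ((A.card : ℝ) * b A.card ^ d) *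
    ∑ i ∈ A, K (b A.card) t ((b A.card)⁻¹ • (t - x i))

/-- The density estimate: the kernel estimate, truncated from below at `B'` and from above at `B`
if `trunc` is true, and the kernel estimate itself otherwise. -/
def densEst {d : ℕ} (trunc : Bool) (B' B : ℝ) (K : ℝ → E d → E d → ℝ) (b : ℕ → ℝ)
    (A : Finset ℕ) (x : ℕ → E d) (t : E d) : ℝ :=
  if trunc then max B' (min B (kde K b A x t)) else kde K b A x t

/-- The range of the values of the densities and of their estimates. -/
def valueRange (trunc : Bool) (B' B : ℝ) : Set ℝ :=
  if trunc then Set.Icc B' B else Set.univ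

/-! ### The data-split estimator -/

/-- The preliminary estimator: the density estimates `F x`, `G y` are computed from the sample points
with indices in `A`, `A'`, and the influence functions are averaged over those in `C`, `C'`. -/
def dsPrelim {d : ℕ} (𝒳 : Set (E d)) (φ : ℝ → ℝ) (ν : ℝ × ℝ → ℝ)
    (ψf ψg : (E d → ℝ) → (E d → ℝ) → E d → ℝ)
    (F G : Finset ℕ → (ℕ → E d) → E d → ℝ) (A C A' C' : Finset ℕ) (x y : ℕ → E d) : ℝ :=
  T 𝒳 φ ν (F A x) (G A' y)
    + 1 / (C.card : ℝ) * ∑ i ∈ C, ψf (F A x) (G A' y) (x i)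
    + 1 / (C'.card : ℝ) * ∑ j ∈ C', ψg (F A x) (G A' y) (y j)

/-- The data-split estimator from `x 0, …, x (n - 1)` and `y 0, …, y (m - 1)`: the average of the
preliminary estimator and of the one with the roles of the two halves of the samples swapped. -/
def dsEstimator {d : ℕ} (𝒳 : Set (E d)) (φ : ℝ → ℝ) (ν : ℝ × ℝ → ℝ)
    (ψf ψg : (E d → ℝ) → (E d → ℝ) → E d → ℝ)
    (F G : Finset ℕ → (ℕ → E d) → E d → ℝ) (n m : ℕ) (x y : ℕ → E d) : ℝ :=
  (dsPrelim 𝒳 φ ν ψf ψg F G (Finset.range (n / 2)) (Finset.Ico (n / 2) n)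
      (Finset.range (m / 2)) (Finset.Ico (m / 2) m) x y
    + dsPrelim 𝒳 φ ν ψf ψg F G (Finset.Ico (n / 2) n) (Finset.range (n / 2))
      (Finset.Ico (m / 2) m) (Finset.range (m / 2)) x y) / 2

end VonMises

end

noncomputable section

namespace VonMises

/-! ### First and second order bounds for regular functions -/

section Regular

variable {V : Type*} [NormedAddCommGroup V] [NormedSpace ℝ V]

/-! The data-split estimator is one Newton step. Expand `T` at the estimate and evaluate the
expansion at the truth: the linear terms are the integrals of the influence functions at the
estimate against `f` and `g`. Hence `T` at the estimate plus these two integrals misses `T(f, g)`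
only by a multiple of the squared `L²` errors (`FunctionalBounds.abs_vonMises_le`). The estimator
replaces the integrals by averages over the other half of the data, which is independent of the
estimate. Such an average minus its integral is the average of `ψ(·; f, g)`, which is centered, plus
the fluctuation of the average of the increment `ψ(·; f̂, ĝ) - ψ(·; f, g)`. Conditionally on the
estimate, the latter has variance of order squared `L²` error over sample size
(`lintegral_sq_average_sub_le`).

With `r n = n ^ (-2s / (2s + d))`, the estimator is therefore `T(f, g)` plus an average of centered
independent variables plus an error with mean square of order `(r n)² + (r m)² + (1/n + 1/m)(r n + r
m)`, up to terms `1/n²` and `1/m²` (`SplitSetting.exists_lintegral_sq_dsEstimator_sub_le`). The mean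
squared error follows directly. For `s > d/2` the error is negligible at the scale `1/√N`, and the
central limit theorem for the two independent averages gives the limit law.

Three points need work. A quadratic remainder in mean square calls for the second moment of the
squared `L²` error. After centering, that error is a degenerate quadratic form in the sample, whose
second moment is computed by conditioning (`lintegral_sq_integral_sq_sum_le`), while its bias comes
from Taylor expansion (`IsSmoothingKernel.abs_bias_le`). Next, the regularity of the influence
functions is assumed only near the truth. It becomes global because densities near `f` separate
integrable functions: this identifies the influence function as a bounded weight minus a constant,
so that it is bounded with controlled growth (`influenceBounds_of_ae_sq_le`). Finally, the halves
may have unequal sizes, which perturbs the weights of the full average by `O(1/n²)`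
(`exists_half_weights`). -/

lemma abs_sub_sub_fderiv_le {h : V → ℝ} {S U : Set V} {C : ℝ} (hS : Convex ℝ S)
    (hU : IsOpen U) (hSU : S ⊆ U) (h1 : DifferentiableOn ℝ h U)
    (h2 : DifferentiableOn ℝ (fderiv ℝ h) U) (hC : ∀ z ∈ S, ‖fderiv ℝ (fderiv ℝ h) z‖ ≤ C)
    {a b : V} (ha : a ∈ S) (hb : b ∈ S) :
    |h b - h a - fderiv ℝ h a (b - a)| ≤ C * ‖b - a‖ ^ 2 := by
  have hseg : segment ℝ a b ⊆ S := hS.segment_subset ha hb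
  have hC0 : 0 ≤ C := le_trans (norm_nonneg (fderiv ℝ (fderiv ℝ h) a)) (hC a ha)
  have hd1 : ∀ z ∈ S, HasFDerivAt h (fderiv ℝ h z) z := fun z hz =>
    ((h1 z (hSU hz)).differentiableAt (hU.mem_nhds (hSU hz))).hasFDerivAt
  have hd2 : ∀ z ∈ S, HasFDerivAt (fderiv ℝ h) (fderiv ℝ (fderiv ℝ h) z) z := fun z hz =>
    ((h2 z (hSU hz)).differentiableAt (hU.mem_nhds (hSU hz))).hasFDerivAt
  -- On the segment the derivative stays within `C * ‖b - a‖` of its value at `a`; the mean value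
  -- inequality costs one more factor `‖b - a‖`. The factor 1/2 of Taylor's formula is given up.
  have hlip : ∀ z ∈ segment ℝ a b, ‖fderiv ℝ h z - fderiv ℝ h a‖ ≤ C * ‖b - a‖ := by
    intro z hz
    have := hS.norm_image_sub_le_of_norm_hasFDerivWithin_le
      (fun x hx => (hd2 x hx).hasFDerivWithinAt) hC ha (hseg hz)
    refine this.trans (mul_le_mul_of_nonneg_left ?_ hC0)
    obtain ⟨t, ht, rfl⟩ := (segment_eq_image' ℝ a b ▸ hz : z ∈ (fun θ : ℝ => a + θ • (b - a)) '' _)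
    simp only [add_sub_cancel_left, norm_smul, Real.norm_eq_abs, abs_of_nonneg ht.1]
    exact mul_le_of_le_one_left (norm_nonneg _) ht.2
  have := (convex_segment a b).norm_image_sub_le_of_norm_hasFDerivWithin_le'
    (fun x hx => (hd1 x (hseg hx)).hasFDerivWithinAt) hlip (left_mem_segment ℝ a b)
    (right_mem_segment ℝ a b)
  rw [Real.norm_eq_abs] at this
  calc _ ≤ _ := this
    _ = _ := by ring

/-- The Lipschitz bound holds only on `S`, which may have empty interior, so it controls the
derivative only in directions pointing into `S`: the difference quotients towards `b` are formed
inside `S`. -/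
lemma abs_fderiv_sub_le {h : V → ℝ} {S : Set V} {C : ℝ} (hS : Convex ℝ S)
    (hL : ∀ a ∈ S, ∀ b ∈ S, |h b - h a| ≤ C * ‖b - a‖)
    {a b : V} (ha : a ∈ S) (hb : b ∈ S) (hd : DifferentiableAt ℝ h a) :
    |fderiv ℝ h a (b - a)| ≤ C * ‖b - a‖ := by
  have h1 : HasDerivAt (fun t : ℝ => h (a + t • (b - a))) (fderiv ℝ h a (b - a)) 0 := by
    have h2 : HasDerivAt (fun t : ℝ => a + t • (b - a)) (b - a) 0 := by
      simpa using ((hasDerivAt_id (0 : ℝ)).smul_const (b - a)).const_add a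
    have h3 : HasFDerivAt h (fderiv ℝ h a) (a + (0 : ℝ) • (b - a)) := by
      simpa using hd.hasFDerivAt
    exact h3.comp_hasDerivAt (0 : ℝ) h2
  have h4 : Tendsto (fun t : ℝ => |t⁻¹ * (h (a + t • (b - a)) - h a)|) (𝓝[>] 0)
      (𝓝 |fderiv ℝ h a (b - a)|) := by
    have h5 : 𝓝[>] (0 : ℝ) ≤ 𝓝[≠] 0 := nhdsWithin_mono 0 fun x (hx : 0 < x) => hx.ne'
    have := (hasDerivAt_iff_tendsto_slope_zero.1 h1).mono_left h5
    simpa using this.abs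
  refine le_of_tendsto h4 ?_
  filter_upwards [Ioc_mem_nhdsGT (zero_lt_one' ℝ)] with t ht
  have hmem : a + t • (b - a) ∈ S :=
    hS.segment_subset ha hb (segment_eq_image' ℝ a b ▸ ⟨t, ⟨ht.1.le, ht.2⟩, rfl⟩)
  have := hL a ha _ hmem
  rw [add_sub_cancel_left, norm_smul, Real.norm_eq_abs, abs_of_pos ht.1] at this
  rw [abs_mul, abs_inv, abs_of_pos ht.1, inv_mul_le_iff₀ ht.1]
  linarith

/-- Lipschitz, Taylor and directional derivative bounds of a regular function on a convex set,
with a common constant. -/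
structure RegularBounds (h : V → ℝ) (S : Set V) (C : ℝ) : Prop where
  nonneg : 0 ≤ C
  lipschitz : ∀ a ∈ S, ∀ b ∈ S, |h b - h a| ≤ C * ‖b - a‖
  taylor : ∀ a ∈ S, ∀ b ∈ S, |h b - h a - fderiv ℝ h a (b - a)| ≤ C * ‖b - a‖ ^ 2
  directional : ∀ a ∈ S, ∀ b ∈ S, |fderiv ℝ h a (b - a)| ≤ C * ‖b - a‖

lemma IsRegularOn.exists_bounds {h : V → ℝ} {S : Set V} (hS : Convex ℝ S)
    (hh : IsRegularOn h S) : ∃ C, RegularBounds h S C := by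
  obtain ⟨⟨C₁, hC₁⟩, ⟨U, hU, hSU, hd1, hd2⟩, C₂, hC₂⟩ := hh
  have hL : ∀ a ∈ S, ∀ b ∈ S, |h b - h a| ≤ max (C₁ : ℝ) C₂ * ‖b - a‖ := fun a ha b hb => by
    have := hC₁.dist_le_mul b hb a ha
    rw [Real.dist_eq, dist_eq_norm] at this
    exact this.trans (mul_le_mul_of_nonneg_right (le_max_left _ _) (norm_nonneg _))
  refine ⟨max C₁ C₂, le_max_of_le_left C₁.2, hL, fun a ha b hb => ?_, fun a ha b hb => ?_⟩
  · exact (abs_sub_sub_fderiv_le hS hU hSU hd1 hd2 hC₂ ha hb).trans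
      (mul_le_mul_of_nonneg_right (le_max_right _ _) (by positivity))
  · exact abs_fderiv_sub_le hS hL ha hb
      ((hd1 a (hSU ha)).differentiableAt (hU.mem_nhds (hSU ha)))

/-- A function satisfying a Lipschitz bound on `S` agrees on `S` with a continuous function. -/
lemma RegularBounds.exists_continuous_eqOn {h : V → ℝ} {S : Set V} {C : ℝ}
    (hb : RegularBounds h S C) : ∃ h' : V → ℝ, Continuous h' ∧ Set.EqOn h h' S := by
  have : LipschitzOnWith ⟨C, hb.nonneg⟩ h S := LipschitzOnWith.of_dist_le_mul fun x hx y hy => by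
    rw [Real.dist_eq, dist_eq_norm]
    exact hb.lipschitz y hy x hx
  obtain ⟨h', hh', he⟩ := this.extend_real
  exact ⟨h', hh'.continuous, he⟩

/-- A second point of `S` supplies an admissible direction. On a one-point set the Lipschitz bound
is void, and the derivative at that point serves as its own bound. -/
lemma RegularBounds.exists_abs_fderiv_one_le {h : ℝ → ℝ} {S : Set ℝ} {C : ℝ}
    (hb : RegularBounds h S C) : ∃ D, 0 ≤ D ∧ ∀ a ∈ S, |fderiv ℝ h a 1| ≤ D := by
  rcases S.subsingleton_or_nontrivial with hS | hS
  · rcases S.eq_empty_or_nonempty with rfl | ⟨c, hc⟩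
    · exact ⟨0, le_rfl, by simp⟩
    · exact ⟨|fderiv ℝ h c 1|, abs_nonneg _, fun a ha => by rw [hS ha hc]⟩
  · refine ⟨C, hb.nonneg, fun a ha => ?_⟩
    obtain ⟨b, hbS, hba⟩ := hS.exists_ne a
    have h1 := hb.directional a ha b hbS
    have h2 : fderiv ℝ h a (b - a) = (b - a) * fderiv ℝ h a 1 := by
      rw [← smul_eq_mul, ← map_smul, smul_eq_mul, mul_one]
    rw [h2, abs_mul, mul_comm, Real.norm_eq_abs] at h1
    exact le_of_mul_le_mul_right h1 (abs_pos.2 (sub_ne_zero.2 hba))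

/-- Moving one coordinate to another value in `J` is an admissible direction; its length cancels,
and a coordinate vector has sup norm one. -/
lemma RegularBounds.abs_fderiv_prod_le {h : ℝ × ℝ → ℝ} {J : Set ℝ} {C : ℝ}
    (hb : RegularBounds h (J ×ˢ J) C) (hJ : J.Nontrivial) {z : ℝ × ℝ} (hz : z ∈ J ×ˢ J) :
    |fderiv ℝ h z (1, 0)| ≤ C ∧ |fderiv ℝ h z (0, 1)| ≤ C := by
  constructor
  · obtain ⟨b, hbJ, hba⟩ := hJ.exists_ne z.1
    have h1 := hb.directional z hz (b, z.2) ⟨hbJ, hz.2⟩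
    have h2 : ((b, z.2) : ℝ × ℝ) - z = (b - z.1) • ((1, 0) : ℝ × ℝ) := by
      ext <;> simp
    rw [h2, map_smul, norm_smul, smul_eq_mul, abs_mul, mul_left_comm, Real.norm_eq_abs] at h1
    have h3 := le_of_mul_le_mul_left h1 (abs_pos.2 (sub_ne_zero.2 hba))
    simpa [Prod.norm_def] using h3
  · obtain ⟨b, hbJ, hba⟩ := hJ.exists_ne z.2
    have h1 := hb.directional z hz (z.1, b) ⟨hz.1, hbJ⟩
    have h2 : ((z.1, b) : ℝ × ℝ) - z = (b - z.2) • ((0, 1) : ℝ × ℝ) := by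
      ext <;> simp
    rw [h2, map_smul, norm_smul, smul_eq_mul, abs_mul, mul_left_comm, Real.norm_eq_abs] at h1
    have h3 := le_of_mul_le_mul_left h1 (abs_pos.2 (sub_ne_zero.2 hba))
    simpa [Prod.norm_def] using h3

end Regular

/-! ### Elementary facts on finite measures -/

/-- Cauchy–Schwarz against the constant one: with total mass `m` and integral `I`, expand `0 ≤ ∫ (m
u - I)² = m (m ∫ u² - I²)`. The case `m = 0` is separate. -/
lemma sq_integral_le {α : Type*} [MeasurableSpace α] {μ : Measure α} [IsFiniteMeasure μ]
    {u : α → ℝ} (hu : MemLp u 2 μ) : (∫ x, u x ∂μ) ^ 2 ≤ μ.real Set.univ * ∫ x, u x ^ 2 ∂μ := by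
  have h1 : Integrable u μ := hu.integrable (by norm_num)
  have h2 : Integrable (fun x => u x ^ 2) μ := hu.integrable_sq
  set I := ∫ x, u x ∂μ with hI
  set m := μ.real Set.univ with hm
  have h3 : 0 ≤ ∫ x, (m * u x - I) ^ 2 ∂μ := integral_nonneg fun x => sq_nonneg _
  have h4 : ∫ x, (m * u x - I) ^ 2 ∂μ = m ^ 2 * (∫ x, u x ^ 2 ∂μ) - m * I ^ 2 := by
    have : ∀ x, (m * u x - I) ^ 2 = m ^ 2 * u x ^ 2 - (2 * m * I) * u x + I ^ 2 := fun x => by ring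
    simp_rw [this]
    have h5 := h2.const_mul (m ^ 2)
    have h6 := h1.const_mul (2 * m * I)
    rw [integral_add (h5.sub' h6) (integrable_const _), integral_sub h5 h6, integral_const_mul, integral_const_mul,
      integral_const, smul_eq_mul, ← hI, ← hm]
    ring
  rcases (measureReal_nonneg (μ := μ) (s := Set.univ)).eq_or_lt with h0 | h0
  · have : μ = 0 := by
      rw [← Measure.measure_univ_eq_zero]
      exact (measureReal_eq_zero_iff).1 h0.symm
    simp [hI, this]
  · rw [← hm] at h0
    nlinarith [(mul_pos h0 h0)]

/-! ### Second order expansion of the functional -/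

lemma RegularBounds.mono {V : Type*} [NormedAddCommGroup V] [NormedSpace ℝ V] {h : V → ℝ}
    {S : Set V} {C C' : ℝ} (hb : RegularBounds h S C) (hC : C ≤ C') : RegularBounds h S C' where
  nonneg := hb.nonneg.trans hC
  lipschitz a ha b hb' := (hb.lipschitz a ha b hb').trans (by gcongr)
  taylor a ha b hb' := (hb.taylor a ha b hb').trans (by gcongr)
  directional a ha b hb' := (hb.directional a ha b hb').trans (by gcongr)

/-- The quantitative content of `IsRegularFunctional`. -/
structure FunctionalBounds {d : ℕ} (𝒳 : Set (E d)) (J : Set ℝ) (φ : ℝ → ℝ) (ν : ℝ × ℝ → ℝ)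
    (I : Set ℝ) (C : ℝ) : Prop where
  measurableSet : MeasurableSet 𝒳
  finite : IsFiniteMeasure (volume.restrict 𝒳)
  convex : Convex ℝ J
  nontrivial : J.Nontrivial
  inner : RegularBounds ν (J ×ˢ J) C
  outer : RegularBounds φ I C
  outer_deriv : ∀ a ∈ I, |fderiv ℝ φ a 1| ≤ C
  integral_mem : ∀ p ∈ Admissible 𝒳 J, ∀ q ∈ Admissible 𝒳 J, ∫ x in 𝒳, ν (p x, q x) ∈ I

lemma convex_valueRange (trunc : Bool) (B' B : ℝ) : Convex ℝ (valueRange trunc B' B) := by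
  unfold valueRange
  split_ifs
  exacts [convex_Icc _ _, convex_univ]

lemma nontrivial_valueRange (trunc : Bool) {B' B : ℝ} (h : B' < B) :
    (valueRange trunc B' B).Nontrivial :=
  ⟨B', by unfold valueRange; split_ifs <;> simp [h.le], B,
    by unfold valueRange; split_ifs <;> simp [h.le], h.ne⟩

lemma IsRegularFunctional.exists_bounds {d : ℕ} {𝒳 : Set (E d)} {J : Set ℝ} {φ : ℝ → ℝ}
    {ν : ℝ × ℝ → ℝ} (h𝒳 : IsCompact 𝒳) (hJ : Convex ℝ J) (hJ' : J.Nontrivial)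
    (hT : IsRegularFunctional 𝒳 J φ ν) : ∃ I C, FunctionalBounds 𝒳 J φ ν I C := by
  obtain ⟨hν, I, hI, hφ, hmem⟩ := hT
  obtain ⟨C₁, hC₁⟩ := hν.exists_bounds (hJ.prod hJ)
  obtain ⟨C₂, hC₂⟩ := hφ.exists_bounds hI.convex
  obtain ⟨C₃, hC₃, hD⟩ := hC₂.exists_abs_fderiv_one_le
  exact ⟨I, max C₁ (max C₂ C₃), h𝒳.measurableSet, isFiniteMeasure_restrict.2 h𝒳.measure_ne_top,
    hJ, hJ', hC₁.mono (le_max_left _ _), hC₂.mono (le_max_of_le_right (le_max_left _ _)),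
    fun a ha => (hD a ha).trans (le_max_of_le_right (le_max_right _ _)), hmem⟩

section Expansion

variable {d : ℕ} {𝒳 : Set (E d)} {J : Set ℝ} {φ : ℝ → ℝ} {ν : ℝ × ℝ → ℝ} {I : Set ℝ} {C : ℝ}

lemma add_smul_sub_mem_admissible (hJ : Convex ℝ J) {p q : E d → ℝ} (hp : p ∈ Admissible 𝒳 J)
    (hq : q ∈ Admissible 𝒳 J) {t : ℝ} (ht0 : 0 ≤ t) (ht1 : t ≤ 1) :
    p + t • (q - p) ∈ Admissible 𝒳 J := by
  refine ⟨hp.1.add ((hq.1.sub hp.1).const_smul t), fun x hx => ?_,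
    hp.2.2.add ((hq.2.2.sub hp.2.2).const_smul t)⟩
  refine hJ.segment_subset (hp.2.1 x hx) (hq.2.1 x hx) ?_
  rw [segment_eq_image' ℝ (p x) (q x)]
  exact ⟨t, ⟨ht0, ht1⟩, rfl⟩

namespace FunctionalBounds

/-- Measurability of `ν` is not available off `J ×ˢ J`, so it is borrowed from a continuous
extension. Lipschitz growth from a base point `(j, j)` reduces integrability to that of `p` and `q`
on a set of finite measure. -/
lemma integrable_comp (H : FunctionalBounds 𝒳 J φ ν I C) {p q : E d → ℝ}
    (hp : p ∈ Admissible 𝒳 J) (hq : q ∈ Admissible 𝒳 J) :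
    IntegrableOn (fun x => ν (p x, q x)) 𝒳 := by
  have := H.finite
  obtain ⟨ν', hν', he⟩ := H.inner.exists_continuous_eqOn
  obtain ⟨j, hj⟩ := H.nontrivial.nonempty
  have hmem : ∀ x ∈ 𝒳, (p x, q x) ∈ J ×ˢ J := fun x hx => ⟨hp.2.1 x hx, hq.2.1 x hx⟩
  have hmeas : AEStronglyMeasurable (fun x => ν (p x, q x)) (volume.restrict 𝒳) := by
    have h1 : Measurable (fun x => ν' (p x, q x)) := hν'.measurable.comp (hp.1.prodMk hq.1)
    refine h1.aestronglyMeasurable.congr ?_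
    exact ae_restrict_of_forall_mem H.measurableSet fun x hx => (he (hmem x hx)).symm
  have hp1 := (hp.2.2.integrable (by norm_num)).abs
  have hq1 := (hq.2.2.integrable (by norm_num)).abs
  have hdom : Integrable (fun x => |ν (j, j)| + C * ((|p x| + |j|) + (|q x| + |j|)))
      (volume.restrict 𝒳) :=
    (integrable_const _).add (((hp1.add (integrable_const _)).add
      (hq1.add (integrable_const _))).const_mul C)
  refine hdom.mono' hmeas (ae_restrict_of_forall_mem H.measurableSet fun x hx => ?_)
  have h1 := H.inner.lipschitz (j, j) ⟨hj, hj⟩ _ (hmem x hx)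
  have h2 : ‖((p x, q x) : ℝ × ℝ) - (j, j)‖ ≤ (|p x| + |j|) + (|q x| + |j|) := by
    rw [Prod.mk_sub_mk, Prod.norm_def]
    refine max_le ?_ ?_
    · exact (abs_sub _ _).trans (le_add_of_nonneg_right (by positivity))
    · exact (abs_sub _ _).trans (le_add_of_nonneg_left (by positivity))
  have h3 := mul_le_mul_of_nonneg_left h2 H.inner.nonneg
  rw [Real.norm_eq_abs]
  have h4 : |ν (p x, q x)| ≤ |ν (j, j)| + |ν (p x, q x) - ν (j, j)| := by
    have := abs_add_le (ν (j, j)) (ν (p x, q x) - ν (j, j))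
    rwa [add_sub_cancel] at this
  linarith

lemma measurable_fderiv_comp {p q : E d → ℝ} (hp : Measurable p) (hq : Measurable q)
    (v : ℝ × ℝ) : Measurable (fun x => fderiv ℝ ν (p x, q x) v) :=
  (measurable_fderiv_apply_const ℝ ν v).comp (hp.prodMk hq)

lemma integrable_fst_mul (H : FunctionalBounds 𝒳 J φ ν I C) {p q w : E d → ℝ}
    (hp : p ∈ Admissible 𝒳 J) (hq : q ∈ Admissible 𝒳 J) (hw : IntegrableOn w 𝒳) :
    IntegrableOn (fun x => fderiv ℝ ν (p x, q x) (1, 0) * w x) 𝒳 :=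
  Integrable.bdd_mul hw (measurable_fderiv_comp hp.1 hq.1 _).aestronglyMeasurable
    (ae_restrict_of_forall_mem H.measurableSet fun x hx =>
      (H.inner.abs_fderiv_prod_le H.nontrivial ⟨hp.2.1 x hx, hq.2.1 x hx⟩).1)

lemma integrable_snd_mul (H : FunctionalBounds 𝒳 J φ ν I C) {p q w : E d → ℝ}
    (hp : p ∈ Admissible 𝒳 J) (hq : q ∈ Admissible 𝒳 J) (hw : IntegrableOn w 𝒳) :
    IntegrableOn (fun x => fderiv ℝ ν (p x, q x) (0, 1) * w x) 𝒳 :=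
  Integrable.bdd_mul hw (measurable_fderiv_comp hp.1 hq.1 _).aestronglyMeasurable
    (ae_restrict_of_forall_mem H.measurableSet fun x hx =>
      (H.inner.abs_fderiv_prod_le H.nontrivial ⟨hp.2.1 x hx, hq.2.1 x hx⟩).2)

/-- First order expansion of `T` with a quadratic remainder. -/
lemma abs_T_sub_sub_le (H : FunctionalBounds 𝒳 J φ ν I C) {p₁ p₂ q₁ q₂ : E d → ℝ}
    (hp₁ : p₁ ∈ Admissible 𝒳 J) (hp₂ : p₂ ∈ Admissible 𝒳 J)
    (hq₁ : q₁ ∈ Admissible 𝒳 J) (hq₂ : q₂ ∈ Admissible 𝒳 J) :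
    |T 𝒳 φ ν q₁ q₂ - T 𝒳 φ ν p₁ p₂ - fderiv ℝ φ (∫ x in 𝒳, ν (p₁ x, p₂ x)) 1 *
        ((∫ x in 𝒳, fderiv ℝ ν (p₁ x, p₂ x) (1, 0) * (q₁ x - p₁ x))
          + ∫ x in 𝒳, fderiv ℝ ν (p₁ x, p₂ x) (0, 1) * (q₂ x - p₂ x))|
      ≤ (2 * C ^ 3 * volume.real 𝒳 + C ^ 2) * (sqDist 𝒳 q₁ p₁ + sqDist 𝒳 q₂ p₂) := by
  have := H.finite
  have hC := H.inner.nonneg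
  have hip := H.integrable_comp hp₁ hp₂
  have hiq := H.integrable_comp hq₁ hq₂
  have hL₁ : MemLp (fun x => q₁ x - p₁ x) 2 (volume.restrict 𝒳) := hq₁.2.2.sub hp₁.2.2
  have hL₂ : MemLp (fun x => q₂ x - p₂ x) 2 (volume.restrict 𝒳) := hq₂.2.2.sub hp₂.2.2
  have hd₁ := H.integrable_fst_mul hp₁ hp₂ (hL₁.integrable (by norm_num))
  have hd₂ := H.integrable_snd_mul hp₁ hp₂ (hL₂.integrable (by norm_num))
  have hs₁ := hL₁.integrable_sq
  have hs₂ := hL₂.integrable_sq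
  have hsum : sqDist 𝒳 q₁ p₁ + sqDist 𝒳 q₂ p₂
      = ∫ x in 𝒳, ((q₁ x - p₁ x) ^ 2 + (q₂ x - p₂ x) ^ 2) := (integral_add hs₁ hs₂).symm
  set S := sqDist 𝒳 q₁ p₁ + sqDist 𝒳 q₂ p₂
  set a := ∫ x in 𝒳, ν (p₁ x, p₂ x) with ha
  set b := ∫ x in 𝒳, ν (q₁ x, q₂ x) with hb
  set ℓ := (∫ x in 𝒳, fderiv ℝ ν (p₁ x, p₂ x) (1, 0) * (q₁ x - p₁ x))
          + ∫ x in 𝒳, fderiv ℝ ν (p₁ x, p₂ x) (0, 1) * (q₂ x - p₂ x) with hℓ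
  have hpm : ∀ x ∈ 𝒳, (p₁ x, p₂ x) ∈ J ×ˢ J := fun x hx => ⟨hp₁.2.1 x hx, hp₂.2.1 x hx⟩
  have hqm : ∀ x ∈ 𝒳, (q₁ x, q₂ x) ∈ J ×ˢ J := fun x hx => ⟨hq₁.2.1 x hx, hq₂.2.1 x hx⟩
  have hnorm : ∀ x, ‖((q₁ x, q₂ x) : ℝ × ℝ) - (p₁ x, p₂ x)‖ ≤ |q₁ x - p₁ x| + |q₂ x - p₂ x| :=
    fun x => by
      rw [Prod.mk_sub_mk, Prod.norm_def]
      exact max_le (le_add_of_nonneg_right (abs_nonneg _)) (le_add_of_nonneg_left (abs_nonneg _))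
  have hnorm2 : ∀ x, ‖((q₁ x, q₂ x) : ℝ × ℝ) - (p₁ x, p₂ x)‖ ^ 2
      ≤ (q₁ x - p₁ x) ^ 2 + (q₂ x - p₂ x) ^ 2 := fun x => by
    rw [Prod.mk_sub_mk, Prod.norm_def]
    rcases max_choice ‖q₁ x - p₁ x‖ ‖q₂ x - p₂ x‖ with h | h
    all_goals
      rw [h, Real.norm_eq_abs, sq_abs]
      nlinarith [sq_nonneg (q₁ x - p₁ x), sq_nonneg (q₂ x - p₂ x)]
  have hu : MemLp (fun x => |q₁ x - p₁ x| + |q₂ x - p₂ x|) 2 (volume.restrict 𝒳) :=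
    hL₁.abs.add hL₂.abs
  -- first order bound
  have hab : (b - a) ^ 2 ≤ 2 * C ^ 2 * volume.real 𝒳 * S := by
    have h1 : |b - a| ≤ C * ∫ x in 𝒳, (|q₁ x - p₁ x| + |q₂ x - p₂ x|) := by
      rw [ha, hb, ← integral_sub hiq hip, ← integral_const_mul]
      refine (abs_integral_le_integral_abs).trans (integral_mono_ae (hiq.sub' hip).abs
        ((hu.integrable (by norm_num)).const_mul C)
        (ae_restrict_of_forall_mem H.measurableSet fun x hx => ?_))
      exact (H.inner.lipschitz _ (hpm x hx) _ (hqm x hx)).trans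
        (mul_le_mul_of_nonneg_left (hnorm x) hC)
    have h2 := sq_integral_le hu
    have h3 : ∫ x in 𝒳, (|q₁ x - p₁ x| + |q₂ x - p₂ x|) ^ 2 ≤ 2 * S := by
      rw [hsum, ← integral_const_mul]
      refine integral_mono hu.integrable_sq ((hs₁.add hs₂).const_mul 2) fun x => ?_
      simp only
      nlinarith [sq_nonneg (|q₁ x - p₁ x| - |q₂ x - p₂ x|), sq_abs (q₁ x - p₁ x),
        sq_abs (q₂ x - p₂ x)]
    have h4 : (volume.restrict 𝒳).real Set.univ = volume.real 𝒳 := by simp [measureReal_def]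
    rw [h4] at h2
    have h5 : (b - a) ^ 2 ≤ (C * ∫ x in 𝒳, (|q₁ x - p₁ x| + |q₂ x - p₂ x|)) ^ 2 := by
      rw [← sq_abs]; gcongr
    rw [mul_pow] at h5
    calc _ ≤ _ := h5
      _ ≤ C ^ 2 * (volume.real 𝒳 * (2 * S)) := by gcongr; exact h2.trans (by gcongr)
      _ = _ := by ring
  -- second order bound of the inner integral
  have hin : |b - a - ℓ| ≤ C * S := by
    have hdd : IntegrableOn (fun x => fderiv ℝ ν (p₁ x, p₂ x) (1, 0) * (q₁ x - p₁ x)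
        + fderiv ℝ ν (p₁ x, p₂ x) (0, 1) * (q₂ x - p₂ x)) 𝒳 := hd₁.add hd₂
    rw [ha, hb, hℓ, ← integral_sub hiq hip, ← integral_add hd₁ hd₂,
      ← integral_sub (hiq.sub' hip) hdd, hsum, ← integral_const_mul]
    refine (abs_integral_le_integral_abs).trans (integral_mono_ae
      ((hiq.sub' hip).sub' hdd).abs ((hs₁.add hs₂).const_mul C)
      (ae_restrict_of_forall_mem H.measurableSet fun x hx => ?_))
    have h1 := H.inner.taylor _ (hpm x hx) _ (hqm x hx)
    have h2 : fderiv ℝ ν (p₁ x, p₂ x) ((q₁ x, q₂ x) - (p₁ x, p₂ x))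
        = fderiv ℝ ν (p₁ x, p₂ x) (1, 0) * (q₁ x - p₁ x)
          + fderiv ℝ ν (p₁ x, p₂ x) (0, 1) * (q₂ x - p₂ x) := by
      have : ((q₁ x, q₂ x) - (p₁ x, p₂ x) : ℝ × ℝ)
          = (q₁ x - p₁ x) • ((1, 0) : ℝ × ℝ) + (q₂ x - p₂ x) • ((0, 1) : ℝ × ℝ) := by
        ext <;> simp
      rw [this, map_add, map_smul, map_smul, smul_eq_mul, smul_eq_mul]
      ring
    rw [h2] at h1
    exact h1.trans (mul_le_mul_of_nonneg_left (hnorm2 x) hC)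
  have haI : a ∈ I := H.integral_mem _ hp₁ _ hp₂
  have hbI : b ∈ I := H.integral_mem _ hq₁ _ hq₂
  have hout := H.outer.taylor a haI b hbI
  have hlin : fderiv ℝ φ a (b - a) = fderiv ℝ φ a 1 * (b - a) := by
    rw [mul_comm, ← smul_eq_mul, ← map_smul, smul_eq_mul, mul_one]
  rw [hlin, Real.norm_eq_abs, sq_abs] at hout
  -- The Taylor error of `φ` is at most `C (b - a)²`, hence `2 C³ vol S`; the inner linearization
  -- error `C S` is multiplied by a derivative of size at most `C`.
  have hsplit : T 𝒳 φ ν q₁ q₂ - T 𝒳 φ ν p₁ p₂ - fderiv ℝ φ a 1 * ℓ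
      = (φ b - φ a - fderiv ℝ φ a 1 * (b - a)) + fderiv ℝ φ a 1 * (b - a - ℓ) := by
    simp only [T, ← ha, ← hb]; ring
  rw [hsplit]
  calc _ ≤ _ := abs_add_le _ _
    _ ≤ C * (2 * C ^ 2 * volume.real 𝒳 * S) + C * (C * S) := by
      rw [abs_mul]
      refine add_le_add (hout.trans (mul_le_mul_of_nonneg_left hab hC)) ?_
      exact mul_le_mul (H.outer_deriv a haI) hin (abs_nonneg _) hC
    _ = _ := by ring

end FunctionalBounds

/-- A derivative is determined by a one-sided quadratic approximation. -/
lemma _root_.HasDerivAt.eq_of_abs_sub_sub_le {Φ : ℝ → ℝ} {D D' K : ℝ} (h : HasDerivAt Φ D 0)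
    (hK : ∀ t ∈ Set.Ioc (0 : ℝ) 1, |Φ t - Φ 0 - t * D'| ≤ K * t ^ 2) : D = D' := by
  have h5 : 𝓝[>] (0 : ℝ) ≤ 𝓝[≠] 0 := nhdsWithin_mono 0 fun x (hx : 0 < x) => hx.ne'
  have h1 := (hasDerivAt_iff_tendsto_slope_zero.1 h).mono_left h5
  refine tendsto_nhds_unique h1 (tendsto_iff_norm_sub_tendsto_zero.2 ?_)
  have h2 : Tendsto (fun t : ℝ => K * t) (𝓝[>] 0) (𝓝 0) := by
    have : Tendsto (fun t : ℝ => K * t) (𝓝 0) (𝓝 (K * 0)) := tendsto_id.const_mul K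
    rw [mul_zero] at this
    exact this.mono_left nhdsWithin_le_nhds
  refine squeeze_zero' (Eventually.of_forall fun _ => norm_nonneg _) ?_ h2
  filter_upwards [Ioc_mem_nhdsGT (zero_lt_one' ℝ)] with t ht
  have h3 := hK t ht
  have h4 : t⁻¹ • (Φ (0 + t) - Φ 0) - D' = t⁻¹ * (Φ t - Φ 0 - t * D') := by
    have := ht.1.ne'
    simp only [zero_add, smul_eq_mul]
    field_simp
  rw [h4, norm_mul, norm_inv, Real.norm_eq_abs, Real.norm_eq_abs, abs_of_pos ht.1,
    inv_mul_le_iff₀ ht.1]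
  linarith

lemma sqDist_segment (p q : E d → ℝ) (t : ℝ) :
    sqDist 𝒳 (p + t • (q - p)) p = t ^ 2 * sqDist 𝒳 q p := by
  simp only [sqDist, ← integral_const_mul]
  congr 1 with x
  simp
  ring

lemma sqDist_self (p : E d → ℝ) : sqDist 𝒳 p p = 0 := by simp [sqDist]

lemma sqDist_nonneg (p q : E d → ℝ) : 0 ≤ sqDist 𝒳 p q := integral_nonneg fun _ => sq_nonneg _

/-- The Gateaux derivative and the linear term of the expansion describe the same function of `t` at
zero. The expansion is available only for `0 ≤ t ≤ 1`, where the path is admissible by convexity;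
this suffices because the derivative is known to exist. -/
lemma IsInfluenceFst.integral_eq (H : FunctionalBounds 𝒳 J φ ν I C)
    {ψ : (E d → ℝ) → (E d → ℝ) → E d → ℝ} (hψ : IsInfluenceFst 𝒳 J φ ν ψ) {p₁ p₂ q : E d → ℝ}
    (hp₁ : p₁ ∈ Admissible 𝒳 J) (hp₂ : p₂ ∈ Admissible 𝒳 J) (hq : q ∈ Admissible 𝒳 J)
    (hqd : IsDensity 𝒳 q) :
    ∫ x in 𝒳, ψ p₁ p₂ x * q x = fderiv ℝ φ (∫ x in 𝒳, ν (p₁ x, p₂ x)) 1 *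
        ∫ x in 𝒳, fderiv ℝ ν (p₁ x, p₂ x) (1, 0) * (q x - p₁ x) := by
  refine (hψ p₁ hp₁ p₂ hp₂ q hq hqd).2.eq_of_abs_sub_sub_le
    (K := (2 * C ^ 3 * volume.real 𝒳 + C ^ 2) * sqDist 𝒳 q p₁) fun t ht => ?_
  have h1 := H.abs_T_sub_sub_le hp₁ hp₂ (add_smul_sub_mem_admissible H.convex hp₁ hq ht.1.le ht.2) hp₂
  rw [sqDist_segment, sqDist_self, add_zero] at h1
  have h2 : ∫ x in 𝒳, fderiv ℝ ν (p₁ x, p₂ x) (1, 0) * ((p₁ + t • (q - p₁)) x - p₁ x)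
      = t * ∫ x in 𝒳, fderiv ℝ ν (p₁ x, p₂ x) (1, 0) * (q x - p₁ x) := by
    rw [← integral_const_mul]
    congr 1 with x
    simp
    ring
  rw [h2] at h1
  simp only [zero_smul, add_zero, sub_self, mul_zero, integral_zero] at h1 ⊢
  calc _ = _ := by congr 1; ring
    _ ≤ _ := h1
    _ = _ := by ring

lemma IsInfluenceSnd.integral_eq (H : FunctionalBounds 𝒳 J φ ν I C)
    {ψ : (E d → ℝ) → (E d → ℝ) → E d → ℝ} (hψ : IsInfluenceSnd 𝒳 J φ ν ψ) {p₁ p₂ q : E d → ℝ}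
    (hp₁ : p₁ ∈ Admissible 𝒳 J) (hp₂ : p₂ ∈ Admissible 𝒳 J) (hq : q ∈ Admissible 𝒳 J)
    (hqd : IsDensity 𝒳 q) :
    ∫ x in 𝒳, ψ p₁ p₂ x * q x = fderiv ℝ φ (∫ x in 𝒳, ν (p₁ x, p₂ x)) 1 *
        ∫ x in 𝒳, fderiv ℝ ν (p₁ x, p₂ x) (0, 1) * (q x - p₂ x) := by
  refine (hψ p₁ hp₁ p₂ hp₂ q hq hqd).2.eq_of_abs_sub_sub_le
    (K := (2 * C ^ 3 * volume.real 𝒳 + C ^ 2) * sqDist 𝒳 q p₂) fun t ht => ?_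
  have h1 := H.abs_T_sub_sub_le hp₁ hp₂ hp₁ (add_smul_sub_mem_admissible H.convex hp₂ hq ht.1.le ht.2)
  rw [sqDist_segment, sqDist_self, zero_add] at h1
  have h2 : ∫ x in 𝒳, fderiv ℝ ν (p₁ x, p₂ x) (0, 1) * ((p₂ + t • (q - p₂)) x - p₂ x)
      = t * ∫ x in 𝒳, fderiv ℝ ν (p₁ x, p₂ x) (0, 1) * (q x - p₂ x) := by
    rw [← integral_const_mul]
    congr 1 with x
    simp
    ring
  rw [h2] at h1
  simp only [zero_smul, add_zero, zero_add, sub_self, mul_zero, integral_zero] at h1 ⊢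
  calc _ = _ := by congr 1; ring
    _ ≤ _ := h1
    _ = _ := by ring

/-- The von Mises expansion of `T` at an estimate of the densities. -/
lemma FunctionalBounds.abs_vonMises_le (H : FunctionalBounds 𝒳 J φ ν I C)
    {ψf ψg : (E d → ℝ) → (E d → ℝ) → E d → ℝ} (hψf : IsInfluenceFst 𝒳 J φ ν ψf)
    (hψg : IsInfluenceSnd 𝒳 J φ ν ψg) {f g p₁ p₂ : E d → ℝ}
    (hf : f ∈ Admissible 𝒳 J) (hg : g ∈ Admissible 𝒳 J) (hfd : IsDensity 𝒳 f)
    (hgd : IsDensity 𝒳 g) (hp₁ : p₁ ∈ Admissible 𝒳 J) (hp₂ : p₂ ∈ Admissible 𝒳 J) :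
    |T 𝒳 φ ν p₁ p₂ + (∫ x in 𝒳, ψf p₁ p₂ x * f x) + (∫ x in 𝒳, ψg p₁ p₂ x * g x) - T 𝒳 φ ν f g|
      ≤ (2 * C ^ 3 * volume.real 𝒳 + C ^ 2) * (sqDist 𝒳 f p₁ + sqDist 𝒳 g p₂) := by
  -- The expansion point is the estimate and the evaluation point is the truth. Only the truth has
  -- to be a density for the influence integrals to be the linear terms.
  rw [hψf.integral_eq H hp₁ hp₂ hf hfd, hψg.integral_eq H hp₁ hp₂ hg hgd, abs_sub_comm]
  calc _ = _ := by congr 1; ring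
    _ ≤ _ := H.abs_T_sub_sub_le hp₁ hp₂ hf hg

end Expansion

/-! ### Bounded continuous densities -/

/-- A continuous density on a compact set, with values strictly between `B'` and `B`. -/
structure IsBoundedDensity {d : ℕ} (𝒳 : Set (E d)) (B' B : ℝ) (f : E d → ℝ) : Prop where
  isCompact : IsCompact 𝒳
  isDensity : IsDensity 𝒳 f
  continuousOn : ContinuousOn f 𝒳
  bounds : ∀ x ∈ 𝒳, B' < f x ∧ f x < B

lemma isBoundedDensity_of_mem_boundedHolderClass {d : ℕ} {s L B' B : ℝ} {𝒳 𝒮 : Set (E d)}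
    {f : E d → ℝ} (h𝒳 : IsCompact 𝒳) (h𝒳𝒮 : 𝒳 ⊆ 𝒮) (hf : f ∈ BoundedHolderClass s L B' B 𝒳 𝒮)
    (hfd : IsDensity 𝒳 f) : IsBoundedDensity 𝒳 B' B f :=
  ⟨h𝒳, hfd, hf.1.1.continuousOn.mono h𝒳𝒮, hf.2⟩

section Density

variable {d : ℕ} {𝒳 : Set (E d)} {B' B : ℝ} {f : E d → ℝ}

namespace IsBoundedDensity

lemma measurable (hf : IsBoundedDensity 𝒳 B' B f) : Measurable f := by
  classical
  have h : 𝒳.piecewise f 0 = f := by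
    ext x
    by_cases hx : x ∈ 𝒳
    · simp [hx]
    · simp [hx, hf.isDensity.2.1 x hx]
  rw [← h]
  exact hf.continuousOn.measurable_piecewise continuousOn_const hf.isCompact.measurableSet

lemma isFiniteMeasure (hf : IsBoundedDensity 𝒳 B' B f) :
    IsFiniteMeasure (volume.restrict 𝒳) := isFiniteMeasure_restrict.2 hf.isCompact.measure_ne_top

lemma nonempty (hf : IsBoundedDensity 𝒳 B' B f) : 𝒳.Nonempty := by
  rw [Set.nonempty_iff_ne_empty]
  rintro rfl
  simpa using hf.isDensity.2.2

lemma volume_ne_zero (hf : IsBoundedDensity 𝒳 B' B f) : volume 𝒳 ≠ 0 := fun h => by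
  have h1 := hf.isDensity.2.2
  rw [Measure.restrict_eq_zero.2 h] at h1
  simp at h1

lemma lt (hf : IsBoundedDensity 𝒳 B' B f) : B' < B := by
  obtain ⟨x, hx⟩ := hf.nonempty
  exact (hf.bounds x hx).1.trans (hf.bounds x hx).2

lemma pos (hf : IsBoundedDensity 𝒳 B' B f) : 0 < B := by
  obtain ⟨x, hx⟩ := hf.nonempty
  exact (hf.isDensity.1 x).trans_lt (hf.bounds x hx).2

lemma abs_apply_le (hf : IsBoundedDensity 𝒳 B' B f) (x : E d) : |f x| ≤ B := by
  rw [abs_of_nonneg (hf.isDensity.1 x)]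
  by_cases hx : x ∈ 𝒳
  · exact (hf.bounds x hx).2.le
  · rw [hf.isDensity.2.1 x hx]; exact hf.pos.le

lemma memLp (hf : IsBoundedDensity 𝒳 B' B f) (p : ℝ≥0∞) : MemLp f p (volume.restrict 𝒳) :=
  have := hf.isFiniteMeasure
  MemLp.of_bound hf.measurable.aestronglyMeasurable B (Eventually.of_forall hf.abs_apply_le)

lemma mem_admissible (hf : IsBoundedDensity 𝒳 B' B f) (trunc : Bool) :
    f ∈ Admissible 𝒳 (valueRange trunc B' B) := by
  refine ⟨hf.measurable, fun x hx => ?_, hf.memLp 2⟩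
  unfold valueRange
  split_ifs
  exacts [⟨(hf.bounds x hx).1.le, (hf.bounds x hx).2.le⟩, trivial]

/-- Compactness makes the strict bounds uniform, which leaves room for perturbations of `f` inside
the value range. -/
lemma exists_margin (hf : IsBoundedDensity 𝒳 B' B f) :
    ∃ ε > 0, ∀ x ∈ 𝒳, B' + ε ≤ f x ∧ f x ≤ B - ε := by
  obtain ⟨a, ha, hamin⟩ := hf.isCompact.exists_isMinOn hf.nonempty hf.continuousOn
  obtain ⟨b, hb, hbmax⟩ := hf.isCompact.exists_isMaxOn hf.nonempty hf.continuousOn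
  refine ⟨min (f a - B') (B - f b), lt_min (sub_pos.2 (hf.bounds a ha).1)
    (sub_pos.2 (hf.bounds b hb).2), fun x hx => ⟨?_, ?_⟩⟩
  · have h1 : f a ≤ f x := hamin hx
    linarith [min_le_left (f a - B') (B - f b)]
  · have h1 : f x ≤ f b := hbmax hx
    linarith [min_le_right (f a - B') (B - f b)]

/-- Small perturbations of `f` towards a bounded density are admissible densities. -/
lemma exists_mixture (hf : IsBoundedDensity 𝒳 B' B f) (trunc : Bool) {r : E d → ℝ}
    (hr : Measurable r) (hrd : IsDensity 𝒳 r) {M : ℝ} (hM : ∀ x, |r x| ≤ M) :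
    ∃ t : ℝ, 0 < t ∧ f + t • (r - f) ∈ Admissible 𝒳 (valueRange trunc B' B) ∧
      IsDensity 𝒳 (f + t • (r - f)) := by
  have := hf.isFiniteMeasure
  obtain ⟨ε, hε, hmargin⟩ := hf.exists_margin
  have hM0 : 0 ≤ M := (abs_nonneg _).trans (hM 0)
  have hB := hf.pos
  have hMB : 0 < M + B + ε := by positivity
  have hdiff : ∀ x, |r x - f x| ≤ M + B := fun x =>
    (abs_sub _ _).trans (add_le_add (hM x) (hf.abs_apply_le x))
  -- This step size keeps the perturbation within the margin `ε`, and it is at most one, so that the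
  -- mixture stays nonnegative.
  have hmp : ∀ x, ε / (M + B + ε) * |r x - f x| ≤ ε := fun x => by
    rw [div_mul_eq_mul_div, div_le_iff₀ hMB]
    exact mul_le_mul_of_nonneg_left ((hdiff x).trans (by linarith)) hε.le
  have ht1 : ε / (M + B + ε) ≤ 1 := (div_le_one hMB).2 (by linarith)
  set t := ε / (M + B + ε) with ht
  have ht0 : 0 < t := by positivity
  have hrL : MemLp r 2 (volume.restrict 𝒳) :=
    MemLp.of_bound hr.aestronglyMeasurable M (Eventually.of_forall hM)
  refine ⟨t, ht0, ⟨hf.measurable.add ((hr.sub hf.measurable).const_smul t), fun x hx => ?_,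
    (hf.memLp 2).add ((hrL.sub (hf.memLp 2)).const_smul t)⟩, fun x => ?_, fun x hx => ?_, ?_⟩
  · unfold valueRange
    split_ifs
    · have h0 : |t * (r x - f x)| ≤ ε := by
        rw [abs_mul, abs_of_pos ht0]; exact hmp x
      have h1 := abs_le.1 h0
      have h2 := hmargin x hx
      simp only [Pi.add_apply, Pi.smul_apply, Pi.sub_apply, smul_eq_mul]
      exact ⟨by linarith [h1.1, h2.1], by linarith [h1.2, h2.2]⟩
    · trivial
  · have h1 := hf.isDensity.1 x
    have h2 := hrd.1 x
    simp only [Pi.add_apply, Pi.smul_apply, Pi.sub_apply, smul_eq_mul]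
    nlinarith [mul_nonneg (sub_nonneg.2 ht1) h1, mul_nonneg ht0.le h2]
  · simp [hf.isDensity.2.1 x hx, hrd.2.1 x hx]
  · have h1 := hrL.integrable (q := 2) (by norm_num)
    have h2 := (hf.memLp 2).integrable (by norm_num)
    have h3 : Integrable (fun x => t * (r x - f x)) (volume.restrict 𝒳) :=
      (h1.sub' h2).const_mul t
    simp only [Pi.add_apply, Pi.smul_apply, Pi.sub_apply, smul_eq_mul]
    rw [integral_add h2 h3, integral_const_mul, integral_sub h1 h2, hf.isDensity.2.2, hrd.2.2]
    simp

/-- Admissible densities separate integrable functions on `𝒳`. -/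
lemma ae_eq_zero_of_forall_density (hf : IsBoundedDensity 𝒳 B' B f) (trunc : Bool)
    {Δ : E d → ℝ} (hΔ : ∀ q ∈ Admissible 𝒳 (valueRange trunc B' B), IsDensity 𝒳 q →
      IntegrableOn (fun x => Δ x * q x) 𝒳 ∧ ∫ x in 𝒳, Δ x * q x = 0) :
    Δ =ᵐ[volume.restrict 𝒳] 0 := by
  have := hf.isFiniteMeasure
  have hmX := hf.isCompact.measurableSet
  have key : ∀ r : E d → ℝ, Measurable r → IsDensity 𝒳 r → (∃ M, ∀ x, |r x| ≤ M) →
      IntegrableOn (fun x => Δ x * r x) 𝒳 ∧ ∫ x in 𝒳, Δ x * r x = 0 := by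
    rintro r hr hrd ⟨M, hM⟩
    obtain ⟨t, ht, hadm, hden⟩ := hf.exists_mixture trunc hr hrd hM
    obtain ⟨hi1, he1⟩ := hΔ _ hadm hden
    obtain ⟨hi0, he0⟩ := hΔ f (hf.mem_admissible trunc) hf.isDensity
    -- Solving the mixture for `r` writes it as a linear combination of two admissible densities;
    -- vanishing integrals thus pass to all bounded densities.
    have heq : (fun x => Δ x * r x)
        = fun x => t⁻¹ * (Δ x * (f + t • (r - f)) x - (1 - t) * (Δ x * f x)) := by
      ext x
      simp only [Pi.add_apply, Pi.smul_apply, Pi.sub_apply, smul_eq_mul]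
      field_simp
      ring
    rw [heq]
    refine ⟨(hi1.sub' (hi0.const_mul (1 - t))).const_mul t⁻¹, ?_⟩
    rw [integral_const_mul, integral_sub hi1 (hi0.const_mul (1 - t)), integral_const_mul, he0, he1]
    simp
  -- Normalized indicators are bounded densities. The choice `A = 𝒳` also yields the integrability
  -- of `Δ` itself, which is not assumed.
  have hind : ∀ A : Set (E d), MeasurableSet A → A ⊆ 𝒳 → volume A ≠ 0 →
      IntegrableOn Δ A ∧ ∫ x in A, Δ x = 0 := by
    intro A hA hAX hA0
    have hAtop : volume A ≠ ∞ := measure_ne_top_of_subset hAX hf.isCompact.measure_ne_top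
    have hv : 0 < volume.real A := ENNReal.toReal_pos hA0 hAtop
    have hrest : (volume.restrict 𝒳).restrict A = volume.restrict A := by
      rw [Measure.restrict_restrict hA, Set.inter_eq_left.2 hAX]
    have hden : IsDensity 𝒳 (A.indicator fun _ => (volume.real A)⁻¹) := by
      refine ⟨fun x => Set.indicator_nonneg (fun _ _ => inv_nonneg.2 hv.le) x, fun x hx =>
        Set.indicator_of_notMem (fun h => hx (hAX h)) _, ?_⟩
      rw [integral_indicator hA, hrest, setIntegral_const, smul_eq_mul, mul_inv_cancel₀ hv.ne']
    have hbd : ∀ x, |A.indicator (fun _ => (volume.real A)⁻¹) x| ≤ (volume.real A)⁻¹ := fun x => by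
      by_cases hx : x ∈ A
      · simp [hx, abs_of_pos (inv_pos.2 hv)]
      · simp [hx, hv.le]
    obtain ⟨h1, h2⟩ := key _ (measurable_const.indicator hA) hden ⟨_, hbd⟩
    have heq : (fun x => Δ x * A.indicator (fun _ => (volume.real A)⁻¹) x)
        = A.indicator fun x => Δ x * (volume.real A)⁻¹ := by
      ext x
      by_cases hx : x ∈ A <;> simp [hx]
    rw [heq] at h1 h2
    rw [IntegrableOn, integrable_indicator_iff hA, IntegrableOn, hrest] at h1
    rw [integral_indicator hA, hrest, integral_mul_const] at h2
    have h3 := h1.mul_const (volume.real A)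
    simp only [mul_assoc, inv_mul_cancel₀ hv.ne', mul_one] at h3
    exact ⟨h3, (mul_eq_zero.1 h2).resolve_right (inv_ne_zero hv.ne')⟩
  have hint : IntegrableOn Δ 𝒳 := (hind 𝒳 hmX subset_rfl hf.volume_ne_zero).1
  refine Integrable.ae_eq_zero_of_forall_setIntegral_eq_zero hint fun A hA _ => ?_
  rw [Measure.restrict_restrict hA]
  by_cases h0 : volume (A ∩ 𝒳) = 0
  · rw [Measure.restrict_eq_zero.2 h0, integral_zero_measure]
  · exact (hind _ (hA.inter hmX) Set.inter_subset_right h0).2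

/-- A function which represents the linear functional `q ↦ ∫ w (q - p)` on the admissible
densities is determined almost everywhere. -/
lemma ae_eq_of_forall_density (hf : IsBoundedDensity 𝒳 B' B f) (trunc : Bool)
    {ψ w p : E d → ℝ} {W : ℝ} (hw : Measurable w) (hW : ∀ x ∈ 𝒳, |w x| ≤ W)
    (hp : IntegrableOn p 𝒳)
    (hψ : ∀ q ∈ Admissible 𝒳 (valueRange trunc B' B), IsDensity 𝒳 q →
      IntegrableOn (fun x => ψ x * q x) 𝒳 ∧ ∫ x in 𝒳, ψ x * q x = ∫ x in 𝒳, w x * (q x - p x)) :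
    ψ =ᵐ[volume.restrict 𝒳] fun x => w x - ∫ y in 𝒳, w y * p y := by
  have := hf.isFiniteMeasure
  have hWae : ∀ᵐ x ∂(volume.restrict 𝒳), ‖w x‖ ≤ W :=
    ae_restrict_of_forall_mem hf.isCompact.measurableSet hW
  have hwp := Integrable.bdd_mul hp hw.aestronglyMeasurable hWae
  set c := ∫ y in 𝒳, w y * p y with hc
  -- Since `q` has mass one, `∫ w (q - p) = ∫ (w - c) q`.
  have h0 : (fun x => ψ x - (w x - c)) =ᵐ[volume.restrict 𝒳] 0 := by
    refine hf.ae_eq_zero_of_forall_density trunc fun q hq hqd => ?_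
    obtain ⟨h1, h2⟩ := hψ q hq hqd
    have hqi := hq.2.2.integrable (q := 2) (by norm_num)
    have hwq := Integrable.bdd_mul hqi hw.aestronglyMeasurable hWae
    have heq : (fun x => (ψ x - (w x - c)) * q x) = fun x => ψ x * q x - (w x * q x - c * q x) := by
      ext x; ring
    have h3 : Integrable (fun x => w x * q x - c * q x) (volume.restrict 𝒳) :=
      hwq.sub' (hqi.const_mul c)
    rw [heq]
    refine ⟨h1.sub' h3, ?_⟩
    simp only [mul_sub] at h2
    rw [integral_sub hwq hwp] at h2
    rw [integral_sub h1 h3, integral_sub hwq (hqi.const_mul c), integral_const_mul, hqd.2.2, h2]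
    ring
  filter_upwards [h0] with x hx
  simpa [sub_eq_zero] using hx

/-- Such a function is bounded, with a bound of at most linear growth in `p`. -/
lemma ae_sq_le_of_forall_density (hf : IsBoundedDensity 𝒳 B' B f) (trunc : Bool)
    {ψ w p : E d → ℝ} {W : ℝ} (hw : Measurable w) (hW : ∀ x ∈ 𝒳, |w x| ≤ W)
    (hp : p ∈ Admissible 𝒳 (valueRange trunc B' B))
    (hψ : ∀ q ∈ Admissible 𝒳 (valueRange trunc B' B), IsDensity 𝒳 q →
      IntegrableOn (fun x => ψ x * q x) 𝒳 ∧ ∫ x in 𝒳, ψ x * q x = ∫ x in 𝒳, w x * (q x - p x)) :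
    ∀ᵐ x ∂(volume.restrict 𝒳),
      ψ x ^ 2 ≤ 2 * W ^ 2 * (1 + volume.real 𝒳 * (2 * (volume.real 𝒳 * B ^ 2))
        + 2 * volume.real 𝒳 * sqDist 𝒳 f p) := by
  have := hf.isFiniteMeasure
  have hB := hf.pos
  have hvol : (volume.restrict 𝒳).real Set.univ = volume.real 𝒳 := by simp [measureReal_def]
  have hW0 : 0 ≤ W := by
    obtain ⟨x, hx⟩ := hf.nonempty
    exact (abs_nonneg _).trans (hW x hx)
  have hpi := hp.2.2.integrable (q := 2) (by norm_num)
  have hWae : ∀ᵐ x ∂(volume.restrict 𝒳), ‖w x‖ ≤ W :=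
    ae_restrict_of_forall_mem hf.isCompact.measurableSet hW
  have hwpL : MemLp (fun x => w x * p x) 2 (volume.restrict 𝒳) :=
    MemLp.of_le_mul (c := W) hp.2.2 (hw.aestronglyMeasurable.mul hp.2.2.1)
      (hWae.mono fun x hx => by rw [norm_mul]; gcongr)
  have hsq : Integrable (fun x => (f x - p x) ^ 2) (volume.restrict 𝒳) :=
    ((hf.memLp 2).sub hp.2.2).integrable_sq
  have h1 := sq_integral_le hwpL
  have h2 : ∫ x in 𝒳, (w x * p x) ^ 2
      ≤ W ^ 2 * (2 * (volume.real 𝒳 * B ^ 2) + 2 * sqDist 𝒳 f p) := by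
    have h3 : Integrable (fun x => W ^ 2 * (2 * B ^ 2 + 2 * (f x - p x) ^ 2))
        (volume.restrict 𝒳) := ((integrable_const _).add (hsq.const_mul 2)).const_mul _
    calc _ ≤ ∫ x in 𝒳, W ^ 2 * (2 * B ^ 2 + 2 * (f x - p x) ^ 2) := by
          refine integral_mono_ae hwpL.integrable_sq h3 (hWae.mono fun x hx => ?_)
          simp only [mul_pow]
          have h4 : w x ^ 2 ≤ W ^ 2 := sq_le_sq' (abs_le.1 hx).1 (abs_le.1 hx).2
          have h5 : p x ^ 2 ≤ 2 * B ^ 2 + 2 * (f x - p x) ^ 2 := by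
            have h6 : f x ^ 2 ≤ B ^ 2 :=
              sq_le_sq' (abs_le.1 (hf.abs_apply_le x)).1 (abs_le.1 (hf.abs_apply_le x)).2
            nlinarith [sq_nonneg (p x - 2 * f x)]
          exact mul_le_mul h4 h5 (sq_nonneg _) (sq_nonneg _)
      _ = _ := by
          rw [integral_const_mul, integral_add (integrable_const _) (hsq.const_mul 2),
            integral_const, integral_const_mul, hvol, sqDist, smul_eq_mul]
          ring
  filter_upwards [hf.ae_eq_of_forall_density trunc hw hW hpi hψ, hWae] with x hx hwx
  rw [hx]
  set c := ∫ y in 𝒳, w y * p y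
  rw [hvol] at h1
  have h4 : w x ^ 2 ≤ W ^ 2 := sq_le_sq' (abs_le.1 hwx).1 (abs_le.1 hwx).2
  -- Cauchy–Schwarz for `c = ∫ w p`. As `ψ = w - c` almost everywhere, `ψ² ≤ 2 w² + 2 c²` gives the
  -- stated constant.
  have h5 : c ^ 2 ≤ volume.real 𝒳 * (W ^ 2 * (2 * (volume.real 𝒳 * B ^ 2) + 2 * sqDist 𝒳 f p)) :=
    h1.trans (mul_le_mul_of_nonneg_left h2 measureReal_nonneg)
  nlinarith [sq_nonneg (w x + c)]

end IsBoundedDensity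

/-! ### The law with a bounded density -/

lemma integral_law (hf : IsBoundedDensity 𝒳 B' B f) (F : E d → ℝ) :
    ∫ x, F x ∂(law 𝒳 f) = ∫ x in 𝒳, F x * f x := by
  rw [law, integral_withDensity_eq_integral_toReal_smul hf.measurable.ennreal_ofReal
    (Eventually.of_forall fun _ => ENNReal.ofReal_lt_top)]
  congr 1 with x
  rw [ENNReal.toReal_ofReal (hf.isDensity.1 x), smul_eq_mul, mul_comm]

lemma isProbabilityMeasure_law (hf : IsBoundedDensity 𝒳 B' B f) :
    IsProbabilityMeasure (law 𝒳 f) := by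
  constructor
  have := hf.isFiniteMeasure
  rw [law, withDensity_apply _ MeasurableSet.univ, Measure.restrict_univ,
    ← ofReal_integral_eq_lintegral_ofReal ((hf.memLp 2).integrable (by norm_num))
      (Eventually.of_forall hf.isDensity.1), hf.isDensity.2.2, ENNReal.ofReal_one]

lemma law_absolutelyContinuous : law 𝒳 f ≪ volume.restrict 𝒳 :=
  withDensity_absolutelyContinuous _ _

/-! ### Global bounds on influence functions -/

variable {trunc : Bool} {φ : ℝ → ℝ} {ν : ℝ × ℝ → ℝ} {I : Set ℝ} {C : ℝ}

lemma FunctionalBounds.abs_weight_le {J : Set ℝ} (H : FunctionalBounds 𝒳 J φ ν I C)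
    {p₁ p₂ : E d → ℝ} (hp₁ : p₁ ∈ Admissible 𝒳 J) (hp₂ : p₂ ∈ Admissible 𝒳 J) {x : E d}
    (hx : x ∈ 𝒳) :
    |fderiv ℝ φ (∫ x in 𝒳, ν (p₁ x, p₂ x)) 1 * fderiv ℝ ν (p₁ x, p₂ x) (1, 0)| ≤ C ^ 2 ∧
    |fderiv ℝ φ (∫ x in 𝒳, ν (p₁ x, p₂ x)) 1 * fderiv ℝ ν (p₁ x, p₂ x) (0, 1)| ≤ C ^ 2 := by
  have h1 := H.outer_deriv _ (H.integral_mem _ hp₁ _ hp₂)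
  have h2 := H.inner.abs_fderiv_prod_le H.nontrivial
    (z := (p₁ x, p₂ x)) ⟨hp₁.2.1 x hx, hp₂.2.1 x hx⟩
  rw [abs_mul, abs_mul, pow_two]
  exact ⟨mul_le_mul h1 h2.1 (abs_nonneg _) H.inner.nonneg,
    mul_le_mul h1 h2.2 (abs_nonneg _) H.inner.nonneg⟩

/-- The influence function is a weight minus a constant, the weight being `φ'` times a partial
derivative of `ν` and so at most `C ^ 2`. The constant depends on `p₁`, which has no uniform bound
without truncation; this causes the growth in `sqDist`. -/
lemma IsInfluenceFst.exists_ae_sq_le (hf : IsBoundedDensity 𝒳 B' B f)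
    (H : FunctionalBounds 𝒳 (valueRange trunc B' B) φ ν I C)
    {ψ : (E d → ℝ) → (E d → ℝ) → E d → ℝ}
    (hψ : IsInfluenceFst 𝒳 (valueRange trunc B' B) φ ν ψ) :
    ∃ M, 0 ≤ M ∧ ∀ p₁ ∈ Admissible 𝒳 (valueRange trunc B' B),
      ∀ p₂ ∈ Admissible 𝒳 (valueRange trunc B' B),
        ∀ᵐ x ∂(volume.restrict 𝒳), ψ p₁ p₂ x ^ 2 ≤ M * (1 + sqDist 𝒳 f p₁) := by
  have hv : 0 ≤ volume.real 𝒳 := measureReal_nonneg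
  refine ⟨2 * (C ^ 2) ^ 2 * (1 + volume.real 𝒳 * (2 * (volume.real 𝒳 * B ^ 2)) + 2 * volume.real 𝒳),
    by positivity, fun p₁ hp₁ p₂ hp₂ => ?_⟩
  have h := hf.ae_sq_le_of_forall_density trunc (ψ := ψ p₁ p₂)
    (w := fun x => fderiv ℝ φ (∫ x in 𝒳, ν (p₁ x, p₂ x)) 1 * fderiv ℝ ν (p₁ x, p₂ x) (1, 0))
    ((FunctionalBounds.measurable_fderiv_comp hp₁.1 hp₂.1 _).const_mul _)
    (fun x hx => (H.abs_weight_le hp₁ hp₂ hx).1) hp₁ fun q hq hqd =>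
      ⟨(hψ p₁ hp₁ p₂ hp₂ q hq hqd).1, by
        rw [hψ.integral_eq H hp₁ hp₂ hq hqd, ← integral_const_mul]
        simp only [mul_assoc]⟩
  filter_upwards [h] with x hx
  have hD := sqDist_nonneg (𝒳 := 𝒳) f p₁
  refine hx.trans ?_
  rw [mul_assoc _ _ (1 + sqDist 𝒳 f p₁)]
  refine mul_le_mul_of_nonneg_left ?_ (by positivity)
  have : 0 ≤ volume.real 𝒳 * (2 * (volume.real 𝒳 * B ^ 2)) := by positivity
  nlinarith [mul_nonneg this hD]

lemma IsInfluenceSnd.exists_ae_sq_le (hf : IsBoundedDensity 𝒳 B' B f)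
    (H : FunctionalBounds 𝒳 (valueRange trunc B' B) φ ν I C)
    {ψ : (E d → ℝ) → (E d → ℝ) → E d → ℝ}
    (hψ : IsInfluenceSnd 𝒳 (valueRange trunc B' B) φ ν ψ) :
    ∃ M, 0 ≤ M ∧ ∀ p₁ ∈ Admissible 𝒳 (valueRange trunc B' B),
      ∀ p₂ ∈ Admissible 𝒳 (valueRange trunc B' B),
        ∀ᵐ x ∂(volume.restrict 𝒳), ψ p₁ p₂ x ^ 2 ≤ M * (1 + sqDist 𝒳 f p₂) := by
  have hv : 0 ≤ volume.real 𝒳 := measureReal_nonneg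
  refine ⟨2 * (C ^ 2) ^ 2 * (1 + volume.real 𝒳 * (2 * (volume.real 𝒳 * B ^ 2)) + 2 * volume.real 𝒳),
    by positivity, fun p₁ hp₁ p₂ hp₂ => ?_⟩
  have h := hf.ae_sq_le_of_forall_density trunc (ψ := ψ p₁ p₂)
    (w := fun x => fderiv ℝ φ (∫ x in 𝒳, ν (p₁ x, p₂ x)) 1 * fderiv ℝ ν (p₁ x, p₂ x) (0, 1))
    ((FunctionalBounds.measurable_fderiv_comp hp₁.1 hp₂.1 _).const_mul _)
    (fun x hx => (H.abs_weight_le hp₁ hp₂ hx).2) hp₂ fun q hq hqd =>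
      ⟨(hψ p₁ hp₁ p₂ hp₂ q hq hqd).1, by
        rw [hψ.integral_eq H hp₁ hp₂ hq hqd, ← integral_const_mul]
        simp only [mul_assoc]⟩
  filter_upwards [h] with x hx
  have hD := sqDist_nonneg (𝒳 := 𝒳) f p₂
  refine hx.trans ?_
  rw [mul_assoc _ _ (1 + sqDist 𝒳 f p₂)]
  refine mul_le_mul_of_nonneg_left ?_ (by positivity)
  have : 0 ≤ volume.real 𝒳 * (2 * (volume.real 𝒳 * B ^ 2)) := by positivity
  nlinarith [mul_nonneg this hD]

/-- The properties of an influence function on which the analysis of its averages relies: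
it is bounded, centered at the true densities, and mean square Lipschitz (globally). -/
structure InfluenceBounds (𝒳 : Set (E d)) (J : Set ℝ)
    (ψ : (E d → ℝ) → (E d → ℝ) → E d → ℝ) (f g e : E d → ℝ) (M : ℝ) : Prop where
  nonneg : 0 ≤ M
  ae_bounded : ∀ p₁ ∈ Admissible 𝒳 J, ∀ p₂ ∈ Admissible 𝒳 J,
    ∃ R, ∀ᵐ x ∂(law 𝒳 e), |ψ p₁ p₂ x| ≤ R
  lipschitz : ∀ p₁ ∈ Admissible 𝒳 J, ∀ p₂ ∈ Admissible 𝒳 J,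
    ∫⁻ x, ENNReal.ofReal ((ψ p₁ p₂ x - ψ f g x) ^ 2) ∂(law 𝒳 e)
      ≤ ENNReal.ofReal (M * (sqDist 𝒳 f p₁ + sqDist 𝒳 g p₂))
  centered : ∫ x, ψ f g x ∂(law 𝒳 e) = 0

/-- The regularity assumption is local, but an untruncated estimate can be far from the truth. Once
the total squared distance `S` is at least `δ`, the growth bound `M (1 + S)` is itself a multiple of
`S`, because `1 ≤ S / δ`. -/
lemma influenceBounds_of_ae_sq_le {J : Set ℝ} {g e : E d → ℝ}
    (he : IsBoundedDensity 𝒳 B' B e) {ψ : (E d → ℝ) → (E d → ℝ) → E d → ℝ} {M : ℝ} (hM : 0 ≤ M)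
    (hf : f ∈ Admissible 𝒳 J) (hg : g ∈ Admissible 𝒳 J)
    (h : ∀ p₁ ∈ Admissible 𝒳 J, ∀ p₂ ∈ Admissible 𝒳 J, ∀ᵐ x ∂(volume.restrict 𝒳),
      ψ p₁ p₂ x ^ 2 ≤ M * (1 + (sqDist 𝒳 f p₁ + sqDist 𝒳 g p₂)))
    (hreg : InfluenceRegular 𝒳 J ψ f g e) (hcent : ∫ x in 𝒳, ψ f g x * e x = 0) :
    ∃ M, InfluenceBounds 𝒳 J ψ f g e M := by
  have := isProbabilityMeasure_law he
  obtain ⟨C, δ, hδ, hC⟩ := hreg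
  refine ⟨max C (4 * M * (1 / δ + 1)), le_max_of_le_right (by positivity), fun p₁ hp₁ p₂ hp₂ => ?_,
    fun p₁ hp₁ p₂ hp₂ => ?_, by rw [integral_law he, hcent]⟩
  · refine ⟨√(M * (1 + (sqDist 𝒳 f p₁ + sqDist 𝒳 g p₂))), ?_⟩
    filter_upwards [law_absolutelyContinuous.ae_le (h p₁ hp₁ p₂ hp₂)] with x hx
    exact Real.abs_le_sqrt hx
  · have hD₁ := sqDist_nonneg (𝒳 := 𝒳) f p₁
    have hD₂ := sqDist_nonneg (𝒳 := 𝒳) g p₂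
    by_cases hnear : sqDist 𝒳 f p₁ < δ ∧ sqDist 𝒳 g p₂ < δ
    · refine (hC p₁ hp₁ p₂ hp₂ hnear.1 hnear.2).trans (ENNReal.ofReal_le_ofReal ?_)
      exact mul_le_mul_of_nonneg_right (le_max_left _ _) (by positivity)
    · have hfar : δ ≤ sqDist 𝒳 f p₁ + sqDist 𝒳 g p₂ := by
        by_contra hlt
        exact hnear ⟨by linarith, by linarith⟩
      set S := sqDist 𝒳 f p₁ + sqDist 𝒳 g p₂ with hS
      have h0 := h f hf g hg
      rw [sqDist_self, sqDist_self] at h0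
      have hbound : ∀ᵐ x ∂(law 𝒳 e), ENNReal.ofReal ((ψ p₁ p₂ x - ψ f g x) ^ 2)
          ≤ ENNReal.ofReal (4 * M * (1 / δ + 1) * S) := by
        filter_upwards [law_absolutelyContinuous.ae_le (h p₁ hp₁ p₂ hp₂),
          law_absolutelyContinuous.ae_le h0] with x hx hx0
        refine ENNReal.ofReal_le_ofReal ?_
        have h1 : 1 ≤ 1 / δ * S := by
          rw [one_div, ← div_eq_inv_mul]; exact (one_le_div hδ).2 hfar
        have h2 : (ψ p₁ p₂ x - ψ f g x) ^ 2 ≤ 2 * ψ p₁ p₂ x ^ 2 + 2 * ψ f g x ^ 2 := by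
          nlinarith [sq_nonneg (ψ p₁ p₂ x + ψ f g x)]
        have h3 : M * 1 ≤ M * (1 / δ * S) := mul_le_mul_of_nonneg_left h1 hM
        have h4 : 0 ≤ M * S := by positivity
        linarith
      calc _ ≤ ∫⁻ _, ENNReal.ofReal (4 * M * (1 / δ + 1) * S) ∂(law 𝒳 e) := lintegral_mono_ae hbound
        _ = ENNReal.ofReal (4 * M * (1 / δ + 1) * S) := by simp
        _ ≤ _ := ENNReal.ofReal_le_ofReal
          (mul_le_mul_of_nonneg_right (le_max_right _ _) (by positivity))

lemma IsInfluenceFst.exists_influenceBounds {g : E d → ℝ} (hf : IsBoundedDensity 𝒳 B' B f)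
    (hg : IsBoundedDensity 𝒳 B' B g)
    (H : FunctionalBounds 𝒳 (valueRange trunc B' B) φ ν I C)
    {ψ : (E d → ℝ) → (E d → ℝ) → E d → ℝ}
    (hψ : IsInfluenceFst 𝒳 (valueRange trunc B' B) φ ν ψ)
    (hreg : InfluenceRegular 𝒳 (valueRange trunc B' B) ψ f g f) :
    ∃ M, InfluenceBounds 𝒳 (valueRange trunc B' B) ψ f g f M := by
  obtain ⟨M, hM, h⟩ := hψ.exists_ae_sq_le hf H
  refine influenceBounds_of_ae_sq_le hf hM (hf.mem_admissible _) (hg.mem_admissible _)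
    (fun p₁ hp₁ p₂ hp₂ => (h p₁ hp₁ p₂ hp₂).mono fun x hx => hx.trans ?_) hreg ?_
  · have := sqDist_nonneg (𝒳 := 𝒳) g p₂
    gcongr
    linarith
  -- Centering: at the truth, the derivative in the direction `f - f = 0` vanishes.
  · rw [hψ.integral_eq H (hf.mem_admissible _) (hg.mem_admissible _) (hf.mem_admissible _)
      hf.isDensity]
    simp

lemma IsInfluenceSnd.exists_influenceBounds {g : E d → ℝ} (hf : IsBoundedDensity 𝒳 B' B f)
    (hg : IsBoundedDensity 𝒳 B' B g)
    (H : FunctionalBounds 𝒳 (valueRange trunc B' B) φ ν I C)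
    {ψ : (E d → ℝ) → (E d → ℝ) → E d → ℝ}
    (hψ : IsInfluenceSnd 𝒳 (valueRange trunc B' B) φ ν ψ)
    (hreg : InfluenceRegular 𝒳 (valueRange trunc B' B) ψ f g g) :
    ∃ M, InfluenceBounds 𝒳 (valueRange trunc B' B) ψ f g g M := by
  obtain ⟨M, hM, h⟩ := hψ.exists_ae_sq_le hg H
  refine influenceBounds_of_ae_sq_le hg hM (hf.mem_admissible _) (hg.mem_admissible _)
    (fun p₁ hp₁ p₂ hp₂ => (h p₁ hp₁ p₂ hp₂).mono fun x hx => hx.trans ?_) hreg ?_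
  · have := sqDist_nonneg (𝒳 := 𝒳) f p₁
    gcongr
    linarith
  · rw [hψ.integral_eq H (hf.mem_admissible _) (hg.mem_admissible _) (hg.mem_admissible _)
      hg.isDensity]
    simp

end Density

/-! ### Taylor expansion in Hölder classes -/

/-- Taylor's theorem on `[0, 1]`, with the remainder bounded by the oscillation of the derivative of
order `k`. -/
lemma abs_sub_taylor_le (k : ℕ) (g : ℕ → ℝ → ℝ) {M : ℝ}
    (hg : ∀ j < k, ∀ τ ∈ Set.Icc (0 : ℝ) 1,
      HasDerivWithinAt (g j) (g (j + 1) τ) (Set.Icc 0 1) τ)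
    (hM : ∀ τ ∈ Set.Icc (0 : ℝ) 1, |g k τ - g k 0| ≤ M) :
    ∀ τ ∈ Set.Icc (0 : ℝ) 1,
      |g 0 τ - ∑ j ∈ Finset.range (k + 1), g j 0 * (τ ^ j / (j.factorial : ℝ))| ≤ M := by
  induction k generalizing g with
  | zero => simpa using hM
  | succ k ih =>
    -- The derivative of the remainder is the remainder of the shifted family, bounded by `M`. The
    -- mean value inequality on an interval of length one preserves `M`; the factorial is not
    -- needed.
    have h1 := ih (fun j => g (j + 1)) (fun j hj => hg (j + 1) (by omega)) hM
    intro τ hτ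
    have hM0 : 0 ≤ M := (abs_nonneg _).trans (hM τ hτ)
    have hmono : ∀ (j : ℕ) (x : ℝ), HasDerivAt
        (fun τ : ℝ => g (j + 1) 0 * (τ ^ (j + 1) / ((j + 1).factorial : ℝ)))
        (g (j + 1) 0 * (x ^ j / (j.factorial : ℝ))) x := by
      intro j x
      have h2 := (((hasDerivAt_pow (j + 1) x).div_const ((j + 1).factorial : ℝ)).const_mul
        (g (j + 1) 0))
      have h3 : ((j + 1 : ℕ) : ℝ) * x ^ (j + 1 - 1) / ((j + 1).factorial : ℝ) = x ^ j / (j.factorial : ℝ) := by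
        rw [Nat.add_sub_cancel, Nat.factorial_succ, Nat.cast_mul, mul_div_mul_left _ _ (by positivity)]
      rw [h3] at h2
      exact h2
    have hr : ∀ x ∈ Set.Icc (0 : ℝ) 1, HasDerivWithinAt
        (fun τ => g 0 τ - ∑ j ∈ Finset.range (k + 2), g j 0 * (τ ^ j / (j.factorial : ℝ)))
        (g 1 x - ∑ j ∈ Finset.range (k + 1), g (j + 1) 0 * (x ^ j / (j.factorial : ℝ)))
        (Set.Icc 0 1) x := by
      intro x hx
      refine (hg 0 (by omega) x hx).sub ?_
      have h4 : (fun τ : ℝ => ∑ j ∈ Finset.range (k + 2), g j 0 * (τ ^ j / (j.factorial : ℝ)))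
          = fun τ => (∑ j ∈ Finset.range (k + 1),
              g (j + 1) 0 * (τ ^ (j + 1) / ((j + 1).factorial : ℝ))) + g 0 0 := by
        ext τ
        rw [Finset.sum_range_succ']
        simp
      rw [h4]
      exact ((HasDerivAt.fun_sum fun j _ => hmono j x).add_const _).hasDerivWithinAt
    have h5 := (convex_Icc (0 : ℝ) 1).norm_image_sub_le_of_norm_hasDerivWithin_le hr h1
      (Set.left_mem_Icc.2 zero_le_one) hτ
    have h6 : g 0 0 - ∑ j ∈ Finset.range (k + 2), g j 0 * ((0 : ℝ) ^ j / (j.factorial : ℝ)) = 0 := by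
      rw [Finset.sum_range_succ']
      simp
    rw [h6, sub_zero, sub_zero, Real.norm_eq_abs, Real.norm_eq_abs, abs_of_nonneg hτ.1] at h5
    exact h5.trans (mul_le_of_le_one_right hM0 hτ.2)

variable {d : ℕ}

/-- Expansion of a multilinear form on the diagonal in the standard basis. -/
lemma multilinear_diag_eq_sum {k : ℕ} (A : ContinuousMultilinearMap ℝ (fun _ : Fin k => E d) ℝ)
    (v : E d) :
    A (fun _ => v) = ∑ J : Fin k → Fin d,
      (∏ i, v (J i)) * A (fun i => EuclideanSpace.single (J i) (1 : ℝ)) := by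
  have hv : v = ∑ c, v c • EuclideanSpace.single c (1 : ℝ) := by
    have := (EuclideanSpace.basisFun (Fin d) ℝ).sum_repr v
    simpa using this.symm
  conv_lhs => rw [hv]
  rw [ContinuousMultilinearMap.map_sum]
  refine Finset.sum_congr rfl fun J _ => ?_
  rw [ContinuousMultilinearMap.map_smul_univ, smul_eq_mul]

lemma abs_apply_le_norm (v : E d) (c : Fin d) : |v c| ≤ ‖v‖ := PiLp.norm_apply_le v c

/-- Along the segment, the derivatives of `f` are its iterated derivatives on the diagonal. The top
one is a sum over `d ^ k` coordinate tuples; each term is a product of `k` coordinates of `v` times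
a partial derivative that oscillates by at most `|L| ‖v‖ ^ (s - k)`. -/
lemma abs_sub_taylor_le_of_mem_holderClass {s L : ℝ} (hs : 0 < s) {𝒮 : Set (E d)} (h𝒮 : UniqueDiffOn ℝ 𝒮)
    {f : E d → ℝ} (hf : f ∈ HolderClass s L 𝒮) {t v : E d} (hseg : segment ℝ t (t + v) ⊆ 𝒮) :
    |f (t + v) - ∑ j ∈ Finset.range (⌊s⌋₊ + 1),
        iteratedFDerivWithin ℝ j f 𝒮 t (fun _ => v) / (j.factorial : ℝ)|
      ≤ (d : ℝ) ^ ⌊s⌋₊ * |L| * ‖v‖ ^ s := by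
  set k := ⌊s⌋₊ with hk
  have hks : (k : ℝ) ≤ s := Nat.floor_le hs.le
  have hline : ∀ τ ∈ Set.Icc (0 : ℝ) 1, t + τ • v ∈ 𝒮 := fun τ hτ => hseg (by
    rw [segment_eq_image' ℝ t (t + v)]
    exact ⟨τ, hτ, by simp⟩)
  have h1 := abs_sub_taylor_le k
    (fun j τ => iteratedFDerivWithin ℝ j f 𝒮 (t + τ • v) (fun _ => v))
    (M := (d : ℝ) ^ k * |L| * ‖v‖ ^ s) ?_ ?_ 1 (Set.right_mem_Icc.2 zero_le_one)
  · simpa [div_eq_mul_inv] using h1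
  · intro j hj τ hτ
    have h2 : DifferentiableWithinAt ℝ (iteratedFDerivWithin ℝ j f 𝒮) 𝒮 (t + τ • v) :=
      hf.1.differentiableOn_iteratedFDerivWithin (by exact_mod_cast hj) h𝒮 _ (hline τ hτ)
    have h3 : HasDerivWithinAt (fun τ : ℝ => t + τ • v) v (Set.Icc 0 1) τ := by
      simpa using (((hasDerivAt_id τ).smul_const v).const_add t).hasDerivWithinAt
    have h4 := h2.hasFDerivWithinAt.comp_hasDerivWithinAt τ h3 hline
    have h5 := ((ContinuousMultilinearMap.apply ℝ (fun _ : Fin j => E d) ℝ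
      (fun _ => v)).hasFDerivAt.comp_hasDerivWithinAt τ h4)
    have h6 : iteratedFDerivWithin ℝ (j + 1) f 𝒮 (t + τ • v) (fun _ => v)
        = fderivWithin ℝ (iteratedFDerivWithin ℝ j f 𝒮) 𝒮 (t + τ • v) v (fun _ => v) := by
      rw [iteratedFDerivWithin_succ_apply_left]
      rfl
    simp only [h6]
    exact h5
  · intro τ hτ
    simp only [zero_smul, add_zero]
    rw [multilinear_diag_eq_sum, multilinear_diag_eq_sum, ← Finset.sum_sub_distrib]
    have h0 : (t : E d) ∈ 𝒮 := by simpa using hline 0 (Set.left_mem_Icc.2 zero_le_one)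
    have hterm : ∀ J : Fin k → Fin d,
        |(∏ i, v (J i)) * iteratedFDerivWithin ℝ k f 𝒮 (t + τ • v)
            (fun i => EuclideanSpace.single (J i) (1 : ℝ))
          - (∏ i, v (J i)) * iteratedFDerivWithin ℝ k f 𝒮 t
            (fun i => EuclideanSpace.single (J i) (1 : ℝ))| ≤ |L| * ‖v‖ ^ s := by
      intro J
      rw [← mul_sub, abs_mul, Finset.abs_prod]
      have h7 : ∏ i, |v (J i)| ≤ ‖v‖ ^ k := by
        refine (Finset.prod_le_prod (fun i _ => abs_nonneg _)
          (fun i _ => abs_apply_le_norm v (J i))).trans ?_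
        simp
      have h8 := hf.2 J (t + τ • v) (hline τ hτ) t h0
      have h9 : ‖t + τ • v - t‖ ≤ ‖v‖ := by
        rw [add_sub_cancel_left, norm_smul, Real.norm_eq_abs, abs_of_nonneg hτ.1]
        exact mul_le_of_le_one_left (norm_nonneg _) hτ.2
      have h10 : L * ‖t + τ • v - t‖ ^ (s - k) ≤ |L| * ‖v‖ ^ (s - k) := by
        refine mul_le_mul (le_abs_self L) ?_ (by positivity) (abs_nonneg _)
        exact Real.rpow_le_rpow (norm_nonneg _) h9 (sub_nonneg.2 hks)
      -- The exponents add up even for `v = 0`, because their sum `s` is nonzero.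
      have h11 : ‖v‖ ^ k * ‖v‖ ^ (s - k) = ‖v‖ ^ s := by
        rw [← Real.rpow_natCast, ← Real.rpow_add' (norm_nonneg _) (by
          rw [add_sub_cancel]; exact hs.ne'), add_sub_cancel]
      calc _ ≤ ‖v‖ ^ k * (|L| * ‖v‖ ^ (s - k)) :=
            mul_le_mul h7 (h8.trans h10) (abs_nonneg _) (by positivity)
        _ = |L| * (‖v‖ ^ k * ‖v‖ ^ (s - k)) := by ring
        _ = _ := by rw [h11]
    calc _ ≤ _ := Finset.abs_sum_le_sum_abs _ _
      _ ≤ ∑ _J : Fin k → Fin d, |L| * ‖v‖ ^ s := Finset.sum_le_sum fun J _ => hterm J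
      _ = _ := by simp [mul_assoc]

/-! ### Bias of the kernel density estimate -/

section Bias

variable {s L B' B : ℝ} {𝒳 𝒮 : Set (E d)} {K : ℝ → E d → E d → ℝ} {f : E d → ℝ}

lemma IsSmoothingKernel.measurable_apply (hK : IsSmoothingKernel s 𝒳 𝒮 K) (h : ℝ) (t : E d) :
    Measurable (K h t) := (hK.measurable h).comp (measurable_const.prodMk measurable_id)

lemma abs_prod_pow_le (r : Fin d → ℕ) (u : E d) : |∏ i, u i ^ r i| ≤ ‖u‖ ^ ∑ i, r i := by
  rw [Finset.abs_prod, ← Finset.prod_pow_eq_pow_sum]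
  refine Finset.prod_le_prod (fun i _ => abs_nonneg _) fun i _ => ?_
  rw [abs_pow]
  exact pow_le_pow_left₀ (abs_nonneg _) (abs_apply_le_norm u i) _

/-- Moments of order at most `⌊s⌋` are thereby dominated by those of orders `0` and `s`, which the
envelope controls. -/
lemma pow_le_one_add_rpow {x : ℝ} (hx : 0 ≤ x) {n : ℕ} (hs : 0 ≤ s) (hn : n ≤ ⌊s⌋₊) :
    x ^ n ≤ 1 + x ^ s := by
  rcases le_total x 1 with h | h
  · exact (pow_le_one₀ hx h).trans (le_add_of_nonneg_right (Real.rpow_nonneg hx _))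
  · have h1 : (n : ℝ) ≤ s := (Nat.cast_le.2 hn).trans (Nat.floor_le hs)
    rw [← Real.rpow_natCast]
    exact (Real.rpow_le_rpow_of_exponent_le h h1).trans (le_add_of_nonneg_left zero_le_one)

lemma IsSmoothingKernel.integrable_moment (hs : 0 ≤ s) (hK : IsSmoothingKernel s 𝒳 𝒮 K) {h : ℝ}
    (hh : 0 < h) {t : E d} (ht : t ∈ 𝒳) {r : Fin d → ℕ} (hr : ∑ i, r i ≤ ⌊s⌋₊) :
    Integrable (fun u : E d => (∏ i, u i ^ r i) * K h t u) := by
  obtain ⟨κ, hκ, -, hκs, hle⟩ := hK.envelope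
  have hm : Measurable (fun u : E d => ∏ i, u i ^ r i) := by fun_prop
  refine (hκ.add hκs).mono' (hm.mul (hK.measurable_apply h t)).aestronglyMeasurable
    (Eventually.of_forall fun u => ?_)
  rw [Real.norm_eq_abs, abs_mul]
  have h1 := (abs_prod_pow_le r u).trans (pow_le_one_add_rpow (norm_nonneg u) hs hr)
  calc _ ≤ (1 + ‖u‖ ^ s) * κ u :=
        mul_le_mul h1 (hle h hh t ht u) (abs_nonneg _) (by positivity)
    _ = _ := by simp only [Pi.add_apply]; ring

/-- The kernel reproduces Taylor polynomials of order `⌊s⌋`. -/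
lemma IsSmoothingKernel.setIntegral_taylor (hs : 0 ≤ s) (hK : IsSmoothingKernel s 𝒳 𝒮 K) :
    ∃ h₀ > 0, ∀ h, 0 < h → h ≤ h₀ → ∀ t ∈ 𝒳,
      ∀ A : (j : ℕ) → ContinuousMultilinearMap ℝ (fun _ : Fin j => E d) ℝ,
        IntegrableOn (fun u => (∑ j ∈ Finset.range (⌊s⌋₊ + 1),
          A j (fun _ => (-h) • u) / (j.factorial : ℝ)) * K h t u) {u | t - h • u ∈ 𝒮} ∧
        ∫ u in {u | t - h • u ∈ 𝒮}, (∑ j ∈ Finset.range (⌊s⌋₊ + 1),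
          A j (fun _ => (-h) • u) / (j.factorial : ℝ)) * K h t u = A 0 (fun i => i.elim0) := by
  obtain ⟨h₀, hh₀, hmom⟩ := hK.moments
  refine ⟨h₀, hh₀, fun h hh hle t ht A => ?_⟩
  -- A tuple of coordinates contributes the monomial whose exponents count the occurrences of each
  -- coordinate. Its degree is the length of the tuple, so the moment conditions apply.
  set cnt : (j : ℕ) → (Fin j → Fin d) → Fin d → ℕ :=
    fun j J c => (Finset.univ.filter fun i => J i = c).card with hcnt
  have hcard : ∀ j (J : Fin j → Fin d), ∑ c, cnt j J c = j := fun j J => by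
    have := Finset.card_eq_sum_card_fiberwise (f := J) (s := Finset.univ) (t := Finset.univ)
      (fun _ _ => Finset.mem_coe.2 (Finset.mem_univ _))
    simpa using this.symm
  set a : (j : ℕ) → (Fin j → Fin d) → ℝ := fun j J =>
    (-h) ^ j * A j (fun i => EuclideanSpace.single (J i) (1 : ℝ)) / (j.factorial : ℝ) with ha
  have hexp : ∀ u : E d, (∑ j ∈ Finset.range (⌊s⌋₊ + 1),
      A j (fun _ => (-h) • u) / (j.factorial : ℝ)) * K h t u
      = ∑ j ∈ Finset.range (⌊s⌋₊ + 1), ∑ J : Fin j → Fin d,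
        a j J * ((∏ c, u c ^ cnt j J c) * K h t u) := by
    intro u
    rw [Finset.sum_mul]
    refine Finset.sum_congr rfl fun j _ => ?_
    rw [multilinear_diag_eq_sum, Finset.sum_div, Finset.sum_mul]
    refine Finset.sum_congr rfl fun J _ => ?_
    have h1 : ∏ i, ((-h) • u) (J i) = (-h) ^ j * ∏ c, u c ^ cnt j J c := by
      have h2 : ∏ i, u (J i) = ∏ c, u c ^ cnt j J c := by
        rw [← Finset.prod_fiberwise (s := Finset.univ) (g := J) (f := fun i => u (J i))]
        refine Finset.prod_congr rfl fun c _ => ?_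
        rw [Finset.prod_congr rfl (g := fun _ => u c) fun i hi => by rw [(Finset.mem_filter.1 hi).2],
          Finset.prod_const]
      rw [← h2]
      simp only [PiLp.smul_apply, smul_eq_mul, Finset.prod_mul_distrib, Finset.prod_const,
        Finset.card_univ, Fintype.card_fin]
    rw [h1]
    simp only [ha]
    ring
  simp only [hexp]
  have hint : ∀ j ∈ Finset.range (⌊s⌋₊ + 1), ∀ J : Fin j → Fin d,
      IntegrableOn (fun u : E d => a j J * ((∏ c, u c ^ cnt j J c) * K h t u))
        {u | t - h • u ∈ 𝒮} := fun j hj J =>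
    ((hK.integrable_moment hs hh ht (by
      rw [hcard]; exact Nat.lt_succ_iff.1 (Finset.mem_range.1 hj))).const_mul _).integrableOn
  refine ⟨integrable_finsetSum _ fun j hj => integrable_finsetSum _ fun J _ => hint j hj J, ?_⟩
  rw [integral_finsetSum _ fun j hj => integrable_finsetSum _ fun J _ => hint j hj J,
    Finset.sum_eq_single_of_mem 0 (by simp)]
  · rw [integral_finsetSum _ fun J _ => hint 0 (by simp) J, Fintype.sum_unique, integral_const_mul,
      hmom h hh hle t ht _ (by rw [hcard]; simp), if_pos (by ext c; simp [hcnt])]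
    simp only [ha, pow_zero, one_mul, Nat.factorial_zero, Nat.cast_one, div_one, mul_one]
    congr 1
    ext i
    exact i.elim0
  -- A tuple of positive length has a nonzero exponent vector, and the corresponding moment
  -- vanishes.
  · intro j hj hj0
    rw [integral_finsetSum _ fun J _ => hint j hj J]
    refine Finset.sum_eq_zero fun J _ => ?_
    have hne : cnt j J ≠ 0 := fun h0 => hj0 (by
      have := hcard j J
      rw [h0] at this
      simpa using this.symm)
    rw [integral_const_mul, hmom h hh hle t ht _ (by
      rw [hcard]; exact Nat.lt_succ_iff.1 (Finset.mem_range.1 hj)), if_neg hne, mul_zero]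

/-- The kernel integrates the Taylor polynomial of `f` at `t` to `f t`, and the Taylor remainder is
of order `h ^ s ‖u‖ ^ s`. Where the kernel does not vanish, visibility keeps the segment inside `𝒮`;
elsewhere there is nothing to bound. -/
lemma IsSmoothingKernel.abs_bias_le (hs : 0 < s) (h𝒮 : IsClosed 𝒮) (h𝒮' : UniqueDiffOn ℝ 𝒮)
    (h𝒳𝒮 : 𝒳 ⊆ 𝒮) (hK : IsSmoothingKernel s 𝒳 𝒮 K) (hf : IsBoundedDensity 𝒳 B' B f)
    (hfH : f ∈ HolderClass s L 𝒮) :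
    ∃ C h₁, 0 ≤ C ∧ 0 < h₁ ∧ ∀ h, 0 < h → h ≤ h₁ → ∀ t ∈ 𝒳,
      |(∫ u, K h t u * f (t - h • u)) - f t| ≤ C * h ^ s := by
  obtain ⟨h₀, hh₀, htay⟩ := hK.setIntegral_taylor hs.le
  obtain ⟨h₁, hh₁, hvis⟩ := hK.visible
  obtain ⟨κ, hκ, -, hκs, hle⟩ := hK.envelope
  have hκ0 : ∀ u, 0 ≤ κ u := fun u => by
    obtain ⟨t, ht⟩ := hf.nonempty
    exact (abs_nonneg _).trans (hle 1 one_pos t ht u)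
  have hI0 : 0 ≤ ∫ u, ‖u‖ ^ s * κ u :=
    integral_nonneg fun u => mul_nonneg (by positivity) (hκ0 u)
  refine ⟨(d : ℝ) ^ ⌊s⌋₊ * |L| * ∫ u, ‖u‖ ^ s * κ u, min h₀ h₁, by positivity, lt_min hh₀ hh₁,
    fun h hh hhle t ht => ?_⟩
  set A := {u : E d | t - h • u ∈ 𝒮} with hA
  have hAm : MeasurableSet A := by
    have : Measurable fun u : E d => t - h • u := by fun_prop
    exact this h𝒮.measurableSet
  -- The density is zero outside `𝒳 ⊆ 𝒮`, so only the region in which the moment conditions are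
  -- stated contributes.
  have h1 : ∫ u, K h t u * f (t - h • u) = ∫ u in A, K h t u * f (t - h • u) := by
    refine (setIntegral_eq_integral_of_forall_compl_eq_zero fun u hu => ?_).symm
    rw [hf.isDensity.2.1 _ (fun h => hu (h𝒳𝒮 h)), mul_zero]
  obtain ⟨hi, he⟩ := htay h hh (hhle.trans (min_le_left _ _)) t ht
    (fun j => iteratedFDerivWithin ℝ j f 𝒮 t)
  rw [iteratedFDerivWithin_zero_apply] at he
  have hKi : Integrable (K h t) := by
    have := hK.integrable_moment hs.le hh ht (r := 0) (by simp)
    simpa using this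
  have hmf : Measurable fun u : E d => f (t - h • u) := hf.measurable.comp (by fun_prop)
  have hKf : Integrable (fun u => K h t u * f (t - h • u)) :=
    Integrable.mul_bdd hKi hmf.aestronglyMeasurable
      (c := B) (Eventually.of_forall fun u => hf.abs_apply_le _)
  rw [h1, ← he, ← integral_sub hKf.integrableOn hi, ← Real.norm_eq_abs]
  have hdom : Integrable (fun u => (d : ℝ) ^ ⌊s⌋₊ * |L| * h ^ s * (‖u‖ ^ s * κ u)) :=
    hκs.const_mul _
  calc _ ≤ ∫ u in A, (d : ℝ) ^ ⌊s⌋₊ * |L| * h ^ s * (‖u‖ ^ s * κ u) := by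
        refine norm_integral_le_of_norm_le hdom.integrableOn
          (ae_restrict_of_forall_mem hAm fun u hu => ?_)
        by_cases hKu : K h t u = 0
        · rw [hKu]
          simp only [zero_mul, mul_zero, sub_zero, norm_zero]
          have := hκ0 u
          positivity
        · have hseg := hvis h hh (hhle.trans (min_le_right _ _)) t ht u hu hKu
          have hv : t - h • u = t + (-h) • u := by rw [neg_smul, sub_eq_add_neg]
          rw [hv] at hseg ⊢
          have h2 := abs_sub_taylor_le_of_mem_holderClass hs h𝒮' hfH hseg
          rw [mul_comm (K h t u), ← sub_mul, norm_mul, Real.norm_eq_abs, Real.norm_eq_abs]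
          have h3 : ‖(-h) • u‖ ^ s = h ^ s * ‖u‖ ^ s := by
            rw [norm_smul, norm_neg, Real.norm_eq_abs, abs_of_pos hh,
              Real.mul_rpow hh.le (norm_nonneg _)]
          rw [h3] at h2
          calc _ ≤ ((d : ℝ) ^ ⌊s⌋₊ * |L| * (h ^ s * ‖u‖ ^ s)) * κ u :=
                mul_le_mul h2 (hle h hh t ht u) (abs_nonneg _) (by positivity)
            _ = _ := by ring
    _ ≤ ∫ u, (d : ℝ) ^ ⌊s⌋₊ * |L| * h ^ s * (‖u‖ ^ s * κ u) :=
        setIntegral_le_integral hdom (Eventually.of_forall fun u => by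
          have := hκ0 u
          simp only [Pi.zero_apply]
          positivity)
    _ = _ := by rw [integral_const_mul]; ring

end Bias

/-! ### Moments of degenerate quadratic forms -/

section Degenerate

variable {Ω α β : Type*} [MeasurableSpace Ω] {P : Measure Ω} [IsProbabilityMeasure P]
  [MeasurableSpace α] [MeasurableSpace β]

lemma integrable_of_abs_le {g : Ω → ℝ} (hg : Measurable g) {c : ℝ} (hc : ∀ ω, |g ω| ≤ c) :
    Integrable g P := Integrable.of_bound hg.aestronglyMeasurable c (Eventually.of_forall hc)

/-- Under independence the joint law is a product, and `V` can be integrated out first with `U`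
fixed. -/
lemma integral_comp_prodMk_eq_zero {U : Ω → α} {V : Ω → β} (hU : Measurable U) (hV : Measurable V)
    (hUV : IndepFun U V P) {F : α → β → ℝ} (hF : Measurable (Function.uncurry F)) {c : ℝ}
    (hc : ∀ u v, |F u v| ≤ c) (h0 : ∀ u, ∫ v, F u v ∂(P.map V) = 0) :
    ∫ ω, F (U ω) (V ω) ∂P = 0 := by
  have := Measure.isProbabilityMeasure_map hU.aemeasurable (μ := P)
  have := Measure.isProbabilityMeasure_map hV.aemeasurable (μ := P)
  have h1 : ∫ ω, F (U ω) (V ω) ∂P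
      = ∫ z, Function.uncurry F z ∂(P.map fun ω => (U ω, V ω)) := by
    rw [integral_map (hU.prodMk hV).aemeasurable hF.aestronglyMeasurable]
    rfl
  rw [h1, (indepFun_iff_map_prod_eq_prod_map_map hU.aemeasurable hV.aemeasurable).1 hUV,
    integral_prod]
  · simp [Function.uncurry, h0]
  · exact integrable_of_abs_le hF fun z => hc z.1 z.2

variable {μ : Measure α} {X : ℕ → Ω → α} {G : α → α → ℝ} {M : ℝ}

/-- Given `X a`, the summands are independent and centered, so only the diagonal of the expanded
square survives. -/
lemma integral_sq_sum_le (hX : ∀ i, Measurable (X i)) (hlaw : ∀ i, P.map (X i) = μ)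
    (hind : iIndepFun X P) (hG : Measurable (Function.uncurry G)) (hM : ∀ x y, |G x y| ≤ M)
    (h0 : ∀ y, ∫ x, G x y ∂μ = 0) (A : Finset ℕ) {a : ℕ} (ha : a ∉ A) :
    ∫ ω, (∑ i ∈ A, G (X i ω) (X a ω)) ^ 2 ∂P ≤ A.card * M ^ 2 := by
  have hGm : ∀ i, Measurable fun ω => G (X i ω) (X a ω) := fun i => hG.comp ((hX i).prodMk (hX a))
  have hM2 : ∀ i j ω, |G (X i ω) (X a ω) * G (X j ω) (X a ω)| ≤ M * M := fun i j ω => by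
    rw [abs_mul]
    exact mul_le_mul (hM _ _) (hM _ _) (abs_nonneg _) ((abs_nonneg _).trans (hM (X i ω) (X a ω)))
  have hint : ∀ i j, Integrable (fun ω => G (X i ω) (X a ω) * G (X j ω) (X a ω)) P := fun i j =>
    integrable_of_abs_le ((hGm i).mul (hGm j)) (hM2 i j)
  have hexp : ∀ ω, (∑ i ∈ A, G (X i ω) (X a ω)) ^ 2
      = ∑ i ∈ A, ∑ j ∈ A, G (X i ω) (X a ω) * G (X j ω) (X a ω) := fun ω => by
    rw [pow_two, Finset.sum_mul_sum]
  simp only [hexp]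
  rw [integral_finsetSum _ fun i _ => integrable_finsetSum _ fun j _ => hint i j]
  have hterm : ∀ i ∈ A, ∫ ω, ∑ j ∈ A, G (X i ω) (X a ω) * G (X j ω) (X a ω) ∂P ≤ M ^ 2 := by
    intro i hi
    rw [integral_finsetSum _ fun j _ => hint i j, Finset.sum_eq_single_of_mem i hi]
    · calc _ ≤ ∫ _, M * M ∂P := integral_mono (hint i i) (integrable_const _)
            fun ω => (abs_le.1 (hM2 i i ω)).2
        _ = M ^ 2 := by simp [pow_two]
    · intro j hj hji
      have hia : i ≠ a := fun h => ha (h ▸ hi)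
      have hja : j ≠ a := fun h => ha (h ▸ hj)
      -- For distinct indices, integrate out `X i` with the pair `(X j, X a)` fixed.
      have hI : IndepFun (fun ω => (X j ω, X a ω)) (X i) P :=
        hind.indepFun_prodMk hX j a i hji hia.symm
      refine integral_comp_prodMk_eq_zero ((hX j).prodMk (hX a)) (hX i) hI
        (F := fun u v => G v u.2 * G u.1 u.2) (c := M * M) ?_ (fun u v => ?_) fun u => ?_
      · exact (hG.comp (measurable_snd.prodMk (measurable_snd.comp measurable_fst))).mul
          (hG.comp measurable_fst)
      · rw [abs_mul]
        exact mul_le_mul (hM _ _) (hM _ _) (abs_nonneg _) ((abs_nonneg _).trans (hM v u.2))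
      · rw [hlaw, integral_mul_const, h0, zero_mul]
  calc _ ≤ ∑ _i ∈ A, M ^ 2 := Finset.sum_le_sum hterm
    _ = _ := by simp

/-- Second moment of a degenerate `V`-statistic with a bounded kernel. -/
lemma integral_sq_sum_sum_le (hX : ∀ i, Measurable (X i)) (hlaw : ∀ i, P.map (X i) = μ)
    (hind : iIndepFun X P) (hG : Measurable (Function.uncurry G)) (hM : ∀ x y, |G x y| ≤ M)
    (hsymm : ∀ x y, G x y = G y x) (h0 : ∀ y, ∫ x, G x y ∂μ = 0) (A : Finset ℕ) :
    ∫ ω, (∑ i ∈ A, ∑ j ∈ A, G (X i ω) (X j ω)) ^ 2 ∂P ≤ 6 * (A.card * M) ^ 2 := by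
  have hGm : ∀ i j, Measurable fun ω => G (X i ω) (X j ω) :=
    fun i j => hG.comp ((hX i).prodMk (hX j))
  have hM0 : 0 ≤ M := by
    by_contra h
    have hne : Nonempty Ω := by
      by_contra hne
      rw [not_nonempty_iff] at hne
      have := measure_univ (μ := P)
      simp [Set.eq_empty_of_isEmpty] at this
    obtain ⟨ω⟩ := hne
    exact h ((abs_nonneg _).trans (hM (X 0 ω) (X 0 ω)))
  have hsum : ∀ (S : Finset ℕ) (u : ℕ → α) (y : α), |∑ i ∈ S, G (u i) y| ≤ S.card * M :=
    fun S u y => (Finset.abs_sum_le_sum_abs _ _).trans (by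
      calc _ ≤ ∑ _i ∈ S, M := Finset.sum_le_sum fun i _ => hM _ _
        _ = _ := by simp)
  have hdiag : ∀ (S : Finset ℕ) (u : ℕ → α), |∑ i ∈ S, G (u i) (u i)| ≤ S.card * M :=
    fun S u => (Finset.abs_sum_le_sum_abs _ _).trans (by
      calc _ ≤ ∑ _i ∈ S, M := Finset.sum_le_sum fun i _ => hM _ _
        _ = _ := by simp)
  have hdouble : ∀ (S : Finset ℕ) (u : ℕ → α),
      |∑ i ∈ S, ∑ j ∈ S, G (u i) (u j)| ≤ S.card * (S.card * M) := fun S u => by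
    rw [Finset.sum_comm]
    refine (Finset.abs_sum_le_sum_abs _ _).trans ?_
    calc _ ≤ ∑ _i ∈ S, (S.card * M : ℝ) := Finset.sum_le_sum fun i _ => hsum S u _
      _ = _ := by simp
  -- The off-diagonal part. The diagonal is at most `card * M` pointwise and needs no cancellation.
  set O : Finset ℕ → (ℕ → α) → ℝ := fun S u =>
    (∑ i ∈ S, ∑ j ∈ S, G (u i) (u j)) - ∑ i ∈ S, G (u i) (u i) with hO
  have hObd : ∀ S u, |O S u| ≤ S.card * (S.card * M) + S.card * M := fun S u =>
    (abs_sub _ _).trans (add_le_add (hdouble S u) (hdiag S u))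
  have hOm : ∀ S, Measurable fun ω => O S (fun i => X i ω) := fun S =>
    (Finset.measurable_fun_sum _ fun i _ => Finset.measurable_fun_sum _ fun j _ => hGm i j).sub
      (Finset.measurable_fun_sum _ fun i _ => hGm i i)
  -- A new point `a` adds `2 R`, where `R` is the sum of the `G (X i) (X a)`. Given the earlier
  -- points `R` is centered, so the cross term vanishes and the second moment grows by at most `4
  -- |S| M²`; these increments sum to at most `2 |S|² M²`.
  have hoff : ∀ S : Finset ℕ, ∫ ω, O S (fun i => X i ω) ^ 2 ∂P ≤ 2 * (S.card * M) ^ 2 := by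
    intro S
    induction S using Finset.induction_on with
    | empty => simp [hO]
    | insert a S ha ih =>
      have hins : ∀ u : ℕ → α, O (insert a S) u = O S u + 2 * ∑ i ∈ S, G (u i) (u a) := by
        intro u
        simp only [hO, Finset.sum_insert ha, Finset.sum_add_distrib]
        rw [Finset.sum_congr rfl fun i _ => hsymm (u a) (u i)]
        ring
      have hRm : Measurable fun ω => ∑ i ∈ S, G (X i ω) (X a ω) :=
        Finset.measurable_fun_sum _ fun i _ => hGm i a
      have hcross : ∫ ω, O S (fun i => X i ω) * ∑ i ∈ S, G (X i ω) (X a ω) ∂P = 0 := by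
        classical
        have hI := hind.indepFun_finset S {a} (Finset.disjoint_singleton_right.2 ha) hX
        have hI' : IndepFun (fun ω (i : S) => X i ω) (X a) P :=
          hI.comp measurable_id (measurable_pi_apply (⟨a, Finset.mem_singleton_self a⟩ : ({a} : Finset ℕ)))
        -- Independence concerns the family restricted to `S`, while `O S` takes whole sequences.
        -- The missing coordinates are filled with the value of `X a`, as no other point of `α` is
        -- at hand; they do not influence `O S`.
        set ext : α → (S → α) → ℕ → α := fun y u i => if h : i ∈ S then u ⟨i, h⟩ else y with hext
        have hextm : ∀ i, Measurable fun z : (S → α) × α => ext z.2 z.1 i := fun i => by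
          by_cases h : i ∈ S
          · simp only [hext, h, dite_true]
            exact (measurable_pi_apply _).comp measurable_fst
          · simp only [hext, h, dite_false]
            exact measurable_snd
        have hmem : ∀ (y : α) ω, ∀ i ∈ S, ext y (fun i : S => X i ω) i = X i ω := fun y ω i hi => by
          simp [hext, hi]
        have key := integral_comp_prodMk_eq_zero (P := P) (measurable_pi_lambda _ fun i : S => hX i)
          (hX a) hI' (F := fun u v => O S (ext v u) * ∑ i ∈ S, G (ext v u i) v)
          (c := (S.card * (S.card * M) + S.card * M) * (S.card * M)) ?_ (fun u v => ?_) fun u => ?_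
        · rw [← key]
          congr 1 with ω
          simp only [hO]
          congr 1
          · congr 1
            · refine Finset.sum_congr rfl fun i hi => Finset.sum_congr rfl fun j hj => ?_
              rw [hmem _ _ i hi, hmem _ _ j hj]
            · refine Finset.sum_congr rfl fun i hi => ?_
              rw [hmem _ _ i hi]
          · refine Finset.sum_congr rfl fun i hi => ?_
            rw [hmem _ _ i hi]
        · refine Measurable.mul (Measurable.sub ?_ ?_) ?_
          · exact Finset.measurable_fun_sum _ fun i _ => Finset.measurable_fun_sum _ fun j _ =>
              hG.comp ((hextm i).prodMk (hextm j))
          · exact Finset.measurable_fun_sum _ fun i _ => hG.comp ((hextm i).prodMk (hextm i))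
          · exact Finset.measurable_fun_sum _ fun i _ => hG.comp ((hextm i).prodMk measurable_snd)
        · rw [abs_mul]
          exact mul_le_mul (hObd _ _) (hsum _ _ _) (abs_nonneg _) (by positivity)
        · rw [hlaw]
          rcases S.eq_empty_or_nonempty with hS | ⟨i₀, hi₀⟩
          · simp [hS]
          have hconst : ∀ v, ∀ i ∈ S, ext v u i = ext (u ⟨i₀, hi₀⟩) u i := fun v i hi => by
            simp [hext, hi]
          have heq : ∀ v, O S (ext v u) * ∑ i ∈ S, G (ext v u i) v
              = O S (ext (u ⟨i₀, hi₀⟩) u) * ∑ i ∈ S, G v (ext (u ⟨i₀, hi₀⟩) u i) := fun v => by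
            congr 1
            · simp only [hO]
              congr 1
              · refine Finset.sum_congr rfl fun i hi => Finset.sum_congr rfl fun j hj => ?_
                rw [hconst v i hi, hconst v j hj]
              · refine Finset.sum_congr rfl fun i hi => ?_
                rw [hconst v i hi]
            · refine Finset.sum_congr rfl fun i hi => ?_
              rw [hconst v i hi, hsymm]
          have hprob : IsProbabilityMeasure μ :=
            hlaw 0 ▸ Measure.isProbabilityMeasure_map (hX 0).aemeasurable
          simp only [heq]
          rw [integral_const_mul, integral_finsetSum]
          · simp [h0]
          · intro i _
            exact integrable_of_abs_le (hG.comp (measurable_id.prodMk measurable_const))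
              fun v => hM _ _
      have hOb := hObd S
      have hi1 : Integrable (fun ω => O S (fun i => X i ω) ^ 2) P :=
        integrable_of_abs_le ((hOm S).pow_const 2)
          (c := (S.card * (S.card * M) + S.card * M) ^ 2) fun ω => by
            rw [abs_pow]; exact pow_le_pow_left₀ (abs_nonneg _) (hOb _) 2
      have hi2 : Integrable (fun ω => O S (fun i => X i ω) * ∑ i ∈ S, G (X i ω) (X a ω)) P :=
        integrable_of_abs_le ((hOm S).mul hRm)
          (c := (S.card * (S.card * M) + S.card * M) * (S.card * M)) fun ω => by
            rw [abs_mul]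
            exact mul_le_mul (hOb _) (hsum S (fun i => X i ω) _) (abs_nonneg _) (by positivity)
      have hi3 : Integrable (fun ω => (∑ i ∈ S, G (X i ω) (X a ω)) ^ 2) P :=
        integrable_of_abs_le (hRm.pow_const 2) (c := (S.card * M) ^ 2) fun ω => by
          rw [abs_pow]; exact pow_le_pow_left₀ (abs_nonneg _) (hsum S (fun i => X i ω) _) 2
      have hsq : ∀ ω, O (insert a S) (fun i => X i ω) ^ 2 = O S (fun i => X i ω) ^ 2
          + 4 * (O S (fun i => X i ω) * ∑ i ∈ S, G (X i ω) (X a ω))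
          + 4 * (∑ i ∈ S, G (X i ω) (X a ω)) ^ 2 := fun ω => by
        rw [hins]; ring
      have hi12 : Integrable (fun ω => O S (fun i => X i ω) ^ 2
          + 4 * (O S (fun i => X i ω) * ∑ i ∈ S, G (X i ω) (X a ω))) P := hi1.add (hi2.const_mul 4)
      simp only [hsq]
      rw [integral_add hi12 (hi3.const_mul 4), integral_add hi1 (hi2.const_mul 4),
        integral_const_mul, integral_const_mul, hcross]
      have hR := integral_sq_sum_le hX hlaw hind hG hM h0 S ha
      rw [Finset.card_insert_of_notMem ha, Nat.cast_add, Nat.cast_one]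
      nlinarith [sq_nonneg M]
  -- The constant is `6 = 2 * 2 + 2`: twice the off-diagonal bound plus twice the square of the
  -- diagonal bound.
  have hsplit : ∀ ω, (∑ i ∈ A, ∑ j ∈ A, G (X i ω) (X j ω)) ^ 2
      ≤ 2 * O A (fun i => X i ω) ^ 2 + 2 * (A.card * M) ^ 2 := fun ω => by
    have h1 : (∑ i ∈ A, G (X i ω) (X i ω)) ^ 2 ≤ (A.card * M) ^ 2 :=
      sq_le_sq' (abs_le.1 (hdiag A fun i => X i ω)).1 (abs_le.1 (hdiag A fun i => X i ω)).2
    have h2 : ∑ i ∈ A, ∑ j ∈ A, G (X i ω) (X j ω)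
        = O A (fun i => X i ω) + ∑ i ∈ A, G (X i ω) (X i ω) := by simp [hO]
    rw [h2]
    nlinarith [sq_nonneg (O A (fun i => X i ω) - ∑ i ∈ A, G (X i ω) (X i ω))]
  have hi1 : Integrable (fun ω => O A (fun i => X i ω) ^ 2) P :=
    integrable_of_abs_le ((hOm A).pow_const 2)
      (c := (A.card * (A.card * M) + A.card * M) ^ 2) fun ω => by
        rw [abs_pow]; exact pow_le_pow_left₀ (abs_nonneg _) (hObd A _) 2
  have hi2 : Integrable (fun ω => (∑ i ∈ A, ∑ j ∈ A, G (X i ω) (X j ω)) ^ 2) P :=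
    integrable_of_abs_le ((Finset.measurable_fun_sum _ fun i _ =>
      Finset.measurable_fun_sum _ fun j _ => hGm i j).pow_const 2)
      (c := (A.card * (A.card * M)) ^ 2) fun ω => by
        rw [abs_pow]; exact pow_le_pow_left₀ (abs_nonneg _) (hdouble A fun i => X i ω) 2
  calc _ ≤ ∫ ω, (2 * O A (fun i => X i ω) ^ 2 + 2 * (A.card * M) ^ 2) ∂P :=
        integral_mono hi2 ((hi1.const_mul 2).add (integrable_const _)) hsplit
    _ = 2 * (∫ ω, O A (fun i => X i ω) ^ 2 ∂P) + 2 * (A.card * M) ^ 2 := by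
        rw [integral_add (hi1.const_mul 2) (integrable_const _), integral_const_mul]
        simp
    _ ≤ _ := by linarith [hoff A]

/-- Fourth moment of a sum of independent centered random elements of `L²(ρ)`, each with
squared norm at most `M`. -/
lemma lintegral_sq_integral_sq_sum_le {ρ : Measure β} [IsFiniteMeasure ρ] {c : α → β → ℝ}
    (hX : ∀ i, Measurable (X i)) (hlaw : ∀ i, P.map (X i) = μ)
    (hind : iIndepFun X P) (hc : Measurable (Function.uncurry c))
    (hL : ∀ x, MemLp (c x) 2 ρ) (hM : ∀ x, ∫ t, c x t ^ 2 ∂ρ ≤ M)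
    (h0 : ∀ᵐ t ∂ρ, ∫ x, c x t ∂μ = 0) (A : Finset ℕ) :
    ∫⁻ ω, ENNReal.ofReal ((∫ t, (∑ i ∈ A, c (X i ω) t) ^ 2 ∂ρ) ^ 2) ∂P
      ≤ ENNReal.ofReal (6 * (A.card * M) ^ 2) := by
  have hprob : IsProbabilityMeasure μ :=
    hlaw 0 ▸ Measure.isProbabilityMeasure_map (hX 0).aemeasurable
  -- The squared norm of the sum is a double sum of inner products. This Gram kernel is symmetric,
  -- bounded by `M`, and, by Fubini, degenerate because the summands are centered.
  set G : α → α → ℝ := fun x y => ∫ t, c x t * c y t ∂ρ with hGdef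
  have hprod : ∀ x y, Integrable (fun t => c x t * c y t) ρ := fun x y =>
    MemLp.integrable_mul (hL x) (hL y)
  have hG : Measurable (Function.uncurry G) := by
    have h1 : Measurable fun z : (α × α) × β => c z.1.1 z.2 * c z.1.2 z.2 :=
      (hc.comp ((measurable_fst.comp measurable_fst).prodMk measurable_snd)).mul
        (hc.comp ((measurable_snd.comp measurable_fst).prodMk measurable_snd))
    exact (h1.stronglyMeasurable.integral_prod_right' (ν := ρ)).measurable
  have hGM : ∀ x y, |G x y| ≤ M := by
    intro x y
    calc |G x y| ≤ ∫ t, |c x t * c y t| ∂ρ := abs_integral_le_integral_abs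
      _ ≤ ∫ t, (1 / 2) * (c x t ^ 2 + c y t ^ 2) ∂ρ := by
          refine integral_mono (hprod x y).abs
            (((hL x).integrable_sq.add (hL y).integrable_sq).const_mul _) fun t => ?_
          simp only
          rw [abs_le]
          constructor <;> nlinarith [sq_nonneg (c x t - c y t), sq_nonneg (c x t + c y t)]
      _ = (1 / 2) * ((∫ t, c x t ^ 2 ∂ρ) + ∫ t, c y t ^ 2 ∂ρ) := by
          rw [integral_const_mul, integral_add (hL x).integrable_sq (hL y).integrable_sq]
      _ ≤ M := by linarith [hM x, hM y]
  have hG0 : ∀ y, ∫ x, G x y ∂μ = 0 := by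
    intro y
    have h1 : Integrable (Function.uncurry fun x t => c x t * c y t) (μ.prod ρ) := by
      have hm : Measurable (Function.uncurry fun x t => c x t * c y t) :=
        hc.mul (hc.comp (measurable_const.prodMk measurable_snd))
      rw [integrable_prod_iff hm.aestronglyMeasurable]
      refine ⟨Eventually.of_forall fun x => hprod x y, ?_⟩
      refine Integrable.of_bound
        (hm.norm.stronglyMeasurable.integral_prod_right' (ν := ρ)).aestronglyMeasurable M
        (Eventually.of_forall fun x => ?_)
      rw [Real.norm_eq_abs, abs_of_nonneg (integral_nonneg fun _ => norm_nonneg _)]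
      calc ∫ t, ‖c x t * c y t‖ ∂ρ ≤ ∫ t, (1 / 2) * (c x t ^ 2 + c y t ^ 2) ∂ρ := by
            refine integral_mono (hprod x y).norm
              (((hL x).integrable_sq.add (hL y).integrable_sq).const_mul _) fun t => ?_
            simp only
            rw [Real.norm_eq_abs, abs_le]
            constructor <;> nlinarith [sq_nonneg (c x t - c y t), sq_nonneg (c x t + c y t)]
        _ = (1 / 2) * ((∫ t, c x t ^ 2 ∂ρ) + ∫ t, c y t ^ 2 ∂ρ) := by
            rw [integral_const_mul, integral_add (hL x).integrable_sq (hL y).integrable_sq]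
        _ ≤ M := by linarith [hM x, hM y]
    rw [hGdef]
    simp only
    rw [integral_integral_swap h1]
    refine integral_eq_zero_of_ae (h0.mono fun t ht => ?_)
    simp only [Pi.zero_apply]
    rw [integral_mul_const, ht, zero_mul]
  have hkey := integral_sq_sum_sum_le hX hlaw hind hG hGM
    (fun x y => by simp only [hGdef, mul_comm]) hG0 A
  have heq : ∀ ω, ∫ t, (∑ i ∈ A, c (X i ω) t) ^ 2 ∂ρ
      = ∑ i ∈ A, ∑ j ∈ A, G (X i ω) (X j ω) := fun ω => by
    simp only [pow_two, Finset.sum_mul_sum]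
    rw [integral_finsetSum _ fun i _ => integrable_finsetSum _ fun j _ => hprod _ _]
    exact Finset.sum_congr rfl fun i _ => integral_finsetSum _ fun j _ => hprod _ _
  simp only [heq]
  rw [← ofReal_integral_eq_lintegral_ofReal _ (Eventually.of_forall fun _ => sq_nonneg _)]
  · exact ENNReal.ofReal_le_ofReal hkey
  · refine integrable_of_abs_le ((Finset.measurable_fun_sum _ fun i _ =>
      Finset.measurable_fun_sum _ fun j _ => hG.comp ((hX i).prodMk (hX j))).pow_const 2)
      (c := (∑ _i ∈ A, ∑ _j ∈ A, M) ^ 2) fun ω => ?_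
    rw [abs_pow]
    refine pow_le_pow_left₀ (abs_nonneg _) ?_ 2
    refine (Finset.abs_sum_le_sum_abs _ _).trans (Finset.sum_le_sum fun i _ => ?_)
    exact (Finset.abs_sum_le_sum_abs _ _).trans (Finset.sum_le_sum fun j _ => hGM _ _)

end Degenerate

/-! ### Risk of the kernel density estimate -/

section Scaling

variable {d : ℕ}

lemma integral_comp_inv_smul_sub {h : ℝ} (hh : 0 < h) (F : E d → ℝ) (t : E d) :
    ∫ x, F (h⁻¹ • (t - x)) = h ^ d * ∫ u, F u := by
  rw [integral_sub_left_eq_self (fun y => F (h⁻¹ • y)) volume t,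
    Measure.integral_comp_inv_smul, finrank_euclideanSpace_fin, smul_eq_mul,
    abs_of_pos (by positivity)]

lemma integral_comp_inv_smul_sub_right {h : ℝ} (hh : 0 < h) (F : E d → ℝ) (x : E d) :
    ∫ t, F (h⁻¹ • (t - x)) = h ^ d * ∫ u, F u := by
  rw [integral_sub_right_eq_self (fun y => F (h⁻¹ • y)) x,
    Measure.integral_comp_inv_smul, finrank_euclideanSpace_fin, smul_eq_mul,
    abs_of_pos (by positivity)]

lemma integrable_comp_inv_smul_sub {h : ℝ} (hh : 0 < h) {F : E d → ℝ} (hF : Integrable F) (t : E d) :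
    Integrable fun x => F (h⁻¹ • (t - x)) :=
  (hF.comp_smul (inv_ne_zero hh.ne')).comp_sub_left t

lemma integrable_comp_inv_smul_sub_right {h : ℝ} (hh : 0 < h) {F : E d → ℝ} (hF : Integrable F)
    (x : E d) : Integrable fun t => F (h⁻¹ • (t - x)) :=
  (hF.comp_smul (inv_ne_zero hh.ne')).comp_sub_right x

end Scaling

section Kernel

variable {d : ℕ} {s L B' B : ℝ} {𝒳 𝒮 : Set (E d)} {K : ℝ → E d → E d → ℝ} {f : E d → ℝ}

lemma law_le_smul (hf : IsBoundedDensity 𝒳 B' B f) : law 𝒳 f ≤ ENNReal.ofReal B • volume := by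
  calc law 𝒳 f ≤ (volume.restrict 𝒳).withDensity fun _ => ENNReal.ofReal B :=
        withDensity_mono (Eventually.of_forall fun x =>
          ENNReal.ofReal_le_ofReal ((le_abs_self _).trans (hf.abs_apply_le x)))
    _ = ENNReal.ofReal B • volume.restrict 𝒳 := withDensity_const _
    _ ≤ ENNReal.ofReal B • volume := by
        gcongr
        exact Measure.restrict_le_self

lemma integrable_law (hf : IsBoundedDensity 𝒳 B' B f) {F : E d → ℝ} (hF : Integrable F) :
    Integrable F (law 𝒳 f) :=
  (hF.smul_measure ENNReal.ofReal_ne_top).mono_measure (law_le_smul hf)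

/-- The rescaled kernel: the contribution of the sample point `x` to the density estimate. -/
def scaledKernel (K : ℝ → E d → E d → ℝ) (h : ℝ) (x t : E d) : ℝ :=
  (h ^ d)⁻¹ * K h t (h⁻¹ • (t - x))

/-- The mean of the kernel density estimate with bandwidth `h`. -/
def meanKernel (𝒳 : Set (E d)) (f : E d → ℝ) (K : ℝ → E d → E d → ℝ) (h : ℝ) (t : E d) : ℝ :=
  ∫ x, scaledKernel K h x t ∂(law 𝒳 f)

lemma kde_eq (b : ℕ → ℝ) (A : Finset ℕ) (x : ℕ → E d) (t : E d) :
    kde K b A x t = (A.card : ℝ)⁻¹ * ∑ i ∈ A, scaledKernel K (b A.card) (x i) t := by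
  simp only [kde, scaledKernel, ← Finset.mul_sum, one_div, mul_inv, mul_assoc]

lemma IsSmoothingKernel.measurable_scaledKernel (hK : IsSmoothingKernel s 𝒳 𝒮 K) (h : ℝ) :
    Measurable (Function.uncurry (scaledKernel K h)) := by
  have h1 : Measurable fun z : E d × E d => (z.2, h⁻¹ • (z.2 - z.1)) := by fun_prop
  exact ((hK.measurable h).comp h1).const_mul _

/-- Substitute `u = h⁻¹ • (t - x)`: the Jacobian cancels the normalization. -/
lemma meanKernel_eq (hf : IsBoundedDensity 𝒳 B' B f) {h : ℝ} (hh : 0 < h) (t : E d) :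
    meanKernel 𝒳 f K h t = ∫ u, K h t u * f (t - h • u) := by
  rw [meanKernel, integral_law hf, setIntegral_eq_integral_of_forall_compl_eq_zero fun x hx => by
    rw [hf.isDensity.2.1 x hx, mul_zero]]
  have h1 : ∀ x, scaledKernel K h x t * f x
      = (h ^ d)⁻¹ * (fun u => K h t u * f (t - h • u)) (h⁻¹ • (t - x)) := fun x => by
    simp only [scaledKernel, smul_inv_smul₀ hh.ne', sub_sub_cancel]
    ring
  simp only [h1]
  rw [integral_const_mul, integral_comp_inv_smul_sub hh (fun u => K h t u * f (t - h • u)),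
    inv_mul_cancel_left₀ (by positivity)]

lemma measurable_meanKernel (hf : IsBoundedDensity 𝒳 B' B f) (hK : IsSmoothingKernel s 𝒳 𝒮 K)
    (h : ℝ) : Measurable (meanKernel 𝒳 f K h) := by
  have := isProbabilityMeasure_law hf
  exact ((hK.measurable_scaledKernel h).comp measurable_swap).stronglyMeasurable.integral_prod_right'
    (ν := law 𝒳 f) |>.measurable

/-- Square integrability of the rescaled kernel, uniformly in the sample point. -/
lemma IsSmoothingKernel.exists_scaledKernel_bounds (h𝒳 : IsCompact 𝒳)
    (hK : IsSmoothingKernel s 𝒳 𝒮 K) :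
    ∃ Q, 0 ≤ Q ∧ ∀ h, 0 < h → ∀ x, MemLp (scaledKernel K h x) 2 (volume.restrict 𝒳) ∧
      ∫ t in 𝒳, scaledKernel K h x t ^ 2 ≤ Q * (h ^ d)⁻¹ := by
  obtain ⟨κ, hκ, hκ2, -, hle⟩ := hK.envelope
  refine ⟨∫ u, κ u ^ 2, integral_nonneg fun _ => sq_nonneg _, fun h hh x => ?_⟩
  have hm : Measurable (scaledKernel K h x) :=
    (hK.measurable_scaledKernel h).comp (measurable_const.prodMk measurable_id)
  -- The kernel depends on `t` also through its boundary adaptation, so it is replaced by its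
  -- envelope before the substitution in `t`.
  have hdom : Integrable (fun t => ((h ^ d)⁻¹) ^ 2 * (fun u => κ u ^ 2) (h⁻¹ • (t - x))) :=
    (integrable_comp_inv_smul_sub_right hh hκ2 x).const_mul _
  have hbd : ∀ t ∈ 𝒳, scaledKernel K h x t ^ 2
      ≤ ((h ^ d)⁻¹) ^ 2 * (fun u => κ u ^ 2) (h⁻¹ • (t - x)) := fun t ht => by
    rw [scaledKernel, mul_pow]
    refine mul_le_mul_of_nonneg_left ?_ (sq_nonneg _)
    have h1 := abs_le.1 (hle h hh t ht (h⁻¹ • (t - x)))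
    exact sq_le_sq' h1.1 h1.2
  have hint : Integrable (fun t => scaledKernel K h x t ^ 2) (volume.restrict 𝒳) := by
    refine hdom.integrableOn.mono' (hm.pow_const 2).aestronglyMeasurable
      (ae_restrict_of_forall_mem h𝒳.measurableSet fun t ht => ?_)
    rw [Real.norm_eq_abs, abs_of_nonneg (sq_nonneg _)]
    exact hbd t ht
  refine ⟨(memLp_two_iff_integrable_sq hm.aestronglyMeasurable).2 hint, ?_⟩
  calc _ ≤ ∫ t in 𝒳, ((h ^ d)⁻¹) ^ 2 * (fun u => κ u ^ 2) (h⁻¹ • (t - x)) :=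
        integral_mono_ae hint hdom.integrableOn (ae_restrict_of_forall_mem h𝒳.measurableSet hbd)
    _ ≤ ∫ t, ((h ^ d)⁻¹) ^ 2 * (fun u => κ u ^ 2) (h⁻¹ • (t - x)) :=
        setIntegral_le_integral hdom (Eventually.of_forall fun t => by
          simp only [Pi.zero_apply]; positivity)
    _ = _ := by
        rw [integral_const_mul, integral_comp_inv_smul_sub_right hh (fun u => κ u ^ 2)]
        have : h ^ d ≠ 0 := by positivity
        field_simp

/-- The substitution absorbs the factor `h⁻ᵈ` and leaves `∫ B κ`, whatever the bandwidth. -/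
lemma IsSmoothingKernel.exists_abs_meanKernel_le (hf : IsBoundedDensity 𝒳 B' B f)
    (hK : IsSmoothingKernel s 𝒳 𝒮 K) :
    ∃ R, 0 ≤ R ∧ ∀ h, 0 < h → ∀ t ∈ 𝒳, |meanKernel 𝒳 f K h t| ≤ R := by
  obtain ⟨κ, hκ, -, -, hle⟩ := hK.envelope
  have hB := hf.pos
  have hκ0 : ∀ u, 0 ≤ κ u := fun u => by
    obtain ⟨t, ht⟩ := hf.nonempty
    exact (abs_nonneg _).trans (hle 1 one_pos t ht u)
  refine ⟨∫ u, B * κ u, integral_nonneg fun u => mul_nonneg hB.le (hκ0 u), fun h hh t ht => ?_⟩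
  rw [meanKernel_eq hf hh, ← Real.norm_eq_abs]
  refine norm_integral_le_of_norm_le (hκ.const_mul B) (Eventually.of_forall fun u => ?_)
  rw [norm_mul, mul_comm, Real.norm_eq_abs, Real.norm_eq_abs]
  exact mul_le_mul (hf.abs_apply_le _) (hle h hh t ht u) (abs_nonneg _) hB.le

lemma IsSmoothingKernel.integrable_scaledKernel (hf : IsBoundedDensity 𝒳 B' B f) (hs : 0 ≤ s)
    (hK : IsSmoothingKernel s 𝒳 𝒮 K) {h : ℝ} (hh : 0 < h) {t : E d} (ht : t ∈ 𝒳) :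
    Integrable (fun x => scaledKernel K h x t) (law 𝒳 f) := by
  have h1 : Integrable (K h t) := by
    simpa using hK.integrable_moment hs hh ht (r := 0) (by simp)
  exact integrable_law hf ((integrable_comp_inv_smul_sub hh h1 t).const_mul _)

lemma IsOptimalBandwidth.pos {b : ℕ → ℝ} (hb : IsOptimalBandwidth d s b) {n : ℕ} (hn : 1 ≤ n) :
    0 < b n := by
  obtain ⟨c, C, hc, h⟩ := hb
  have hn0 : (0 : ℝ) < n := by exact_mod_cast hn
  exact (mul_pos hc (Real.rpow_pos_of_pos hn0 _)).trans_le (h n hn).1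

lemma measurable_kde (hK : IsSmoothingKernel s 𝒳 𝒮 K) (b : ℕ → ℝ) (A : Finset ℕ) :
    Measurable fun z : (ℕ → E d) × E d => kde K b A z.1 z.2 := by
  simp only [kde_eq]
  refine (Finset.measurable_fun_sum _ fun i _ => ?_).const_mul _
  have h1 : Measurable fun z : (ℕ → E d) × E d => (z.1 i, z.2) := by fun_prop
  exact (hK.measurable_scaledKernel _).comp h1

lemma measurable_densEst (hK : IsSmoothingKernel s 𝒳 𝒮 K) (trunc : Bool) (B' B : ℝ) (b : ℕ → ℝ)
    (A : Finset ℕ) : Measurable fun z : (ℕ → E d) × E d => densEst trunc B' B K b A z.1 z.2 := by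
  have h := measurable_kde hK b A
  unfold densEst
  split_ifs
  exacts [measurable_const.max (measurable_const.min h), h]

lemma memLp_kde (h𝒳 : IsCompact 𝒳) (hK : IsSmoothingKernel s 𝒳 𝒮 K) {b : ℕ → ℝ}
    (hb : IsOptimalBandwidth d s b) (A : Finset ℕ) (x : ℕ → E d) :
    MemLp (kde K b A x) 2 (volume.restrict 𝒳) := by
  obtain ⟨Q, -, hQ⟩ := hK.exists_scaledKernel_bounds h𝒳
  have heq : kde K b A x
      = fun t => (A.card : ℝ)⁻¹ * ∑ i ∈ A, scaledKernel K (b A.card) (x i) t := by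
    ext t
    exact kde_eq b A x t
  rw [heq]
  -- The bandwidth is known to be positive only for a nonempty sample; for the empty one the
  -- estimate is zero.
  rcases A.eq_empty_or_nonempty with rfl | hA
  · simp
  · exact (memLp_finsetSum A fun i _ => (hQ _ (hb.pos hA.card_pos) (x i)).1).const_mul _

lemma densEst_mem_admissible (hf : IsBoundedDensity 𝒳 B' B f) (hK : IsSmoothingKernel s 𝒳 𝒮 K)
    (trunc : Bool) {b : ℕ → ℝ} (hb : IsOptimalBandwidth d s b) (A : Finset ℕ) (x : ℕ → E d) :
    densEst trunc B' B K b A x ∈ Admissible 𝒳 (valueRange trunc B' B) := by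
  have := hf.isFiniteMeasure
  have hm : Measurable (densEst trunc B' B K b A x) :=
    (measurable_densEst hK trunc B' B b A).comp (measurable_const.prodMk measurable_id)
  refine ⟨hm, fun t _ => ?_, ?_⟩
  · unfold densEst valueRange
    split_ifs
    exacts [⟨le_max_left _ _, max_le hf.lt.le (min_le_left _ _)⟩, trivial]
  · cases trunc with
    | false =>
      have h1 : densEst false B' B K b A x = kde K b A x := by ext t; simp [densEst]
      rw [h1]
      exact memLp_kde hf.isCompact hK hb A x
    | true =>
      refine MemLp.of_bound hm.aestronglyMeasurable (|B'| + |B|) (Eventually.of_forall fun t => ?_)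
      simp only [densEst, if_true, Real.norm_eq_abs]
      have h1 : max B' (min B (kde K b A x t)) ≤ B := max_le hf.lt.le (min_le_left _ _)
      have h2 : B' ≤ max B' (min B (kde K b A x t)) := le_max_left _ _
      rw [abs_le]
      constructor
      · linarith [neg_abs_le B', abs_nonneg B]
      · linarith [le_abs_self B, abs_nonneg B']

/-- Truncation projects onto an interval that contains `f t`, which cannot increase the distance to
`f t`. -/
lemma abs_sub_densEst_le (hf : IsBoundedDensity 𝒳 B' B f) (trunc : Bool) (b : ℕ → ℝ) (A : Finset ℕ)
    (x : ℕ → E d) {t : E d} (ht : t ∈ 𝒳) :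
    |f t - densEst trunc B' B K b A x t| ≤ |f t - kde K b A x t| := by
  unfold densEst
  split_ifs
  · obtain ⟨h1, h2⟩ := hf.bounds t ht
    set y := kde K b A x t
    rcases le_total y B' with h3 | h3
    · rw [min_eq_right (h3.trans hf.lt.le), max_eq_left h3, abs_of_pos (by linarith),
        abs_of_pos (by linarith)]
      linarith
    · rcases le_total y B with h4 | h4
      · rw [min_eq_right h4, max_eq_right h3]
      · rw [min_eq_left h4, max_eq_right hf.lt.le, abs_of_neg (by linarith),
          abs_of_neg (by linarith)]
        linarith
  · exact le_rfl

/-- The squared error is controlled by the fluctuation and the bias of the kernel estimate. -/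
lemma sqDist_densEst_le (hf : IsBoundedDensity 𝒳 B' B f) (hK : IsSmoothingKernel s 𝒳 𝒮 K)
    (trunc : Bool) {b : ℕ → ℝ} (hb : IsOptimalBandwidth d s b) {A : Finset ℕ} (hA : A.Nonempty)
    (x : ℕ → E d) {β : ℝ} (hβ : ∀ t ∈ 𝒳, |meanKernel 𝒳 f K (b A.card) t - f t| ≤ β) :
    sqDist 𝒳 f (densEst trunc B' B K b A x)
      ≤ 2 * ((A.card : ℝ)⁻¹ ^ 2 * ∫ t in 𝒳, (∑ i ∈ A,
          (scaledKernel K (b A.card) (x i) t - meanKernel 𝒳 f K (b A.card) t)) ^ 2)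
        + 2 * (volume.real 𝒳 * β ^ 2) := by
  have := hf.isFiniteMeasure
  have hn : (A.card : ℝ) ≠ 0 := by exact_mod_cast hA.card_pos.ne'
  have hvol : (volume.restrict 𝒳).real Set.univ = volume.real 𝒳 := by simp [measureReal_def]
  obtain ⟨Q, -, hQ⟩ := hK.exists_scaledKernel_bounds hf.isCompact
  obtain ⟨R, -, hR⟩ := hK.exists_abs_meanKernel_le hf
  have hbp := hb.pos hA.card_pos
  set h := b A.card with hh
  have hmean : MemLp (meanKernel 𝒳 f K h) 2 (volume.restrict 𝒳) :=
    MemLp.of_bound (measurable_meanKernel hf hK h).aestronglyMeasurable R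
      (ae_restrict_of_forall_mem hf.isCompact.measurableSet (hR h hbp))
  have hL : MemLp (fun t => ∑ i ∈ A, (scaledKernel K h (x i) t - meanKernel 𝒳 f K h t)) 2
      (volume.restrict 𝒳) := memLp_finsetSum A fun i _ => (hQ h hbp (x i)).1.sub hmean
  have hest : Integrable (fun t => (f t - densEst trunc B' B K b A x t) ^ 2)
      (volume.restrict 𝒳) :=
    ((hf.memLp 2).sub (densEst_mem_admissible hf hK trunc hb A x).2.2).integrable_sq
  have hdom : Integrable (fun t => 2 * ((A.card : ℝ)⁻¹ ^ 2 *
      (∑ i ∈ A, (scaledKernel K h (x i) t - meanKernel 𝒳 f K h t)) ^ 2)) (volume.restrict 𝒳) :=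
    (hL.integrable_sq.const_mul _).const_mul 2
  calc _ ≤ ∫ t in 𝒳, (2 * ((A.card : ℝ)⁻¹ ^ 2 *
          (∑ i ∈ A, (scaledKernel K h (x i) t - meanKernel 𝒳 f K h t)) ^ 2) + 2 * β ^ 2) := by
        refine integral_mono_ae hest (hdom.add (integrable_const _))
          (ae_restrict_of_forall_mem hf.isCompact.measurableSet fun t ht => ?_)
        have h1 : (f t - densEst trunc B' B K b A x t) ^ 2 ≤ (f t - kde K b A x t) ^ 2 :=
          sq_le_sq.2 (abs_sub_densEst_le hf trunc b A x ht)
        refine h1.trans ?_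
        have h2 : kde K b A x t - f t
            = (A.card : ℝ)⁻¹ * (∑ i ∈ A, (scaledKernel K h (x i) t - meanKernel 𝒳 f K h t))
              + (meanKernel 𝒳 f K h t - f t) := by
          rw [kde_eq, Finset.sum_sub_distrib, Finset.sum_const, nsmul_eq_mul, mul_sub,
            inv_mul_cancel_left₀ hn]
          ring
        have h3 : (meanKernel 𝒳 f K h t - f t) ^ 2 ≤ β ^ 2 :=
          sq_le_sq' (abs_le.1 (hβ t ht)).1 (abs_le.1 (hβ t ht)).2
        have h4 : (f t - kde K b A x t) ^ 2 = (kde K b A x t - f t) ^ 2 := by ring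
        rw [h4, h2]
        simp only
        rw [← mul_pow]
        nlinarith [sq_nonneg ((A.card : ℝ)⁻¹ *
          (∑ i ∈ A, (scaledKernel K h (x i) t - meanKernel 𝒳 f K h t))
            - (meanKernel 𝒳 f K h t - f t))]
    _ = _ := by
        rw [integral_add hdom (integrable_const _), integral_const_mul, integral_const_mul,
          integral_const, hvol, smul_eq_mul]
        ring

/-- The rate of convergence of the squared `L²` error of the density estimates. -/
def rate (d : ℕ) (s : ℝ) (n : ℕ) : ℝ := (n : ℝ) ^ (-(2 * s) / (2 * s + d))

lemma rate_nonneg (n : ℕ) : 0 ≤ rate d s n := Real.rpow_nonneg (Nat.cast_nonneg n) _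

lemma rate_sq (n : ℕ) : rate d s n ^ 2 = (n : ℝ) ^ (-(4 * s) / (2 * s + d)) := by
  rw [rate, ← Real.rpow_natCast, ← Real.rpow_mul (Nat.cast_nonneg n)]
  congr 1
  push_cast
  ring

/-- This bandwidth balances the squared bias `b ^ (2 s)` and the variance `b ^ (-d) / n`. The `+ 1`
makes room for the mean subtracted from each kernel; `1 ≤ n ^ (d / (2 s + d))` absorbs it. -/
lemma IsOptimalBandwidth.exists_bounds (hs : 0 < s) {b : ℕ → ℝ} (hb : IsOptimalBandwidth d s b)
    {h₁ : ℝ} (hh₁ : 0 < h₁) :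
    ∃ C k₀, 0 ≤ C ∧ 1 ≤ k₀ ∧ ∀ n, k₀ ≤ n → b n ≤ h₁ ∧ b n ^ (2 * s) ≤ C * rate d s n ∧
      ((b n ^ d)⁻¹ + 1) * (n : ℝ)⁻¹ ≤ C * rate d s n := by
  obtain ⟨c, C, hc, hcC⟩ := id hb
  have hsd : 0 < 2 * s + d := by positivity
  have hlim : Tendsto (fun n : ℕ => C * (n : ℝ) ^ (-1 / (2 * s + d))) atTop (𝓝 (C * 0)) := by
    refine Tendsto.const_mul C ?_
    have h1 : Tendsto (fun x : ℝ => x ^ (-(1 / (2 * s + d)))) atTop (𝓝 0) :=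
      tendsto_rpow_neg_atTop (by positivity)
    have h2 := h1.comp tendsto_natCast_atTop_atTop
    simpa [Function.comp_def, neg_div] using h2
  rw [mul_zero] at hlim
  obtain ⟨k₁, hk₁⟩ := eventually_atTop.1 (hlim.eventually_le_const hh₁)
  refine ⟨|C| ^ (2 * s) + ((c ^ d)⁻¹ + 1), max 1 k₁, by positivity, le_max_left _ _, fun n hn => ?_⟩
  have hn1 : 1 ≤ n := (le_max_left _ _).trans hn
  have hn0 : (1 : ℝ) ≤ n := by exact_mod_cast hn1
  have hnpos : (0 : ℝ) < n := by linarith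
  obtain ⟨hlo, hhi⟩ := hcC n hn1
  have hbp := hb.pos hn1
  have hr := rate_nonneg (d := d) (s := s) n
  refine ⟨hhi.trans (hk₁ n ((le_max_right _ _).trans hn)), ?_, ?_⟩
  · calc b n ^ (2 * s) ≤ (|C| * (n : ℝ) ^ (-1 / (2 * s + d))) ^ (2 * s) := by
          refine Real.rpow_le_rpow hbp.le (hhi.trans ?_) (by positivity)
          exact mul_le_mul_of_nonneg_right (le_abs_self C) (by positivity)
      _ = |C| ^ (2 * s) * rate d s n := by
          rw [Real.mul_rpow (abs_nonneg _) (by positivity), ← Real.rpow_mul hnpos.le, rate]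
          congr 2
          ring
      _ ≤ _ := mul_le_mul_of_nonneg_right (le_add_of_nonneg_right (by positivity)) hr
  · have hid : (n : ℝ) ^ ((d : ℝ) / (2 * s + d)) * (n : ℝ)⁻¹ = rate d s n := by
      rw [← Real.rpow_neg_one, ← Real.rpow_add hnpos, rate]
      congr 1
      field_simp
      ring
    have hone : (1 : ℝ) ≤ (n : ℝ) ^ ((d : ℝ) / (2 * s + d)) :=
      Real.one_le_rpow hn0 (by positivity)
    have hinv : (b n ^ d)⁻¹ ≤ (c ^ d)⁻¹ * (n : ℝ) ^ ((d : ℝ) / (2 * s + d)) := by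
      have h1 : (c * (n : ℝ) ^ (-1 / (2 * s + d))) ^ d ≤ b n ^ d :=
        pow_le_pow_left₀ (by positivity) hlo d
      have h2 : (c * (n : ℝ) ^ (-1 / (2 * s + d))) ^ d
          = c ^ d * ((n : ℝ) ^ ((d : ℝ) / (2 * s + d)))⁻¹ := by
        rw [mul_pow, ← Real.rpow_natCast, ← Real.rpow_natCast ((n : ℝ) ^ (-1 / (2 * s + d))),
          ← Real.rpow_mul hnpos.le, ← Real.rpow_neg hnpos.le]
        congr 2
        ring
      rw [h2] at h1
      calc (b n ^ d)⁻¹ ≤ (c ^ d * ((n : ℝ) ^ ((d : ℝ) / (2 * s + d)))⁻¹)⁻¹ :=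
            inv_anti₀ (by positivity) h1
        _ = _ := by rw [mul_inv, inv_inv]
    calc ((b n ^ d)⁻¹ + 1) * (n : ℝ)⁻¹
        ≤ (((c ^ d)⁻¹ + 1) * (n : ℝ) ^ ((d : ℝ) / (2 * s + d))) * (n : ℝ)⁻¹ := by
          refine mul_le_mul_of_nonneg_right ?_ (by positivity)
          rw [add_mul, one_mul]
          exact add_le_add hinv hone
      _ = ((c ^ d)⁻¹ + 1) * rate d s n := by rw [mul_assoc, hid]
      _ ≤ _ := mul_le_mul_of_nonneg_right (le_add_of_nonneg_left (by positivity)) hr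

/-! ### Second moments of the squared `L²` error -/

section Risk

variable {Ω : Type*} [MeasurableSpace Ω] {P : Measure Ω} [IsProbabilityMeasure P]
  {X : ℕ → Ω → E d}

/-- Second moment of the squared `L²` error of the density estimate. -/
lemma exists_lintegral_sq_sqDist_le (hs : 0 < s) (h𝒮 : IsClosed 𝒮) (h𝒮' : UniqueDiffOn ℝ 𝒮)
    (h𝒳𝒮 : 𝒳 ⊆ 𝒮) (hf : IsBoundedDensity 𝒳 B' B f) (hfH : f ∈ HolderClass s L 𝒮)
    (hK : IsSmoothingKernel s 𝒳 𝒮 K) (trunc : Bool) {b : ℕ → ℝ} (hb : IsOptimalBandwidth d s b)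
    (hX : ∀ i, Measurable (X i)) (hlaw : ∀ i, P.map (X i) = law 𝒳 f) (hind : iIndepFun X P) :
    ∃ C k₀, 0 ≤ C ∧ 1 ≤ k₀ ∧ ∀ A : Finset ℕ, k₀ ≤ A.card →
      ∫⁻ ω, ENNReal.ofReal
          (sqDist 𝒳 f (densEst trunc B' B K b A fun i => X i ω) ^ 2) ∂P
        ≤ ENNReal.ofReal (C * rate d s A.card ^ 2) := by
  have := hf.isFiniteMeasure
  have hvol : (volume.restrict 𝒳).real Set.univ = volume.real 𝒳 := by simp [measureReal_def]
  have hv : 0 ≤ volume.real 𝒳 := measureReal_nonneg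
  obtain ⟨β, h₁, hβ, hh₁, hbias⟩ := hK.abs_bias_le hs h𝒮 h𝒮' h𝒳𝒮 hf hfH
  obtain ⟨C₀, k₀, hC₀, hk₀, hrate⟩ := hb.exists_bounds hs hh₁
  obtain ⟨Q, hQ0, hQ⟩ := hK.exists_scaledKernel_bounds hf.isCompact
  obtain ⟨R, hR0, hR⟩ := hK.exists_abs_meanKernel_le hf
  -- `M₀ * ((h ^ d)⁻¹ + 1)` will bound the squared norm of one centered summand: `Q` comes from the
  -- kernel and `R` from its mean.
  set M₀ := 2 * Q + 2 * (volume.real 𝒳 * R ^ 2) with hM₀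
  have hM₀0 : 0 ≤ M₀ := by positivity
  refine ⟨48 * (M₀ * C₀) ^ 2 + 8 * (volume.real 𝒳 * β ^ 2 * C₀) ^ 2, k₀, by positivity, hk₀,
    fun A hA => ?_⟩
  have hcard : 1 ≤ A.card := hk₀.trans hA
  have hAne : A.Nonempty := Finset.card_pos.1 hcard
  have hn : (0 : ℝ) < A.card := by exact_mod_cast hcard
  obtain ⟨hble, hb2s, hbd⟩ := hrate A.card hA
  have hbp := hb.pos hcard
  set h := b A.card with hh
  set r := rate d s A.card with hr
  have hr0 : 0 ≤ r := rate_nonneg _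
  have hmeasm := measurable_meanKernel hf hK h
  have hmean : MemLp (meanKernel 𝒳 f K h) 2 (volume.restrict 𝒳) :=
    MemLp.of_bound hmeasm.aestronglyMeasurable R
      (ae_restrict_of_forall_mem hf.isCompact.measurableSet (hR h hbp))
  set c : E d → E d → ℝ := fun x t => scaledKernel K h x t - meanKernel 𝒳 f K h t with hc
  have hcm : Measurable (Function.uncurry c) :=
    (hK.measurable_scaledKernel h).sub (hmeasm.comp measurable_snd)
  have hcL : ∀ x, MemLp (c x) 2 (volume.restrict 𝒳) := fun x => (hQ h hbp x).1.sub hmean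
  have hcM : ∀ x, ∫ t in 𝒳, c x t ^ 2 ≤ M₀ * ((h ^ d)⁻¹ + 1) := fun x => by
    have h1 := (hQ h hbp x).1.integrable_sq
    have h2 := hmean.integrable_sq
    calc ∫ t in 𝒳, c x t ^ 2
        ≤ ∫ t in 𝒳, (2 * scaledKernel K h x t ^ 2 + 2 * R ^ 2) := by
          refine integral_mono_ae (hcL x).integrable_sq ((h1.const_mul 2).add (integrable_const _))
            (ae_restrict_of_forall_mem hf.isCompact.measurableSet fun t ht => ?_)
          have h3 : meanKernel 𝒳 f K h t ^ 2 ≤ R ^ 2 :=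
            sq_le_sq' (abs_le.1 (hR h hbp t ht)).1 (abs_le.1 (hR h hbp t ht)).2
          simp only [hc]
          nlinarith [sq_nonneg (scaledKernel K h x t + meanKernel 𝒳 f K h t)]
      _ = 2 * (∫ t in 𝒳, scaledKernel K h x t ^ 2) + 2 * (volume.real 𝒳 * R ^ 2) := by
          rw [integral_add (h1.const_mul 2) (integrable_const _), integral_const_mul,
            integral_const, hvol, smul_eq_mul]
          ring
      _ ≤ 2 * (Q * (h ^ d)⁻¹) + 2 * (volume.real 𝒳 * R ^ 2) := by linarith [(hQ h hbp x).2]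
      _ ≤ M₀ * ((h ^ d)⁻¹ + 1) := by
          have h4 : 0 ≤ (h ^ d)⁻¹ := by positivity
          have h5 : 0 ≤ volume.real 𝒳 * R ^ 2 := by positivity
          rw [hM₀]
          nlinarith [mul_nonneg h5 h4]
  have hc0 : ∀ᵐ t ∂(volume.restrict 𝒳), ∫ x, c x t ∂(law 𝒳 f) = 0 := by
    have := isProbabilityMeasure_law hf
    refine ae_restrict_of_forall_mem hf.isCompact.measurableSet fun t ht => ?_
    simp only [hc]
    rw [integral_sub (hK.integrable_scaledKernel hf hs.le hbp ht) (integrable_const _),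
      integral_const]
    simp [meanKernel]
  have hkey := lintegral_sq_integral_sq_sum_le hX hlaw hind hcm hcL hcM hc0 A
  have hpt : ∀ ω, ENNReal.ofReal (sqDist 𝒳 f (densEst trunc B' B K b A fun i => X i ω) ^ 2)
      ≤ ENNReal.ofReal (8 * (A.card : ℝ)⁻¹ ^ 4) *
          ENNReal.ofReal ((∫ t in 𝒳, (∑ i ∈ A, c (X i ω) t) ^ 2) ^ 2)
        + ENNReal.ofReal (8 * (volume.real 𝒳 * β ^ 2 * (C₀ * r)) ^ 2) := by
    intro ω
    rw [← ENNReal.ofReal_mul (by positivity), ← ENNReal.ofReal_add (by positivity) (by positivity)]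
    refine ENNReal.ofReal_le_ofReal ?_
    have h1 := sqDist_densEst_le hf hK trunc hb hAne (fun i => X i ω) (β := β * h ^ s)
      fun t ht => by
        rw [meanKernel_eq hf hbp]
        exact hbias h hbp hble t ht
    have h2 := sqDist_nonneg (𝒳 := 𝒳) f (densEst trunc B' B K b A fun i => X i ω)
    have h3 : (β * h ^ s) ^ 2 ≤ β ^ 2 * (C₀ * r) := by
      rw [mul_pow, ← Real.rpow_natCast (h ^ s), ← Real.rpow_mul hbp.le]
      refine mul_le_mul_of_nonneg_left ?_ (sq_nonneg _)
      have : s * ((2 : ℕ) : ℝ) = 2 * s := by push_cast; ring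
      rw [this]
      exact hb2s
    have h4 : volume.real 𝒳 * (β * h ^ s) ^ 2 ≤ volume.real 𝒳 * β ^ 2 * (C₀ * r) := by
      rw [mul_assoc]
      exact mul_le_mul_of_nonneg_left h3 hv
    set D := sqDist 𝒳 f (densEst trunc B' B K b A fun i => X i ω)
    set W := ∫ t in 𝒳, (∑ i ∈ A, c (X i ω) t) ^ 2 with hW
    have h5 : D ≤ 2 * ((A.card : ℝ)⁻¹ ^ 2 * W) + 2 * (volume.real 𝒳 * β ^ 2 * (C₀ * r)) :=
      h1.trans (by linarith)
    calc D ^ 2 ≤ (2 * ((A.card : ℝ)⁻¹ ^ 2 * W) + 2 * (volume.real 𝒳 * β ^ 2 * (C₀ * r))) ^ 2 :=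
          pow_le_pow_left₀ h2 h5 2
      _ ≤ 8 * ((A.card : ℝ)⁻¹ ^ 2 * W) ^ 2 + 8 * (volume.real 𝒳 * β ^ 2 * (C₀ * r)) ^ 2 := by
          nlinarith [sq_nonneg ((A.card : ℝ)⁻¹ ^ 2 * W - volume.real 𝒳 * β ^ 2 * (C₀ * r))]
      _ = _ := by ring
  calc _ ≤ _ := lintegral_mono hpt
    _ = ENNReal.ofReal (8 * (A.card : ℝ)⁻¹ ^ 4) *
          (∫⁻ ω, ENNReal.ofReal ((∫ t in 𝒳, (∑ i ∈ A, c (X i ω) t) ^ 2) ^ 2) ∂P)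
        + ENNReal.ofReal (8 * (volume.real 𝒳 * β ^ 2 * (C₀ * r)) ^ 2) := by
        rw [lintegral_add_right _ measurable_const, lintegral_const_mul' _ _ ENNReal.ofReal_ne_top]
        simp
    _ ≤ ENNReal.ofReal (8 * (A.card : ℝ)⁻¹ ^ 4) *
          ENNReal.ofReal (6 * (A.card * (M₀ * ((h ^ d)⁻¹ + 1))) ^ 2)
        + ENNReal.ofReal (8 * (volume.real 𝒳 * β ^ 2 * (C₀ * r)) ^ 2) := by gcongr
    _ ≤ _ := by
        rw [← ENNReal.ofReal_mul (by positivity),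
          ← ENNReal.ofReal_add (by positivity) (by positivity)]
        refine ENNReal.ofReal_le_ofReal ?_
        -- The quadratic form has second moment of order `n²`; after division by `n⁴` this is the
        -- square of the variance term `(h⁻ᵈ + 1) / n`. The constant is `48 = 8 * 6`.
        have h6 : 8 * (A.card : ℝ)⁻¹ ^ 4 * (6 * (A.card * (M₀ * ((h ^ d)⁻¹ + 1))) ^ 2)
            = 48 * (M₀ * (((h ^ d)⁻¹ + 1) * (A.card : ℝ)⁻¹)) ^ 2 := by
          field_simp
          ring
        rw [h6]
        have h7 : (M₀ * (((h ^ d)⁻¹ + 1) * (A.card : ℝ)⁻¹)) ^ 2 ≤ (M₀ * (C₀ * r)) ^ 2 := by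
          gcongr
        calc _ ≤ 48 * (M₀ * (C₀ * r)) ^ 2 + 8 * (volume.real 𝒳 * β ^ 2 * (C₀ * r)) ^ 2 := by
              linarith
          _ = _ := by ring

/-- First moments from second moments, at scale `r`. -/
lemma lintegral_ofReal_le_of_sq {D : Ω → ℝ} {C r : ℝ} (hC : 0 ≤ C) (hr : 0 < r)
    (h : ∫⁻ ω, ENNReal.ofReal (D ω ^ 2) ∂P ≤ ENNReal.ofReal (C * r ^ 2)) :
    ∫⁻ ω, ENNReal.ofReal (D ω) ∂P ≤ ENNReal.ofReal ((C + 1) * r) := by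
  -- `D ≤ r + D² / r` loses only a constant when `D` has size `r`, and unlike Cauchy–Schwarz it
  -- needs no measurability of `D`.
  have hpt : ∀ ω, ENNReal.ofReal (D ω) ≤ ENNReal.ofReal r
      + ENNReal.ofReal r⁻¹ * ENNReal.ofReal (D ω ^ 2) := fun ω => by
    rw [← ENNReal.ofReal_mul (by positivity), ← ENNReal.ofReal_add hr.le (by positivity)]
    refine ENNReal.ofReal_le_ofReal ?_
    have h1 : r * D ω ≤ r ^ 2 + D ω ^ 2 := by nlinarith [sq_nonneg (r - D ω), sq_nonneg (r + D ω)]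
    have h2 : r * (r + r⁻¹ * D ω ^ 2) = r ^ 2 + D ω ^ 2 := by field_simp
    exact le_of_mul_le_mul_left (h1.trans h2.ge) hr
  calc _ ≤ _ := lintegral_mono hpt
    _ = ENNReal.ofReal r + ENNReal.ofReal r⁻¹ * ∫⁻ ω, ENNReal.ofReal (D ω ^ 2) ∂P := by
        rw [lintegral_add_left measurable_const, lintegral_const_mul' _ _ ENNReal.ofReal_ne_top]
        simp
    _ ≤ ENNReal.ofReal r + ENNReal.ofReal r⁻¹ * ENNReal.ofReal (C * r ^ 2) := by gcongr
    _ = _ := by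
        rw [← ENNReal.ofReal_mul (by positivity), ← ENNReal.ofReal_add hr.le (by positivity)]
        congr 1
        field_simp
        ring

end Risk

end Kernel

/-! ### Averages over an independent sample -/

section Averages

variable {Ω α Θ : Type*} [MeasurableSpace Ω] {P : Measure Ω} [IsProbabilityMeasure P]
  [MeasurableSpace α] [MeasurableSpace Θ] {μ : Measure α} {X : ℕ → Ω → α}

/-- Variances of independent terms add, and each is at most a second moment. General weights serve
both the averages and the correction for unequal halves. -/
lemma lintegral_sq_weighted_sum_le (hX : ∀ i, Measurable (X i)) (hlaw : ∀ i, P.map (X i) = μ)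
    (hind : iIndepFun X P) {u : α → ℝ} (hu : Measurable u) (hL : MemLp u 2 μ) (C : Finset ℕ)
    (w : ℕ → ℝ) :
    ∫⁻ ω, ENNReal.ofReal ((∑ i ∈ C, w i * (u (X i ω) - ∫ x, u x ∂μ)) ^ 2) ∂P
      ≤ ENNReal.ofReal (∑ i ∈ C, w i ^ 2) * ∫⁻ x, ENNReal.ofReal (u x ^ 2) ∂μ := by
  have hprob : IsProbabilityMeasure μ :=
    hlaw 0 ▸ Measure.isProbabilityMeasure_map (hX 0).aemeasurable
  have hLi : ∀ i, MemLp (fun ω => u (X i ω)) 2 P := fun i => by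
    have := (hlaw i).symm ▸ hL
    exact (memLp_map_measure_iff hu.aestronglyMeasurable (hX i).aemeasurable).1 this
  have hmean : ∀ i, ∫ ω, u (X i ω) ∂P = ∫ x, u x ∂μ := fun i => by
    rw [← hlaw i, integral_map (hX i).aemeasurable hu.aestronglyMeasurable]
  have hsecond : ∀ i, ∫ ω, u (X i ω) ^ 2 ∂P = ∫ x, u x ^ 2 ∂μ := fun i => by
    rw [← hlaw i, integral_map (hX i).aemeasurable (hu.pow_const 2).aestronglyMeasurable]
  have hLw : ∀ i, MemLp (fun ω => w i * u (X i ω)) 2 P := fun i => (hLi i).const_mul _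
  have hvar : variance (fun ω => ∑ i ∈ C, w i * u (X i ω)) P
      ≤ (∑ i ∈ C, w i ^ 2) * ∫ x, u x ^ 2 ∂μ := by
    have h1 : (fun ω => ∑ i ∈ C, w i * u (X i ω)) = ∑ i ∈ C, fun ω => w i * u (X i ω) := by
      ext ω; simp
    rw [h1, IndepFun.variance_sum (fun i _ => hLw i) fun i _ j _ hij =>
      ((hind.indepFun hij).comp (hu.const_mul (w i)) (hu.const_mul (w j))), Finset.sum_mul]
    refine Finset.sum_le_sum fun i _ => ?_
    rw [variance_const_mul]
    refine mul_le_mul_of_nonneg_left ?_ (sq_nonneg _)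
    rw [← hsecond i]
    exact variance_le_expectation_sq (hLi i).1
  have hLs : MemLp (fun ω => ∑ i ∈ C, w i * u (X i ω)) 2 P := memLp_finsetSum C fun i _ => hLw i
  have heq : ∀ ω, ∑ i ∈ C, w i * (u (X i ω) - ∫ x, u x ∂μ)
      = ∑ i ∈ C, w i * u (X i ω) - ∫ ω, ∑ i ∈ C, w i * u (X i ω) ∂P := fun ω => by
    rw [integral_finsetSum _ fun i _ => (hLw i).integrable (by norm_num), ← Finset.sum_sub_distrib]
    refine Finset.sum_congr rfl fun i _ => ?_
    rw [integral_const_mul, hmean]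
    ring
  simp only [heq]
  have hLc : Integrable (fun ω => (∑ i ∈ C, w i * u (X i ω)
      - ∫ ω, ∑ i ∈ C, w i * u (X i ω) ∂P) ^ 2) P := (hLs.sub (memLp_const _)).integrable_sq
  rw [← ofReal_integral_eq_lintegral_ofReal hLc
      (Eventually.of_forall fun _ => sq_nonneg _),
    ← ofReal_integral_eq_lintegral_ofReal hL.integrable_sq
      (Eventually.of_forall fun _ => sq_nonneg _),
    ← ENNReal.ofReal_mul (Finset.sum_nonneg fun i _ => sq_nonneg _)]
  refine ENNReal.ofReal_le_ofReal ?_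
  rw [variance_eq_integral hLs.1.aemeasurable] at hvar
  exact hvar

lemma lintegral_comp_prodMk_of_indepFun {β : Type*} [MeasurableSpace β] {U : Ω → Θ} {V : Ω → β}
    (hU : Measurable U) (hV : Measurable V) (hUV : IndepFun U V P) {F : Θ × β → ℝ≥0∞}
    (hF : Measurable F) :
    ∫⁻ ω, F (U ω, V ω) ∂P = ∫⁻ ω, ∫⁻ ω', F (U ω, V ω') ∂P ∂P := by
  have := Measure.isProbabilityMeasure_map hU.aemeasurable (μ := P)
  have := Measure.isProbabilityMeasure_map hV.aemeasurable (μ := P)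
  have h1 : ∀ u, ∫⁻ v, F (u, v) ∂(P.map V) = ∫⁻ ω', F (u, V ω') ∂P := fun u =>
    lintegral_map (hF.comp (measurable_const.prodMk measurable_id)) hV
  rw [← lintegral_map (f := F) (g := fun ω => (U ω, V ω)) hF (hU.prodMk hV),
    (indepFun_iff_map_prod_eq_prod_map_map hU.aemeasurable hV.aemeasurable).1 hUV,
    lintegral_prod _ hF.aemeasurable, lintegral_map hF.lintegral_prod_right' hU]
  simp only [h1]

/-- Conditional variance of the average of a function which depends on an independent sample. -/
lemma lintegral_sq_average_sub_le (hX : ∀ i, Measurable (X i)) (hlaw : ∀ i, P.map (X i) = μ)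
    (hind : iIndepFun X P) {C : Finset ℕ} (hC : C.Nonempty) {θ : Ω → Θ} (hθ : Measurable θ)
    (hθX : IndepFun θ (fun ω (i : C) => X i ω) P) {h : Θ → α → ℝ}
    (hh : Measurable (Function.uncurry h)) (hL : ∀ ω, MemLp (h (θ ω)) 2 μ) {V : Ω → ℝ≥0∞}
    (hV : ∀ ω, ∫⁻ x, ENNReal.ofReal (h (θ ω) x ^ 2) ∂μ ≤ V ω) :
    ∫⁻ ω, ENNReal.ofReal
        ((1 / (C.card : ℝ) * ∑ i ∈ C, h (θ ω) (X i ω) - ∫ x, h (θ ω) x ∂μ) ^ 2) ∂P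
      ≤ ENNReal.ofReal (C.card : ℝ)⁻¹ * ∫⁻ ω, V ω ∂P := by
  have hprob : IsProbabilityMeasure μ :=
    hlaw 0 ▸ Measure.isProbabilityMeasure_map (hX 0).aemeasurable
  have hn : (C.card : ℝ) ≠ 0 := by exact_mod_cast hC.card_pos.ne'
  set F : Θ × (C → α) → ℝ≥0∞ := fun z => ENNReal.ofReal
    ((1 / (C.card : ℝ) * ∑ i : C, h z.1 (z.2 i) - ∫ x, h z.1 x ∂μ) ^ 2) with hF
  have hFm : Measurable F := by
    have h1 : Measurable fun z : Θ × (C → α) => ∑ i : C, h z.1 (z.2 i) :=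
      Finset.measurable_fun_sum _ fun i _ =>
        hh.comp (measurable_fst.prodMk ((measurable_pi_apply i).comp measurable_snd))
    have h2 : Measurable fun t : Θ => ∫ x, h t x ∂μ :=
      (hh.stronglyMeasurable.integral_prod_right' (ν := μ)).measurable
    exact (((h1.const_mul _).sub (h2.comp measurable_fst)).pow_const 2).ennreal_ofReal
  have hsum : ∀ (t : Θ) ω, F (t, fun i : C => X i ω) = ENNReal.ofReal
      ((1 / (C.card : ℝ) * ∑ i ∈ C, h t (X i ω) - ∫ x, h t x ∂μ) ^ 2) := fun t ω => by
    simp only [hF]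
    rw [Finset.sum_coe_sort C fun i => h t (X i ω)]
  simp only [← hsum]
  -- Independence allows `θ` to be frozen. For each frozen value the sum is over an i.i.d. sample,
  -- with weights `1 / |C|` whose squares sum to `1 / |C|`.
  rw [lintegral_comp_prodMk_of_indepFun hθ (measurable_pi_lambda _ fun i : C => hX i) hθX hFm,
    ← lintegral_const_mul' _ _ ENNReal.ofReal_ne_top]
  refine lintegral_mono fun ω => ?_
  have hu : Measurable (h (θ ω)) := hh.comp (measurable_const.prodMk measurable_id)
  have key := lintegral_sq_weighted_sum_le hX hlaw hind hu (hL ω) C fun _ => (C.card : ℝ)⁻¹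
  have hw : ∑ _i ∈ C, ((C.card : ℝ)⁻¹) ^ 2 = (C.card : ℝ)⁻¹ := by
    rw [Finset.sum_const, nsmul_eq_mul]
    field_simp
  have heq : ∀ ω', ∑ i ∈ C, (C.card : ℝ)⁻¹ * (h (θ ω) (X i ω') - ∫ x, h (θ ω) x ∂μ)
      = 1 / (C.card : ℝ) * ∑ i ∈ C, h (θ ω) (X i ω') - ∫ x, h (θ ω) x ∂μ := fun ω' => by
    rw [← Finset.mul_sum, Finset.sum_sub_distrib, Finset.sum_const, nsmul_eq_mul]
    field_simp
  rw [hw] at key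
  simp only [heq] at key
  simp only [hsum]
  exact key.trans (by gcongr; exact hV ω)

-- Estimators take whole sequences. Setting the coordinates outside `S` to zero produces a sequence
-- that depends on the block `S` alone, and so is independent of the block `T`.
omit [IsProbabilityMeasure P] in
lemma indepFun_mask {ι : Type*} [DecidableEq ι] [Zero α] {Z : ι → Ω → α} (hZ : ∀ i, Measurable (Z i))
    (hind : iIndepFun Z P) {S T : Finset ι} (hST : Disjoint S T) :
    IndepFun (fun ω i => if i ∈ S then Z i ω else 0) (fun ω (i : T) => Z i ω) P := by
  have h1 := hind.indepFun_finset S T hST hZ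
  have h2 : Measurable fun (z : S → α) (i : ι) => if h : i ∈ S then z ⟨i, h⟩ else 0 := by
    refine measurable_pi_lambda _ fun i => ?_
    by_cases h : i ∈ S
    · simp only [h, dite_true]; exact measurable_pi_apply _
    · simp only [h, dite_false]; exact measurable_const
  have h3 := h1.comp h2 measurable_id
  convert h3 using 1
  · ext ω i
    simp
  · rfl

/-- The part of the data used for the density estimates. -/
def maskedData [Zero α] (A A' : Finset ℕ) (X Y : ℕ → Ω → α) (ω : Ω) : (ℕ → α) × (ℕ → α) :=
  (fun i => if i ∈ A then X i ω else 0, fun j => if j ∈ A' then Y j ω else 0)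

lemma measurable_maskedData [Zero α] (A A' : Finset ℕ) {Y : ℕ → Ω → α} (hX : ∀ i, Measurable (X i))
    (hY : ∀ j, Measurable (Y j)) : Measurable (maskedData A A' X Y) := by
  refine Measurable.prodMk (measurable_pi_lambda _ fun i => ?_) (measurable_pi_lambda _ fun j => ?_)
  · split_ifs
    exacts [hX i, measurable_const]
  · split_ifs
    exacts [hY j, measurable_const]

omit [IsProbabilityMeasure P] in
lemma indepFun_maskedData [Zero α] {Y : ℕ → Ω → α} (hX : ∀ i, Measurable (X i))
    (hY : ∀ j, Measurable (Y j)) (hind : iIndepFun (Sum.elim X Y) P) {A C A' C' : Finset ℕ}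
    (hAC : Disjoint A C) (hAC' : Disjoint A' C') :
    IndepFun (maskedData A A' X Y) (fun ω (i : C) => X i ω) P ∧
      IndepFun (maskedData A A' X Y) (fun ω (j : C') => Y j ω) P := by
  classical
  have hZ : ∀ i, Measurable (Sum.elim X Y i) := by
    rintro (i | j)
    exacts [hX i, hY j]
  have hm : Measurable fun z : ℕ ⊕ ℕ → α =>
      ((fun i => z (Sum.inl i), fun j => z (Sum.inr j)) : (ℕ → α) × (ℕ → α)) := by fun_prop
  constructor
  · have hd : Disjoint (A.disjSum A') (C.map Function.Embedding.inl) := by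
      rw [Finset.disjoint_left]
      rintro (i | j) h1 h2
      · simp only [Finset.inl_mem_disjSum] at h1
        simp only [Finset.mem_map, Function.Embedding.inl_apply, Sum.inl.injEq, exists_eq_right] at h2
        exact Finset.disjoint_left.1 hAC h1 h2
      · simp at h2
    have h1 := indepFun_mask hZ hind hd
    have hm2 : Measurable fun (z : (C.map (Function.Embedding.inl : ℕ ↪ ℕ ⊕ ℕ)) → α) (i : C) =>
        z ⟨Sum.inl i, Finset.mem_map_of_mem _ i.2⟩ :=
      measurable_pi_lambda _ fun i => measurable_pi_apply _
    convert h1.comp hm hm2 using 1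
    · ext ω : 1
      simp [maskedData]
    · rfl
  · have hd : Disjoint (A.disjSum A') (C'.map Function.Embedding.inr) := by
      rw [Finset.disjoint_left]
      rintro (i | j) h1 h2
      · simp at h2
      · simp only [Finset.inr_mem_disjSum] at h1
        simp only [Finset.mem_map, Function.Embedding.inr_apply, Sum.inr.injEq, exists_eq_right] at h2
        exact Finset.disjoint_left.1 hAC' h1 h2
    have h1 := indepFun_mask hZ hind hd
    have hm2 : Measurable fun (z : (C'.map (Function.Embedding.inr : ℕ ↪ ℕ ⊕ ℕ)) → α) (j : C') =>
        z ⟨Sum.inr j, Finset.mem_map_of_mem _ j.2⟩ :=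
      measurable_pi_lambda _ fun i => measurable_pi_apply _
    convert h1.comp hm hm2 using 1
    · ext ω : 1
      simp [maskedData]
    · rfl

end Averages

/-! ### The data-split estimator -/

section Split

variable {d : ℕ}

/-- The estimate reads only the coordinates in `A`, so it can be computed from masked data. -/
lemma densEst_congr (trunc : Bool) (B' B : ℝ) (K : ℝ → E d → E d → ℝ) (b : ℕ → ℝ) (A : Finset ℕ)
    {x x' : ℕ → E d} (h : ∀ i ∈ A, x i = x' i) :
    densEst trunc B' B K b A x = densEst trunc B' B K b A x' := by
  have hk : kde K b A x = kde K b A x' := by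
    ext t
    simp only [kde]
    congr 1
    exact Finset.sum_congr rfl fun i hi => by rw [h i hi]
  ext t
  simp only [densEst, hk]

/-- A measurable family of density estimates, with the given rate for the squared `L²` error in mean
square. -/
structure IsEstimator {Ω : Type*} [MeasurableSpace Ω] (P : Measure Ω) (s : ℝ) (𝒳 : Set (E d))
    (J : Set ℝ) (f : E d → ℝ) (F : Finset ℕ → (ℕ → E d) → E d → ℝ) (X : ℕ → Ω → E d)
    (C : ℝ) (k₀ : ℕ) : Prop where
  measurable : ∀ A, Measurable fun z : (ℕ → E d) × E d => F A z.1 z.2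
  admissible : ∀ A x, F A x ∈ Admissible 𝒳 J
  congr : ∀ (A : Finset ℕ) (x x' : ℕ → E d), (∀ i ∈ A, x i = x' i) → F A x = F A x'
  nonneg : 0 ≤ C
  one_le : 1 ≤ k₀
  risk : ∀ A : Finset ℕ, k₀ ≤ A.card →
    ∫⁻ ω, ENNReal.ofReal (sqDist 𝒳 f (F A fun i => X i ω) ^ 2) ∂P
      ≤ ENNReal.ofReal (C * rate d s A.card ^ 2)

/-- Measurability of the functional in a parameter. -/
lemma FunctionalBounds.measurable_T {𝒳 : Set (E d)} {J : Set ℝ} {φ : ℝ → ℝ} {ν : ℝ × ℝ → ℝ}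
    {I : Set ℝ} {C : ℝ} (H : FunctionalBounds 𝒳 J φ ν I C) {Θ : Type*} [MeasurableSpace Θ]
    {p q : Θ → E d → ℝ} (hp : Measurable fun z : Θ × E d => p z.1 z.2)
    (hq : Measurable fun z : Θ × E d => q z.1 z.2) (hpa : ∀ θ, p θ ∈ Admissible 𝒳 J)
    (hqa : ∀ θ, q θ ∈ Admissible 𝒳 J) : Measurable fun θ => T 𝒳 φ ν (p θ) (q θ) := by
  have := H.finite
  obtain ⟨ν', hν', hνe⟩ := H.inner.exists_continuous_eqOn
  obtain ⟨φ', hφ', hφe⟩ := H.outer.exists_continuous_eqOn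
  have h1 : ∀ θ, T 𝒳 φ ν (p θ) (q θ) = φ' (∫ x in 𝒳, ν' (p θ x, q θ x)) := fun θ => by
    rw [T, hφe (H.integral_mem _ (hpa θ) _ (hqa θ))]
    congr 1
    exact setIntegral_congr_fun H.measurableSet fun x hx =>
      hνe ⟨(hpa θ).2.1 x hx, (hqa θ).2.1 x hx⟩
  simp only [h1]
  have h2 : Measurable fun z : Θ × E d => ν' (p z.1 z.2, q z.1 z.2) :=
    hν'.measurable.comp (hp.prodMk hq)
  exact hφ'.measurable.comp
    (h2.stronglyMeasurable.integral_prod_right' (ν := volume.restrict 𝒳)).measurable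

/-- The data of the two-sample problem, in the form in which they enter the analysis of the
data-split estimator. -/
structure SplitSetting {Ω : Type*} [MeasurableSpace Ω] (P : Measure Ω) (s B' B : ℝ) (𝒳 : Set (E d))
    (trunc : Bool) (φ : ℝ → ℝ) (ν : ℝ × ℝ → ℝ) (ψf ψg : (E d → ℝ) → (E d → ℝ) → E d → ℝ)
    (f g : E d → ℝ) (F G : Finset ℕ → (ℕ → E d) → E d → ℝ) (X Y : ℕ → Ω → E d)
    (I : Set ℝ) (C M : ℝ) (k₀ : ℕ) : Prop where
  f_density : IsBoundedDensity 𝒳 B' B f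
  g_density : IsBoundedDensity 𝒳 B' B g
  functional : FunctionalBounds 𝒳 (valueRange trunc B' B) φ ν I C
  influence_f : IsInfluenceFst 𝒳 (valueRange trunc B' B) φ ν ψf
  influence_g : IsInfluenceSnd 𝒳 (valueRange trunc B' B) φ ν ψg
  measurable_ψf : JointlyMeasurable 𝒳 (valueRange trunc B' B) ψf
  measurable_ψg : JointlyMeasurable 𝒳 (valueRange trunc B' B) ψg
  bounds_f : InfluenceBounds 𝒳 (valueRange trunc B' B) ψf f g f M
  bounds_g : InfluenceBounds 𝒳 (valueRange trunc B' B) ψg f g g M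
  estimator_f : IsEstimator P s 𝒳 (valueRange trunc B' B) f F X M k₀
  estimator_g : IsEstimator P s 𝒳 (valueRange trunc B' B) g G Y M k₀
  measurable_X : ∀ i, Measurable (X i)
  measurable_Y : ∀ j, Measurable (Y j)
  law_X : ∀ i, P.map (X i) = law 𝒳 f
  law_Y : ∀ j, P.map (Y j) = law 𝒳 g
  indep : iIndepFun (Sum.elim X Y) P

variable {Ω : Type*} [MeasurableSpace Ω] {P : Measure Ω} {s B' B : ℝ}
  {𝒳 : Set (E d)} {trunc : Bool} {φ : ℝ → ℝ} {ν : ℝ × ℝ → ℝ}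
  {ψf ψg : (E d → ℝ) → (E d → ℝ) → E d → ℝ} {f g : E d → ℝ}
  {F G : Finset ℕ → (ℕ → E d) → E d → ℝ} {X Y : ℕ → Ω → E d} {I : Set ℝ} {C M : ℝ} {k₀ : ℕ}

lemma lintegral_ofReal_add_sq_le {a b c : Ω → ℝ} (ha : Measurable a) (hb : Measurable b) :
    ∫⁻ ω, ENNReal.ofReal ((a ω + b ω + c ω) ^ 2) ∂P
      ≤ 3 * (∫⁻ ω, ENNReal.ofReal (a ω ^ 2) ∂P + ∫⁻ ω, ENNReal.ofReal (b ω ^ 2) ∂P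
        + ∫⁻ ω, ENNReal.ofReal (c ω ^ 2) ∂P) := by
  have hab : Measurable fun ω => ENNReal.ofReal (a ω ^ 2) + ENNReal.ofReal (b ω ^ 2) :=
    (ha.pow_const 2).ennreal_ofReal.add (hb.pow_const 2).ennreal_ofReal
  rw [← lintegral_add_left (ha.pow_const 2).ennreal_ofReal, ← lintegral_add_left hab,
    ← lintegral_const_mul' _ _ (by norm_num)]
  refine lintegral_mono fun ω => ?_
  have h3 : (3 : ℝ≥0∞) = ENNReal.ofReal 3 := by norm_num
  rw [h3, ← ENNReal.ofReal_add (sq_nonneg _) (sq_nonneg _),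
    ← ENNReal.ofReal_add (by positivity) (sq_nonneg _), ← ENNReal.ofReal_mul (by norm_num)]
  refine ENNReal.ofReal_le_ofReal ?_
  nlinarith [sq_nonneg (a ω - b ω), sq_nonneg (b ω - c ω), sq_nonneg (a ω - c ω)]

/-- The average of the influence functions at the true densities. -/
def influenceAverage (ψf ψg : (E d → ℝ) → (E d → ℝ) → E d → ℝ) (f g : E d → ℝ) (C C' : Finset ℕ)
    (X Y : ℕ → Ω → E d) (ω : Ω) : ℝ :=
  1 / (C.card : ℝ) * ∑ i ∈ C, ψf f g (X i ω) + 1 / (C'.card : ℝ) * ∑ j ∈ C', ψg f g (Y j ω)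

/-- The bound on the remainder of the preliminary estimator. -/
def remainderBound (d : ℕ) (s : ℝ) (a a' c c' : ℕ) : ℝ :=
  rate d s a ^ 2 + rate d s a' ^ 2 + ((c : ℝ)⁻¹ + (c' : ℝ)⁻¹) * (rate d s a + rate d s a')

lemma ofReal_remainder_le (κ : ℝ) {M x y i j : ℝ} (hM : 0 ≤ M) (hx : 0 ≤ x) (hy : 0 ≤ y)
    (hi : 0 ≤ i) (hj : 0 ≤ j) :
    3 * (ENNReal.ofReal (2 * κ ^ 2 * M * (x ^ 2 + y ^ 2))
        + ENNReal.ofReal (i * (M * (M + 1) * (x + y)))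
        + ENNReal.ofReal (j * (M * (M + 1) * (x + y))))
      ≤ ENNReal.ofReal (3 * (2 * κ ^ 2 * M + M * (M + 1))
          * (x ^ 2 + y ^ 2 + (i + j) * (x + y))) := by
  have h3 : (3 : ℝ≥0∞) = ENNReal.ofReal 3 := by norm_num
  rw [h3, ← ENNReal.ofReal_add (by positivity) (by positivity),
    ← ENNReal.ofReal_add (by positivity) (by positivity), ← ENNReal.ofReal_mul (by norm_num)]
  refine ENNReal.ofReal_le_ofReal ?_
  rw [mul_assoc 3]
  refine mul_le_mul_of_nonneg_left ?_ (by norm_num)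
  have e1 : 0 ≤ 2 * κ ^ 2 * M := by positivity
  have e2 : 0 ≤ M * (M + 1) := by positivity
  have e3 : 0 ≤ x ^ 2 + y ^ 2 := by positivity
  have e4 : 0 ≤ (i + j) * (x + y) := by positivity
  nlinarith [mul_nonneg e1 e4, mul_nonneg e2 e3]

/-! ### Linearization of the preliminary estimator -/

namespace SplitSetting

variable (S : SplitSetting P s B' B 𝒳 trunc φ ν ψf ψg f g F G X Y I C M k₀)
include S

lemma indep_X : iIndepFun X P := S.indep.precomp (g := Sum.inl) Sum.inl_injective

lemma indep_Y : iIndepFun Y P := S.indep.precomp (g := Sum.inr) Sum.inr_injective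

lemma mem_f : f ∈ Admissible 𝒳 (valueRange trunc B' B) := S.f_density.mem_admissible _

lemma mem_g : g ∈ Admissible 𝒳 (valueRange trunc B' B) := S.g_density.mem_admissible _

lemma measurable_influence_true : Measurable (ψf f g) ∧ Measurable (ψg f g) := by
  -- A one-point parameter space reduces joint measurability to measurability in the point.
  have hf : Measurable fun z : Unit × E d => f z.2 := S.f_density.measurable.comp measurable_snd
  have hg : Measurable fun z : Unit × E d => g z.2 := S.g_density.measurable.comp measurable_snd
  have hm : Measurable fun x : E d => ((), x) := by fun_prop
  exact ⟨(S.measurable_ψf Unit (fun _ => f) (fun _ => g) hf hg (fun _ => S.mem_f)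
      fun _ => S.mem_g).comp hm,
    (S.measurable_ψg Unit (fun _ => f) (fun _ => g) hf hg (fun _ => S.mem_f)
      fun _ => S.mem_g).comp hm⟩

lemma measurable_influence (A A' : Finset ℕ) :
    Measurable (fun z : ((ℕ → E d) × (ℕ → E d)) × E d => ψf (F A z.1.1) (G A' z.1.2) z.2) ∧
    Measurable (fun z : ((ℕ → E d) × (ℕ → E d)) × E d => ψg (F A z.1.1) (G A' z.1.2) z.2) := by
  have hF : Measurable fun z : ((ℕ → E d) × (ℕ → E d)) × E d => F A z.1.1 z.2 :=
    (S.estimator_f.measurable A).comp ((measurable_fst.comp measurable_fst).prodMk measurable_snd)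
  have hG : Measurable fun z : ((ℕ → E d) × (ℕ → E d)) × E d => G A' z.1.2 z.2 :=
    (S.estimator_g.measurable A').comp ((measurable_snd.comp measurable_fst).prodMk measurable_snd)
  exact ⟨S.measurable_ψf _ (fun z : (ℕ → E d) × (ℕ → E d) => F A z.1) (fun z => G A' z.2)
      hF hG (fun z => S.estimator_f.admissible A z.1) fun z => S.estimator_g.admissible A' z.2,
    S.measurable_ψg _ (fun z : (ℕ → E d) × (ℕ → E d) => F A z.1) (fun z => G A' z.2)
      hF hG (fun z => S.estimator_f.admissible A z.1) fun z => S.estimator_g.admissible A' z.2⟩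

lemma measurable_data : Measurable fun ω => ((fun i => X i ω, fun j => Y j ω) :
    (ℕ → E d) × (ℕ → E d)) :=
  (measurable_pi_lambda _ S.measurable_X).prodMk (measurable_pi_lambda _ S.measurable_Y)

lemma measurable_T_estimate (A A' : Finset ℕ) :
    Measurable fun ω => T 𝒳 φ ν (F A fun i => X i ω) (G A' fun j => Y j ω) := by
  have hF : Measurable fun z : ((ℕ → E d) × (ℕ → E d)) × E d => F A z.1.1 z.2 :=
    (S.estimator_f.measurable A).comp ((measurable_fst.comp measurable_fst).prodMk measurable_snd)
  have hG : Measurable fun z : ((ℕ → E d) × (ℕ → E d)) × E d => G A' z.1.2 z.2 :=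
    (S.estimator_g.measurable A').comp ((measurable_snd.comp measurable_fst).prodMk measurable_snd)
  exact (S.functional.measurable_T hF hG (fun z => S.estimator_f.admissible A z.1)
    fun z => S.estimator_g.admissible A' z.2).comp S.measurable_data

lemma measurable_dsPrelim (A D A' D' : Finset ℕ) :
    Measurable fun ω => dsPrelim 𝒳 φ ν ψf ψg F G A D A' D' (fun i => X i ω) (fun j => Y j ω) := by
  unfold dsPrelim
  have h1 := S.measurable_influence A A'
  refine ((S.measurable_T_estimate A A').add ?_).add ?_
  · exact (Finset.measurable_fun_sum _ fun i _ =>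
      h1.1.comp (S.measurable_data.prodMk (S.measurable_X i))).const_mul _
  · exact (Finset.measurable_fun_sum _ fun j _ =>
      h1.2.comp (S.measurable_data.prodMk (S.measurable_Y j))).const_mul _

lemma measurable_influenceAverage (D D' : Finset ℕ) :
    Measurable (influenceAverage ψf ψg f g D D' X Y) := by
  have h1 := S.measurable_influence_true
  exact ((Finset.measurable_fun_sum _ fun i _ => h1.1.comp (S.measurable_X i)).const_mul _).add
    ((Finset.measurable_fun_sum _ fun j _ => h1.2.comp (S.measurable_Y j)).const_mul _)

lemma memLp_influence_f {p q : E d → ℝ} (hp : p ∈ Admissible 𝒳 (valueRange trunc B' B))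
    (hq : q ∈ Admissible 𝒳 (valueRange trunc B' B)) : MemLp (ψf p q) 2 (law 𝒳 f) := by
  have := isProbabilityMeasure_law S.f_density
  obtain ⟨R, hR⟩ := S.bounds_f.ae_bounded p hp q hq
  have hp' : Measurable fun z : Unit × E d => p z.2 := hp.1.comp measurable_snd
  have hq' : Measurable fun z : Unit × E d => q z.2 := hq.1.comp measurable_snd
  have hm : Measurable (ψf p q) := (S.measurable_ψf Unit (fun _ => p) (fun _ => q) hp' hq'
    (fun _ => hp) fun _ => hq).comp (measurable_const.prodMk measurable_id : Measurable fun x => ((), x))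
  exact MemLp.of_bound hm.aestronglyMeasurable R hR

lemma memLp_influence_g {p q : E d → ℝ} (hp : p ∈ Admissible 𝒳 (valueRange trunc B' B))
    (hq : q ∈ Admissible 𝒳 (valueRange trunc B' B)) : MemLp (ψg p q) 2 (law 𝒳 g) := by
  have := isProbabilityMeasure_law S.g_density
  obtain ⟨R, hR⟩ := S.bounds_g.ae_bounded p hp q hq
  have hp' : Measurable fun z : Unit × E d => p z.2 := hp.1.comp measurable_snd
  have hq' : Measurable fun z : Unit × E d => q z.2 := hq.1.comp measurable_snd
  have hm : Measurable (ψg p q) := (S.measurable_ψg Unit (fun _ => p) (fun _ => q) hp' hq'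
    (fun _ => hp) fun _ => hq).comp (measurable_const.prodMk measurable_id : Measurable fun x => ((), x))
  exact MemLp.of_bound hm.aestronglyMeasurable R hR

lemma estimate_maskedData (A A' : Finset ℕ) (ω : Ω) :
    F A (maskedData A A' X Y ω).1 = F A (fun i => X i ω) ∧
    G A' (maskedData A A' X Y ω).2 = G A' (fun j => Y j ω) :=
  ⟨S.estimator_f.congr _ _ _ fun i hi => by simp [maskedData, hi],
    S.estimator_g.congr _ _ _ fun i hi => by simp [maskedData, hi]⟩

lemma measurable_sqDist_f (A : Finset ℕ) :
    Measurable fun ω => sqDist 𝒳 f (F A fun i => X i ω) := by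
  have := S.functional.finite
  have h1 : Measurable fun z : Ω × E d => (f z.2 - F A (fun i => X i z.1) z.2) ^ 2 := by
    refine ((S.f_density.measurable.comp measurable_snd).sub ?_).pow_const 2
    exact (S.estimator_f.measurable A).comp
      (((measurable_pi_lambda _ S.measurable_X).comp measurable_fst).prodMk measurable_snd)
  exact (h1.stronglyMeasurable.integral_prod_right' (ν := volume.restrict 𝒳)).measurable

/-- The conditional variances involve the squared error only to first order; its mean is obtained
from its second moment at the scale of the rate. -/
lemma lintegral_sqDist_add_le [IsProbabilityMeasure P] {A A' : Finset ℕ} (hA : k₀ ≤ A.card) (hA' : k₀ ≤ A'.card) :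
    ∫⁻ ω, ENNReal.ofReal (M * (sqDist 𝒳 f (F A fun i => X i ω) + sqDist 𝒳 g (G A' fun j => Y j ω))) ∂P
      ≤ ENNReal.ofReal (M * (M + 1) * (rate d s A.card + rate d s A'.card)) := by
  have hM := S.bounds_f.nonneg
  have hpos : ∀ {A : Finset ℕ}, k₀ ≤ A.card → 0 < rate d s A.card := fun {A} h => by
    have : 1 ≤ A.card := S.estimator_f.one_le.trans h
    exact Real.rpow_pos_of_pos (by exact_mod_cast this) _
  have h1 := lintegral_ofReal_le_of_sq hM (hpos hA) (S.estimator_f.risk A hA)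
  have h2 := lintegral_ofReal_le_of_sq hM (hpos hA') (S.estimator_g.risk A' hA')
  have h3 : ∀ ω, ENNReal.ofReal
      (M * (sqDist 𝒳 f (F A fun i => X i ω) + sqDist 𝒳 g (G A' fun j => Y j ω)))
      = ENNReal.ofReal M * (ENNReal.ofReal (sqDist 𝒳 f (F A fun i => X i ω))
        + ENNReal.ofReal (sqDist 𝒳 g (G A' fun j => Y j ω))) := fun ω => by
    rw [ENNReal.ofReal_mul hM, ENNReal.ofReal_add (sqDist_nonneg _ _) (sqDist_nonneg _ _)]
  simp only [h3]
  rw [lintegral_const_mul' _ _ ENNReal.ofReal_ne_top,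
    lintegral_add_left (S.measurable_sqDist_f A).ennreal_ofReal]
  calc _ ≤ ENNReal.ofReal M * (ENNReal.ofReal ((M + 1) * rate d s A.card)
        + ENNReal.ofReal ((M + 1) * rate d s A'.card)) := by gcongr
    _ = _ := by
        have := (hpos hA).le
        have := (hpos hA').le
        rw [← ENNReal.ofReal_add (by positivity) (by positivity), ← ENNReal.ofReal_mul hM]
        congr 1
        ring

/-- Asymptotic linearity of the preliminary estimator. -/
lemma lintegral_sq_dsPrelim_sub_le [IsProbabilityMeasure P] {A D A' D' : Finset ℕ} (hAD : Disjoint A D)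
    (hAD' : Disjoint A' D') (hA : k₀ ≤ A.card) (hA' : k₀ ≤ A'.card) (hD : D.Nonempty)
    (hD' : D'.Nonempty) :
    ∫⁻ ω, ENNReal.ofReal
        ((dsPrelim 𝒳 φ ν ψf ψg F G A D A' D' (fun i => X i ω) (fun j => Y j ω) - T 𝒳 φ ν f g
          - influenceAverage ψf ψg f g D D' X Y ω) ^ 2) ∂P
      ≤ ENNReal.ofReal (3 * (2 * (2 * C ^ 3 * volume.real 𝒳 + C ^ 2) ^ 2 * M + M * (M + 1))
          * remainderBound d s A.card A'.card D.card D'.card) := by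
  have hprobf := isProbabilityMeasure_law S.f_density
  have hprobg := isProbabilityMeasure_law S.g_density
  have hM := S.bounds_f.nonneg
  set κ := 2 * C ^ 3 * volume.real 𝒳 + C ^ 2 with hκ
  have hκ0 : 0 ≤ κ := by
    have := S.functional.inner.nonneg
    have : 0 ≤ volume.real 𝒳 := measureReal_nonneg
    positivity
  -- Both estimates are functions of `θ`, which is independent of the first sample over `D` and of
  -- the second over `D'`. The two independences are used separately, one for each average.
  set θ := maskedData A A' X Y with hθdef
  have hθ : Measurable θ := measurable_maskedData A A' S.measurable_X S.measurable_Y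
  obtain ⟨hindf, hindg⟩ := indepFun_maskedData (P := P) S.measurable_X S.measurable_Y S.indep hAD hAD'
  obtain ⟨hmψf, hmψg⟩ := S.measurable_influence A A'
  obtain ⟨hmf, hmg⟩ := S.measurable_influence_true
  -- the increments of the influence functions
  set hf : (ℕ → E d) × (ℕ → E d) → E d → ℝ :=
    fun z x => ψf (F A z.1) (G A' z.2) x - ψf f g x with hhf
  set hg : (ℕ → E d) × (ℕ → E d) → E d → ℝ :=
    fun z x => ψg (F A z.1) (G A' z.2) x - ψg f g x with hhg
  have hhfm : Measurable (Function.uncurry hf) := hmψf.sub (hmf.comp measurable_snd)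
  have hhgm : Measurable (Function.uncurry hg) := hmψg.sub (hmg.comp measurable_snd)
  have hadF : ∀ z : (ℕ → E d) × (ℕ → E d), F A z.1 ∈ Admissible 𝒳 (valueRange trunc B' B) :=
    fun z => S.estimator_f.admissible A _
  have hadG : ∀ z : (ℕ → E d) × (ℕ → E d), G A' z.2 ∈ Admissible 𝒳 (valueRange trunc B' B) :=
    fun z => S.estimator_g.admissible A' _
  have hLf : ∀ z, MemLp (hf z) 2 (law 𝒳 f) := fun z =>
    (S.memLp_influence_f (hadF z) (hadG z)).sub (S.memLp_influence_f S.mem_f S.mem_g)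
  have hLg : ∀ z, MemLp (hg z) 2 (law 𝒳 g) := fun z =>
    (S.memLp_influence_g (hadF z) (hadG z)).sub (S.memLp_influence_g S.mem_f S.mem_g)
  have hmask := S.estimate_maskedData A A'
  have hWf := lintegral_sq_average_sub_le (P := P) S.measurable_X S.law_X S.indep_X hD hθ hindf hhfm
    (fun ω => hLf (θ ω)) (V := fun ω => ENNReal.ofReal
      (M * (sqDist 𝒳 f (F A fun i => X i ω) + sqDist 𝒳 g (G A' fun j => Y j ω)))) fun ω => by
      rw [← (hmask ω).1, ← (hmask ω).2]
      exact S.bounds_f.lipschitz _ (hadF (θ ω)) _ (hadG (θ ω))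
  have hWg := lintegral_sq_average_sub_le (P := P) S.measurable_Y S.law_Y S.indep_Y hD' hθ hindg hhgm
    (fun ω => hLg (θ ω)) (V := fun ω => ENNReal.ofReal
      (M * (sqDist 𝒳 f (F A fun i => X i ω) + sqDist 𝒳 g (G A' fun j => Y j ω)))) fun ω => by
      rw [← (hmask ω).1, ← (hmask ω).2]
      exact S.bounds_g.lipschitz _ (hadF (θ ω)) _ (hadG (θ ω))
  -- The fluctuation of the averaged increments about their conditional mean; its conditional
  -- variance is a squared `L²` error divided by the number of points.
  set Wf : Ω → ℝ := fun ω => 1 / (D.card : ℝ) * ∑ i ∈ D, hf (θ ω) (X i ω)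
    - ∫ x, hf (θ ω) x ∂(law 𝒳 f) with hWfdef
  set Wg : Ω → ℝ := fun ω => 1 / (D'.card : ℝ) * ∑ j ∈ D', hg (θ ω) (Y j ω)
    - ∫ x, hg (θ ω) x ∂(law 𝒳 g) with hWgdef
  have hWfm : Measurable Wf := by
    refine ((Finset.measurable_fun_sum _ fun i _ =>
      hhfm.comp (hθ.prodMk (S.measurable_X i))).const_mul _).sub ?_
    exact (hhfm.stronglyMeasurable.integral_prod_right' (ν := law 𝒳 f)).measurable.comp hθ
  have hWgm : Measurable Wg := by
    refine ((Finset.measurable_fun_sum _ fun j _ =>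
      hhgm.comp (hθ.prodMk (S.measurable_Y j))).const_mul _).sub ?_
    exact (hhgm.stronglyMeasurable.integral_prod_right' (ν := law 𝒳 g)).measurable.comp hθ
  -- the deterministic remainder
  set Rm : Ω → ℝ := fun ω => dsPrelim 𝒳 φ ν ψf ψg F G A D A' D' (fun i => X i ω) (fun j => Y j ω)
    - T 𝒳 φ ν f g - influenceAverage ψf ψg f g D D' X Y ω - Wf ω - Wg ω with hRm
  have hRmm : Measurable Rm := ((((S.measurable_dsPrelim A D A' D').sub measurable_const).sub
    (S.measurable_influenceAverage D D')).sub hWfm).sub hWgm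
  have hRle : ∀ ω, |Rm ω|
      ≤ κ * (sqDist 𝒳 f (F A fun i => X i ω) + sqDist 𝒳 g (G A' fun j => Y j ω)) := by
    intro ω
    have h1 := S.functional.abs_vonMises_le S.influence_f S.influence_g S.mem_f S.mem_g
      S.f_density.isDensity S.g_density.isDensity (hadF (θ ω)) (hadG (θ ω))
    have h2 : ∫ x, hf (θ ω) x ∂(law 𝒳 f)
        = ∫ x in 𝒳, ψf (F A (θ ω).1) (G A' (θ ω).2) x * f x := by
      rw [← integral_law S.f_density]
      simp only [hhf]
      rw [integral_sub ((S.memLp_influence_f (hadF (θ ω)) (hadG (θ ω))).integrable (by norm_num))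
        ((S.memLp_influence_f S.mem_f S.mem_g).integrable (by norm_num)), S.bounds_f.centered,
        sub_zero]
    have h3 : ∫ x, hg (θ ω) x ∂(law 𝒳 g)
        = ∫ x in 𝒳, ψg (F A (θ ω).1) (G A' (θ ω).2) x * g x := by
      rw [← integral_law S.g_density]
      simp only [hhg]
      rw [integral_sub ((S.memLp_influence_g (hadF (θ ω)) (hadG (θ ω))).integrable (by norm_num))
        ((S.memLp_influence_g S.mem_f S.mem_g).integrable (by norm_num)), S.bounds_g.centered,
        sub_zero]
    rw [← h2, ← h3, (hmask ω).1, (hmask ω).2] at h1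
    -- The averages cancel. Since the influence functions at the truth are centered, the conditional
    -- means of the increments are the influence integrals, and the von Mises remainder is left.
    have h4 : Rm ω = T 𝒳 φ ν (F A fun i => X i ω) (G A' fun j => Y j ω)
        + (∫ x, hf (θ ω) x ∂(law 𝒳 f)) + (∫ x, hg (θ ω) x ∂(law 𝒳 g)) - T 𝒳 φ ν f g := by
      simp only [hRm, dsPrelim, influenceAverage, hWfdef, hWgdef]
      have h5 : ∑ i ∈ D, hf (θ ω) (X i ω)
          = ∑ i ∈ D, ψf (F A fun i => X i ω) (G A' fun j => Y j ω) (X i ω)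
            - ∑ i ∈ D, ψf f g (X i ω) := by
        simp only [hhf]
        rw [(hmask ω).1, (hmask ω).2, Finset.sum_sub_distrib]
      have h6 : ∑ j ∈ D', hg (θ ω) (Y j ω)
          = ∑ j ∈ D', ψg (F A fun i => X i ω) (G A' fun j => Y j ω) (Y j ω)
            - ∑ j ∈ D', ψg f g (Y j ω) := by
        simp only [hhg]
        rw [(hmask ω).1, (hmask ω).2, Finset.sum_sub_distrib]
      rw [h5, h6]
      ring
    rw [h4]
    exact h1
  have hRsq : ∫⁻ ω, ENNReal.ofReal (Rm ω ^ 2) ∂P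
      ≤ ENNReal.ofReal (2 * κ ^ 2 * M * (rate d s A.card ^ 2 + rate d s A'.card ^ 2)) := by
    have hpt : ∀ ω, ENNReal.ofReal (Rm ω ^ 2) ≤ ENNReal.ofReal (2 * κ ^ 2)
        * (ENNReal.ofReal (sqDist 𝒳 f (F A fun i => X i ω) ^ 2)
          + ENNReal.ofReal (sqDist 𝒳 g (G A' fun j => Y j ω) ^ 2)) := fun ω => by
      rw [← ENNReal.ofReal_add (sq_nonneg _) (sq_nonneg _), ← ENNReal.ofReal_mul (by positivity)]
      refine ENNReal.ofReal_le_ofReal ?_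
      have h1 := sq_le_sq' (abs_le.1 (hRle ω)).1 (abs_le.1 (hRle ω)).2
      rw [mul_pow] at h1
      refine h1.trans ?_
      rw [mul_comm (2 : ℝ), mul_assoc]
      refine mul_le_mul_of_nonneg_left ?_ (sq_nonneg _)
      nlinarith [sq_nonneg (sqDist 𝒳 f (F A fun i => X i ω) - sqDist 𝒳 g (G A' fun j => Y j ω))]
    calc _ ≤ _ := lintegral_mono hpt
      _ = ENNReal.ofReal (2 * κ ^ 2)
          * (∫⁻ ω, ENNReal.ofReal (sqDist 𝒳 f (F A fun i => X i ω) ^ 2) ∂P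
            + ∫⁻ ω, ENNReal.ofReal (sqDist 𝒳 g (G A' fun j => Y j ω) ^ 2) ∂P) := by
          rw [lintegral_const_mul' _ _ ENNReal.ofReal_ne_top,
            lintegral_add_left ((S.measurable_sqDist_f A).pow_const 2).ennreal_ofReal]
      _ ≤ ENNReal.ofReal (2 * κ ^ 2) * (ENNReal.ofReal (M * rate d s A.card ^ 2)
            + ENNReal.ofReal (M * rate d s A'.card ^ 2)) := by
          gcongr
          exacts [S.estimator_f.risk A hA, S.estimator_g.risk A' hA']
      _ = _ := by
          rw [← ENNReal.ofReal_add (by positivity) (by positivity),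
            ← ENNReal.ofReal_mul (by positivity)]
          congr 1
          ring
  have hE := S.lintegral_sqDist_add_le hA hA'
  have hr1 := rate_nonneg (d := d) (s := s) A.card
  have hr2 := rate_nonneg (d := d) (s := s) A'.card
  have hWf' := hWf.trans (mul_le_mul_right hE _)
  have hWg' := hWg.trans (mul_le_mul_right hE _)
  rw [← ENNReal.ofReal_mul (inv_nonneg.2 (Nat.cast_nonneg _))] at hWf' hWg'
  have hsplit : ∀ ω, dsPrelim 𝒳 φ ν ψf ψg F G A D A' D' (fun i => X i ω) (fun j => Y j ω)
      - T 𝒳 φ ν f g - influenceAverage ψf ψg f g D D' X Y ω = Rm ω + Wf ω + Wg ω := fun ω => by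
    simp only [hRm]; ring
  simp only [hsplit]
  refine (lintegral_ofReal_add_sq_le hRmm hWfm).trans ?_
  calc _ ≤ 3 * (ENNReal.ofReal (2 * κ ^ 2 * M * (rate d s A.card ^ 2 + rate d s A'.card ^ 2))
        + ENNReal.ofReal ((D.card : ℝ)⁻¹ * (M * (M + 1) * (rate d s A.card + rate d s A'.card)))
        + ENNReal.ofReal ((D'.card : ℝ)⁻¹ * (M * (M + 1) * (rate d s A.card + rate d s A'.card)))) := by
        gcongr
    _ ≤ _ := ofReal_remainder_le κ hM hr1 hr2 (inv_nonneg.2 (Nat.cast_nonneg _))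
        (inv_nonneg.2 (Nat.cast_nonneg _))

end SplitSetting

end Split

/-! ### Two-sample central limit theorem -/

section CLT

variable {Ω : Type*} [MeasurableSpace Ω] {P : Measure Ω} [IsProbabilityMeasure P]

-- Chebyshev's inequality.
omit [IsProbabilityMeasure P] in
lemma tendstoInMeasure_zero_of_lintegral_sq {Z : ℕ → Ω → ℝ} (hZ : ∀ k, Measurable (Z k))
    (h : Tendsto (fun k => ∫⁻ ω, ENNReal.ofReal (Z k ω ^ 2) ∂P) atTop (𝓝 0)) :
    TendstoInMeasure P Z atTop 0 := by
  rw [tendstoInMeasure_iff_norm]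
  intro ε hε
  have hε2 : ENNReal.ofReal (ε ^ 2) ≠ 0 := by
    rw [Ne, ENNReal.ofReal_eq_zero, not_le]; positivity
  have hdiv : Tendsto (fun k => (∫⁻ ω, ENNReal.ofReal (Z k ω ^ 2) ∂P) / ENNReal.ofReal (ε ^ 2))
      atTop (𝓝 0) := by
    have := ENNReal.Tendsto.div_const h (b := ENNReal.ofReal (ε ^ 2)) (Or.inr hε2)
    rwa [ENNReal.zero_div] at this
  refine tendsto_of_tendsto_of_tendsto_of_le_of_le tendsto_const_nhds hdiv (fun _ => zero_le)
    fun k => ?_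
  refine le_trans (measure_mono fun ω hω => ?_)
    (meas_ge_le_lintegral_div ((hZ k).pow_const 2).ennreal_ofReal.aemeasurable hε2
      ENNReal.ofReal_ne_top)
  simp only [Pi.zero_apply, sub_zero, Set.mem_ofPred_eq, Real.norm_eq_abs] at hω ⊢
  refine ENNReal.ofReal_le_ofReal ?_
  rw [← sq_abs (Z k ω)]
  exact pow_le_pow_left₀ hε.le hω 2

/-- Rescaled normalized sums along a sequence of sample sizes. -/
lemma tendstoInDistribution_scaled_sum {U : ℕ → Ω → ℝ} (hind : iIndepFun U P)
    (hident : ∀ i, IdentDistrib (U i) (U 0) P P) (hL : MemLp (U 0) 2 P) (h0 : ∫ ω, U 0 ω ∂P = 0)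
    {n : ℕ → ℕ} (hn : Tendsto n atTop atTop) {a : ℕ → ℝ} {α : ℝ} (ha : Tendsto a atTop (𝓝 α)) :
    TendstoInDistribution (fun k ω => a k * ((√(n k : ℝ))⁻¹ * ∑ i ∈ Finset.range (n k), U i ω))
      atTop (id : ℝ → ℝ) (fun _ => P)
      (gaussianReal 0 (Real.toNNReal (α ^ 2 * variance (U 0) P))) := by
  have h1 := tendstoInDistribution_inv_sqrt_mul_sum_sub (Y := (id : ℝ → ℝ))
    (P' := gaussianReal 0 (variance (U 0) P).toNNReal) HasLaw.id hL hind hident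
  simp only [h0, mul_zero, sub_zero] at h1
  have h2 : TendstoInDistribution
      (fun k ω => (√(n k : ℝ))⁻¹ * ∑ i ∈ Finset.range (n k), U i ω) atTop (id : ℝ → ℝ)
      (fun _ => P) (gaussianReal 0 (variance (U 0) P).toNNReal) :=
    ⟨fun k => h1.forall_aemeasurable (n k), h1.aemeasurable_limit, h1.tendsto.comp hn⟩
  -- Slutsky's lemma, with the deterministic factors regarded as converging in measure to a
  -- constant.
  have h3 : TendstoInMeasure P (fun k (_ : Ω) => a k) atTop (fun _ => α) :=
    tendstoInMeasure_of_tendsto_ae (fun _ => aestronglyMeasurable_const)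
      (Eventually.of_forall fun _ => ha)
  have h4 := h2.continuous_comp_prodMk_of_tendstoInMeasure_const
    (g := fun z : ℝ × ℝ => z.2 * z.1) (by fun_prop) h3 fun _ => aemeasurable_const
  refine ⟨h4.forall_aemeasurable, aemeasurable_id, ?_⟩
  have h5 := h4.tendsto
  have h6 : (gaussianReal 0 (variance (U 0) P).toNNReal).map (fun ω => α * id ω)
      = (gaussianReal 0 (Real.toNNReal (α ^ 2 * variance (U 0) P))).map id := by
    have h7 := gaussianReal_map_const_mul (μ := 0) (v := (variance (U 0) P).toNNReal) α
    rw [Measure.map_id]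
    simp only [id]
    rw [h7, mul_zero]
    congr 1
    ext
    simp [Real.coe_toNNReal _ (variance_nonneg _ _),
      Real.coe_toNNReal _ (mul_nonneg (sq_nonneg α) (variance_nonneg (U 0) P))]
  have h8 := h5
  simp only [h6] at h8
  exact h8

/-- Sums of independent sequences which are asymptotically normal. -/
lemma tendstoInDistribution_add_gaussian {A D : ℕ → Ω → ℝ} {v w : ℝ} (hv : 0 ≤ v) (hw : 0 ≤ w)
    (hA : TendstoInDistribution A atTop (id : ℝ → ℝ) (fun _ => P) (gaussianReal 0 v.toNNReal))
    (hD : TendstoInDistribution D atTop (id : ℝ → ℝ) (fun _ => P) (gaussianReal 0 w.toNNReal))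
    (hAD : ∀ k, IndepFun (A k) (D k) P) :
    TendstoInDistribution (fun k ω => A k ω + D k ω) atTop (id : ℝ → ℝ) (fun _ => P)
      (gaussianReal 0 (v + w).toNNReal) := by
  have hmA := hA.forall_aemeasurable
  have hmD := hD.forall_aemeasurable
  refine ⟨fun k => (hmA k).add (hmD k), aemeasurable_id, ?_⟩
  -- By Lévy's continuity theorem it suffices to multiply characteristic functions: independence
  -- factors them for each `k`, and the Gaussian limits multiply to variance `v + w`.
  have h1 := ProbabilityMeasure.tendsto_iff_tendsto_charFun.1 hA.tendsto
  have h2 := ProbabilityMeasure.tendsto_iff_tendsto_charFun.1 hD.tendsto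
  refine ProbabilityMeasure.tendsto_iff_tendsto_charFun.2 fun t => ?_
  have h3 := (h1 t).mul (h2 t)
  simp only [ProbabilityMeasure.coe_mk, Measure.map_id, charFun_gaussianReal] at h3 ⊢
  have h4 : ∀ k, charFun (P.map fun ω => A k ω + D k ω) t
      = charFun (P.map (A k)) t * charFun (P.map (D k)) t := fun k => by
    rw [(hAD k).charFun_map_fun_add_eq_mul (hmA k) (hmD k)]
    rfl
  simp only [h4]
  convert h3 using 2
  rw [← Complex.exp_add]
  congr 1
  rw [Real.coe_toNNReal _ hv, Real.coe_toNNReal _ hw, Real.coe_toNNReal _ (add_nonneg hv hw)]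
  push_cast
  ring

end CLT

/-! ### Averaging over the two halves of a sample -/

section Halves

/-- The difference is `(y - x) / (2 x (x + y))`. With `|y - x| ≤ 1` it is of second order in the
inverse sample size, as `x + y ≤ 4 x`. -/
lemma abs_half_inv_sub_le {x y : ℝ} (hx : 1 ≤ x) (hy : 1 ≤ y) (hxy : |y - x| ≤ 1) :
    |1 / (2 * x) - 1 / (x + y)| ≤ 2 * ((x + y)⁻¹) ^ 2 := by
  have hx0 : 0 < x := by linarith
  have hs : 0 < x + y := by linarith
  have h1 : 1 / (2 * x) - 1 / (x + y) = (y - x) / (2 * x * (x + y)) := by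
    field_simp
    ring
  rw [h1, abs_div, abs_of_pos (show 0 < 2 * x * (x + y) by positivity),
    div_le_iff₀ (by positivity)]
  refine hxy.trans ?_
  have h2 := (abs_le.1 hxy).2
  have h3 : 2 * (x + y)⁻¹ ^ 2 * (2 * x * (x + y)) = 4 * x / (x + y) := by
    field_simp
    ring
  rw [h3, le_div_iff₀ hs]
  linarith

/-- The mean of the averages over the two halves of a sample differs from the average over the
sample by a linear combination with small weights. -/
lemma exists_half_weights {n : ℕ} (hn : 2 ≤ n) :
    ∃ w : ℕ → ℝ, ∑ i ∈ Finset.range n, w i ^ 2 ≤ 4 * (n : ℝ)⁻¹ ^ 2 ∧ ∀ v : ℕ → ℝ,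
      (1 / ((Finset.range (n / 2)).card : ℝ) * ∑ i ∈ Finset.range (n / 2), v i
        + 1 / ((Finset.Ico (n / 2) n).card : ℝ) * ∑ i ∈ Finset.Ico (n / 2) n, v i) / 2
      = 1 / ((Finset.range n).card : ℝ) * ∑ i ∈ Finset.range n, v i
        + ∑ i ∈ Finset.range n, w i * v i := by
  set x : ℝ := ((Finset.range (n / 2)).card : ℝ) with hx
  set y : ℝ := ((Finset.Ico (n / 2) n).card : ℝ) with hy
  have hxy : x + y = n := by
    rw [hx, hy, Finset.card_range, Nat.card_Ico, ← Nat.cast_add]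
    congr 1
    omega
  have hx1 : 1 ≤ x := by
    rw [hx, Finset.card_range]
    exact_mod_cast (show 1 ≤ n / 2 by omega)
  have hyx : x ≤ y ∧ y ≤ x + 1 := by
    rw [hx, hy, Finset.card_range, Nat.card_Ico]
    constructor
    · exact_mod_cast (show n / 2 ≤ n - n / 2 by omega)
    · exact_mod_cast (show n - n / 2 ≤ n / 2 + 1 by omega)
  have hd : |y - x| ≤ 1 := abs_le.2 ⟨by linarith, by linarith⟩
  have hn0 : (2 : ℝ) ≤ n := by exact_mod_cast hn
  -- Weight of a point in the mean of the two half-averages minus its weight in the full average; it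
  -- vanishes for even `n`.
  refine ⟨fun i => if i < n / 2 then 1 / (2 * x) - 1 / (x + y) else 1 / (2 * y) - 1 / (x + y),
    ?_, fun v => ?_⟩
  · have h1 : ∀ i, |(if i < n / 2 then 1 / (2 * x) - 1 / (x + y)
        else 1 / (2 * y) - 1 / (x + y))| ≤ 2 * (n : ℝ)⁻¹ ^ 2 := fun i => by
      rw [← hxy]
      split_ifs
      · exact abs_half_inv_sub_le hx1 (hx1.trans hyx.1) hd
      · rw [add_comm x y]
        exact abs_half_inv_sub_le (hx1.trans hyx.1) hx1 (by rwa [abs_sub_comm])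
    calc _ ≤ ∑ _i ∈ Finset.range n, (2 * (n : ℝ)⁻¹ ^ 2) ^ 2 := by
          refine Finset.sum_le_sum fun i _ => ?_
          exact sq_le_sq' (abs_le.1 (h1 i)).1 (abs_le.1 (h1 i)).2
      _ = 4 * (n : ℝ)⁻¹ ^ 2 * (n : ℝ)⁻¹ := by
          rw [Finset.sum_const, Finset.card_range, nsmul_eq_mul]
          have : (n : ℝ) ≠ 0 := by linarith
          field_simp
          norm_num
      _ ≤ _ := mul_le_of_le_one_right (by positivity) (inv_le_one_of_one_le₀ (by linarith))
  · have hsplit : ∀ F : ℕ → ℝ, ∑ i ∈ Finset.range n, F i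
        = ∑ i ∈ Finset.range (n / 2), F i + ∑ i ∈ Finset.Ico (n / 2) n, F i := fun F =>
      (Finset.sum_range_add_sum_Ico F (Nat.div_le_self n 2)).symm
    rw [hsplit v, hsplit fun i => (if i < n / 2 then _ else _) * v i, Finset.card_range n, ← hxy]
    have e1 : ∑ i ∈ Finset.range (n / 2), (if i < n / 2 then 1 / (2 * x) - 1 / (x + y)
        else 1 / (2 * y) - 1 / (x + y)) * v i
        = (1 / (2 * x) - 1 / (x + y)) * ∑ i ∈ Finset.range (n / 2), v i := by
      rw [Finset.mul_sum]
      exact Finset.sum_congr rfl fun i hi => by rw [if_pos (Finset.mem_range.1 hi)]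
    have e2 : ∑ i ∈ Finset.Ico (n / 2) n, (if i < n / 2 then 1 / (2 * x) - 1 / (x + y)
        else 1 / (2 * y) - 1 / (x + y)) * v i
        = (1 / (2 * y) - 1 / (x + y)) * ∑ i ∈ Finset.Ico (n / 2) n, v i := by
      rw [Finset.mul_sum]
      exact Finset.sum_congr rfl fun i hi => by
        rw [if_neg (not_lt.2 (Finset.mem_Ico.1 hi).1)]
    rw [e1, e2]
    have : x ≠ 0 := by linarith
    have : y ≠ 0 := by linarith
    have : x + y ≠ 0 := by linarith
    field_simp
    ring

/-- The rate is a power with exponent between `-1` and `0`, so quartering the sample size costs at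
most a factor of four. -/
lemma rate_le_of_le {d : ℕ} {s : ℝ} (hs : 0 < s) {a n : ℕ} (ha : 1 ≤ a) (hn : 1 ≤ n) (h : n ≤ 4 * a) :
    rate d s a ≤ 4 * rate d s n := by
  have ha' : (1 : ℝ) ≤ a := by exact_mod_cast ha
  have hn' : (1 : ℝ) ≤ n := by exact_mod_cast hn
  have h' : (n : ℝ) ≤ 4 * a := by exact_mod_cast h
  have hd : (0 : ℝ) ≤ d := Nat.cast_nonneg d
  set e := 2 * s / (2 * s + d) with he
  have he0 : 0 ≤ e := by positivity
  have he1 : e ≤ 1 := div_le_one_of_le₀ (by linarith) (by linarith)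
  rw [rate, rate, neg_div, ← he]
  calc (a : ℝ) ^ (-e) ≤ ((1 / 4 : ℝ) * n) ^ (-e) :=
        Real.rpow_le_rpow_of_nonpos (by linarith) (by linarith) (by linarith)
    _ = (1 / 4 : ℝ) ^ (-e) * (n : ℝ) ^ (-e) := Real.mul_rpow (by norm_num) (by linarith)
    _ ≤ 4 * (n : ℝ) ^ (-e) := by
        refine mul_le_mul_of_nonneg_right ?_ (Real.rpow_nonneg (by linarith) _)
        rw [Real.rpow_neg (by norm_num), ← Real.inv_rpow (by norm_num)]
        norm_num
        calc (4 : ℝ) ^ e ≤ 4 ^ (1 : ℝ) := Real.rpow_le_rpow_of_exponent_le (by norm_num) he1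
          _ = 4 := Real.rpow_one 4

/-- Each term is a product of two factors that grow by at most four. Both halves of a sample of size
`n ≥ 2` satisfy the condition `n ≤ 4 * a`. -/
lemma remainderBound_half_le {d : ℕ} {s : ℝ} (hs : 0 < s) {n m a a' c c' : ℕ} (hn : 1 ≤ n)
    (hm : 1 ≤ m) (ha : 1 ≤ a) (ha' : 1 ≤ a') (hc : 1 ≤ c) (hc' : 1 ≤ c') (hna : n ≤ 4 * a)
    (hma : m ≤ 4 * a') (hnc : n ≤ 4 * c) (hmc : m ≤ 4 * c') :
    remainderBound d s a a' c c' ≤ 16 * remainderBound d s n m n m := by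
  have hinv : ∀ {c n : ℕ}, 1 ≤ c → 1 ≤ n → n ≤ 4 * c → (c : ℝ)⁻¹ ≤ 4 * (n : ℝ)⁻¹ :=
    fun {c n} hc hn h => by
      have hc' : (1 : ℝ) ≤ c := by exact_mod_cast hc
      have hn' : (1 : ℝ) ≤ n := by exact_mod_cast hn
      have h' : (n : ℝ) ≤ 4 * c := by exact_mod_cast h
      rw [← div_eq_mul_inv, le_div_iff₀ (by linarith), inv_mul_le_iff₀ (by linarith)]
      linarith
  have h1 := rate_le_of_le (d := d) hs ha hn hna
  have h2 := rate_le_of_le (d := d) hs ha' hm hma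
  have h3 := hinv hc hn hnc
  have h4 := hinv hc' hm hmc
  have p1 := rate_nonneg (d := d) (s := s) a
  have p2 := rate_nonneg (d := d) (s := s) a'
  have q1 : (0 : ℝ) ≤ (c : ℝ)⁻¹ := by positivity
  have q2 : (0 : ℝ) ≤ (c' : ℝ)⁻¹ := by positivity
  calc remainderBound d s a a' c c'
      ≤ (4 * rate d s n) ^ 2 + (4 * rate d s m) ^ 2
        + (4 * (n : ℝ)⁻¹ + 4 * (m : ℝ)⁻¹) * (4 * rate d s n + 4 * rate d s m) := by
        unfold remainderBound
        gcongr
    _ = _ := by unfold remainderBound; ring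

end Halves

/-! ### Linearization of the data-split estimator -/

section Linearization

variable {d : ℕ} {Ω : Type*} [MeasurableSpace Ω] {P : Measure Ω} {s B' B : ℝ}
  {𝒳 : Set (E d)} {trunc : Bool} {φ : ℝ → ℝ} {ν : ℝ × ℝ → ℝ}
  {ψf ψg : (E d → ℝ) → (E d → ℝ) → E d → ℝ} {f g : E d → ℝ}
  {F G : Finset ℕ → (ℕ → E d) → E d → ℝ} {X Y : ℕ → Ω → E d} {I : Set ℝ} {C M : ℝ} {k₀ : ℕ}

lemma InfluenceBounds.mono {J : Set ℝ} {ψ : (E d → ℝ) → (E d → ℝ) → E d → ℝ} {e : E d → ℝ}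
    {M' : ℝ} (h : InfluenceBounds 𝒳 J ψ f g e M) (hM : M ≤ M') :
    InfluenceBounds 𝒳 J ψ f g e M' :=
  ⟨h.nonneg.trans hM, h.ae_bounded, fun p₁ hp₁ p₂ hp₂ => (h.lipschitz p₁ hp₁ p₂ hp₂).trans
    (ENNReal.ofReal_le_ofReal (mul_le_mul_of_nonneg_right hM
      (add_nonneg (sqDist_nonneg _ _) (sqDist_nonneg _ _)))), h.centered⟩

lemma IsEstimator.mono {J : Set ℝ} {M' : ℝ} {k₁ : ℕ} (h : IsEstimator P s 𝒳 J f F X M k₀)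
    (hM : M ≤ M') (hk : k₀ ≤ k₁) : IsEstimator P s 𝒳 J f F X M' k₁ :=
  ⟨h.measurable, h.admissible, h.congr, h.nonneg.trans hM, h.one_le.trans hk, fun A hA =>
    (h.risk A (hk.trans hA)).trans
      (ENNReal.ofReal_le_ofReal (mul_le_mul_of_nonneg_right hM (sq_nonneg _)))⟩

/-- Kernel density estimates of a bounded Hölder density. -/
lemma exists_isEstimator_densEst [IsProbabilityMeasure P] {L : ℝ} {𝒮 : Set (E d)} (hs : 0 < s)
    (h𝒮 : IsClosed 𝒮) (h𝒮' : UniqueDiffOn ℝ 𝒮) (h𝒳𝒮 : 𝒳 ⊆ 𝒮) (hf : IsBoundedDensity 𝒳 B' B f)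
    (hfH : f ∈ HolderClass s L 𝒮) {K : ℝ → E d → E d → ℝ} (hK : IsSmoothingKernel s 𝒳 𝒮 K)
    (trunc : Bool) {b : ℕ → ℝ} (hb : IsOptimalBandwidth d s b) (hX : ∀ i, Measurable (X i))
    (hlaw : ∀ i, P.map (X i) = law 𝒳 f) (hind : iIndepFun X P) :
    ∃ C k₀, IsEstimator P s 𝒳 (valueRange trunc B' B) f (densEst trunc B' B K b) X C k₀ := by
  obtain ⟨C, k₀, hC, hk₀, h⟩ :=
    exists_lintegral_sq_sqDist_le hs h𝒮 h𝒮' h𝒳𝒮 hf hfH hK trunc hb hX hlaw hind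
  exact ⟨C, k₀, measurable_densEst hK trunc B' B b, densEst_mem_admissible hf hK trunc hb,
    fun A x x' hx => densEst_congr trunc B' B K b A hx, hC, hk₀, h⟩

/-- A weighted sum of centered independent variables. -/
lemma lintegral_sq_weighted_sum_le_of_centered [IsProbabilityMeasure P] {α : Type*}
    [MeasurableSpace α] {μ : Measure α} {X : ℕ → Ω → α} (hX : ∀ i, Measurable (X i))
    (hlaw : ∀ i, P.map (X i) = μ) (hind : iIndepFun X P) {u : α → ℝ} (hu : Measurable u)
    (hL : MemLp u 2 μ) (h0 : ∫ x, u x ∂μ = 0) (D : Finset ℕ) (w : ℕ → ℝ) {W : ℝ}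
    (hW : ∑ i ∈ D, w i ^ 2 ≤ W) :
    ∫⁻ ω, ENNReal.ofReal ((∑ i ∈ D, w i * u (X i ω)) ^ 2) ∂P
      ≤ ENNReal.ofReal (W * ∫ x, u x ^ 2 ∂μ) := by
  have h1 := lintegral_sq_weighted_sum_le hX hlaw hind hu hL D w
  simp only [h0, sub_zero] at h1
  have h2 : 0 ≤ W := (Finset.sum_nonneg fun i _ => sq_nonneg (w i)).trans hW
  rw [ENNReal.ofReal_mul h2,
    ofReal_integral_eq_lintegral_ofReal hL.integrable_sq (Eventually.of_forall fun x => sq_nonneg _)]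
  exact h1.trans (mul_le_mul_left (ENNReal.ofReal_le_ofReal hW) _)

namespace SplitSetting

variable (S : SplitSetting P s B' B 𝒳 trunc φ ν ψf ψg f g F G X Y I C M k₀)
include S

lemma measurable_dsEstimator (n m : ℕ) :
    Measurable fun ω => dsEstimator 𝒳 φ ν ψf ψg F G n m (fun i => X i ω) (fun j => Y j ω) := by
  unfold dsEstimator
  exact ((S.measurable_dsPrelim _ _ _ _).add (S.measurable_dsPrelim _ _ _ _)).div_const 2

/-- The mean square of a linear combination of the influence functions. -/
lemma lintegral_sq_weighted_influence_le [IsProbabilityMeasure P] (D D' : Finset ℕ)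
    (w w' : ℕ → ℝ) {W W' : ℝ}
    (hW : ∑ i ∈ D, w i ^ 2 ≤ W) (hW' : ∑ j ∈ D', w' j ^ 2 ≤ W') :
    ∫⁻ ω, ENNReal.ofReal
        ((∑ i ∈ D, w i * ψf f g (X i ω) + ∑ j ∈ D', w' j * ψg f g (Y j ω)) ^ 2) ∂P
      ≤ ENNReal.ofReal (3 * (∫ x, ψf f g x ^ 2 ∂(law 𝒳 f) + ∫ x, ψg f g x ^ 2 ∂(law 𝒳 g))
          * (W + W')) := by
  obtain ⟨hmf, hmg⟩ := S.measurable_influence_true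
  have hf := lintegral_sq_weighted_sum_le_of_centered S.measurable_X S.law_X S.indep_X hmf
    (S.memLp_influence_f S.mem_f S.mem_g) S.bounds_f.centered D w hW
  have hg := lintegral_sq_weighted_sum_le_of_centered S.measurable_Y S.law_Y S.indep_Y hmg
    (S.memLp_influence_g S.mem_f S.mem_g) S.bounds_g.centered D' w' hW'
  have h3 := lintegral_ofReal_add_sq_le (P := P) (c := fun _ => 0)
    (Finset.measurable_fun_sum D fun i _ => (hmf.comp (S.measurable_X i)).const_mul (w i))
    (Finset.measurable_fun_sum D' fun j _ => (hmg.comp (S.measurable_Y j)).const_mul (w' j))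
  simp only [Function.comp_apply, add_zero, ne_eq, OfNat.ofNat_ne_zero, not_false_eq_true,
    zero_pow, ENNReal.ofReal_zero, lintegral_zero] at h3
  set Vf := ∫ x, ψf f g x ^ 2 ∂(law 𝒳 f)
  set Vg := ∫ x, ψg f g x ^ 2 ∂(law 𝒳 g)
  have hVf : 0 ≤ Vf := integral_nonneg fun x => sq_nonneg _
  have hVg : 0 ≤ Vg := integral_nonneg fun x => sq_nonneg _
  have hW0 : 0 ≤ W := (Finset.sum_nonneg fun i _ => sq_nonneg (w i)).trans hW
  have hW0' : 0 ≤ W' := (Finset.sum_nonneg fun i _ => sq_nonneg (w' i)).trans hW'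
  calc _ ≤ 3 * (ENNReal.ofReal (W * Vf) + ENNReal.ofReal (W' * Vg)) := h3.trans (by gcongr)
    _ = ENNReal.ofReal (3 * (W * Vf + W' * Vg)) := by
        rw [ENNReal.ofReal_mul (p := 3) (by norm_num), ENNReal.ofReal_add (by positivity) (by positivity)]
        norm_num
    _ ≤ _ := by
        refine ENNReal.ofReal_le_ofReal ?_
        nlinarith [mul_nonneg hW0 hVg, mul_nonneg hW0' hVf]

/-- The average of the influence functions over the whole samples has the parametric rate. -/
lemma lintegral_sq_influenceAverage_le [IsProbabilityMeasure P] (n m : ℕ) :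
    ∫⁻ ω, ENNReal.ofReal
        (influenceAverage ψf ψg f g (Finset.range n) (Finset.range m) X Y ω ^ 2) ∂P
      ≤ ENNReal.ofReal (3 * (∫ x, ψf f g x ^ 2 ∂(law 𝒳 f) + ∫ x, ψg f g x ^ 2 ∂(law 𝒳 g))
          * ((n : ℝ)⁻¹ + (m : ℝ)⁻¹)) := by
  have hw : ∀ n : ℕ, ∑ _i ∈ Finset.range n, (1 / (n : ℝ)) ^ 2 ≤ (n : ℝ)⁻¹ := fun n => by
    rw [Finset.sum_const, Finset.card_range, nsmul_eq_mul]
    refine le_of_eq ?_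
    rcases eq_or_ne (n : ℝ) 0 with h | h
    · simp [h]
    · field_simp
  have h := S.lintegral_sq_weighted_influence_le (Finset.range n) (Finset.range m)
    (fun _ => 1 / (n : ℝ)) (fun _ => 1 / (m : ℝ)) (hw n) (hw m)
  simpa only [influenceAverage, Finset.card_range, Finset.mul_sum] using h

/-- Asymptotic linearity of the data-split estimator. -/
lemma exists_lintegral_sq_dsEstimator_sub_le [IsProbabilityMeasure P] (hs : 0 < s) :
    ∃ K n₀, 0 ≤ K ∧ 1 ≤ n₀ ∧ ∀ n m : ℕ, n₀ ≤ n → n₀ ≤ m →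
      ∫⁻ ω, ENNReal.ofReal ((dsEstimator 𝒳 φ ν ψf ψg F G n m (fun i => X i ω) (fun j => Y j ω)
          - T 𝒳 φ ν f g
          - influenceAverage ψf ψg f g (Finset.range n) (Finset.range m) X Y ω) ^ 2) ∂P
        ≤ ENNReal.ofReal (K * (remainderBound d s n m n m
          + ((n : ℝ)⁻¹ ^ 2 + (m : ℝ)⁻¹ ^ 2))) := by
  have hM := S.bounds_f.nonneg
  have hk := S.estimator_f.one_le
  set Q := 3 * (2 * (2 * C ^ 3 * volume.real 𝒳 + C ^ 2) ^ 2 * M + M * (M + 1)) with hQ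
  have hQ0 : 0 ≤ Q := by positivity
  set V := 3 * (∫ x, ψf f g x ^ 2 ∂(law 𝒳 f) + ∫ x, ψg f g x ^ 2 ∂(law 𝒳 g)) with hV
  have hV0 : 0 ≤ V := mul_nonneg (by norm_num)
    (add_nonneg (integral_nonneg fun x => sq_nonneg _) (integral_nonneg fun x => sq_nonneg _))
  -- From `2 k₀` points on, each half has at least `k₀`. The constants are `24 = 3 * (1/4 + 1/4) *
  -- 16`, from the two preliminary errors halved, and `12 = 3 * 4`, from the unequal halves.
  refine ⟨24 * Q + 12 * V, 2 * k₀, by positivity, by omega, fun n m hn hm => ?_⟩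
  obtain ⟨w, hw, hwv⟩ := exists_half_weights (n := n) (by omega)
  obtain ⟨w', hw', hwv'⟩ := exists_half_weights (n := m) (by omega)
  have hdisj : ∀ n : ℕ, Disjoint (Finset.range (n / 2)) (Finset.Ico (n / 2) n) := fun n =>
    Finset.disjoint_left.2 fun i h1 h2 =>
      absurd (Finset.mem_range.1 h1) (not_lt.2 (Finset.mem_Ico.1 h2).1)
  have hne : ∀ {n : ℕ}, 2 * k₀ ≤ n → (Finset.range (n / 2)).Nonempty
      ∧ (Finset.Ico (n / 2) n).Nonempty := fun {n} h =>
    ⟨Finset.nonempty_range_iff.2 (by omega), Finset.nonempty_Ico.2 (by omega)⟩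
  have h1 := S.lintegral_sq_dsPrelim_sub_le (hdisj n) (hdisj m)
    (by rw [Finset.card_range]; omega) (by rw [Finset.card_range]; omega) (hne hn).2 (hne hm).2
  have h2 := S.lintegral_sq_dsPrelim_sub_le (hdisj n).symm (hdisj m).symm
    (by rw [Nat.card_Ico]; omega) (by rw [Nat.card_Ico]; omega) (hne hn).1 (hne hm).1
  have h3 := S.lintegral_sq_weighted_influence_le (Finset.range n) (Finset.range m) w w' hw hw'
  rw [← hQ] at h1 h2
  rw [← hV] at h3
  set e₁ : Ω → ℝ := fun ω => dsPrelim 𝒳 φ ν ψf ψg F G (Finset.range (n / 2))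
    (Finset.Ico (n / 2) n) (Finset.range (m / 2)) (Finset.Ico (m / 2) m) (fun i => X i ω)
    (fun j => Y j ω) - T 𝒳 φ ν f g
    - influenceAverage ψf ψg f g (Finset.Ico (n / 2) n) (Finset.Ico (m / 2) m) X Y ω with he₁
  set e₂ : Ω → ℝ := fun ω => dsPrelim 𝒳 φ ν ψf ψg F G (Finset.Ico (n / 2) n)
    (Finset.range (n / 2)) (Finset.Ico (m / 2) m) (Finset.range (m / 2)) (fun i => X i ω)
    (fun j => Y j ω) - T 𝒳 φ ν f g
    - influenceAverage ψf ψg f g (Finset.range (n / 2)) (Finset.range (m / 2)) X Y ω with he₂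
  have hm₁ : Measurable e₁ := ((S.measurable_dsPrelim _ _ _ _).sub measurable_const).sub
    (S.measurable_influenceAverage _ _)
  have hm₂ : Measurable e₂ := ((S.measurable_dsPrelim _ _ _ _).sub measurable_const).sub
    (S.measurable_influenceAverage _ _)
  -- Averaging the two linearizations produces the influence average over the full samples up to the
  -- small weighted sums, which form the third error term.
  have hsplit : ∀ ω, dsEstimator 𝒳 φ ν ψf ψg F G n m (fun i => X i ω) (fun j => Y j ω)
      - T 𝒳 φ ν f g - influenceAverage ψf ψg f g (Finset.range n) (Finset.range m) X Y ω
      = e₁ ω / 2 + e₂ ω / 2 + (∑ i ∈ Finset.range n, w i * ψf f g (X i ω)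
        + ∑ j ∈ Finset.range m, w' j * ψg f g (Y j ω)) := fun ω => by
    have a1 := hwv fun i => ψf f g (X i ω)
    have a2 := hwv' fun j => ψg f g (Y j ω)
    simp only [he₁, he₂, dsEstimator, influenceAverage]
    linear_combination a1 + a2
  simp only [hsplit]
  have hr : ∀ {a a' c c' : ℕ}, 1 ≤ a → 1 ≤ a' → 1 ≤ c → 1 ≤ c' → n ≤ 4 * a → m ≤ 4 * a' →
      n ≤ 4 * c → m ≤ 4 * c' → Q * remainderBound d s a a' c c'
        ≤ 16 * Q * remainderBound d s n m n m :=
    fun h1 h2 h3 h4 h5 h6 h7 h8 => (mul_le_mul_of_nonneg_left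
      (remainderBound_half_le hs (by omega) (by omega) h1 h2 h3 h4 h5 h6 h7 h8) hQ0).trans_eq (by ring)
  have h1' := h1.trans (ENNReal.ofReal_le_ofReal (hr
    (by rw [Finset.card_range]; omega) (by rw [Finset.card_range]; omega)
    (by rw [Nat.card_Ico]; omega) (by rw [Nat.card_Ico]; omega)
    (by rw [Finset.card_range]; omega) (by rw [Finset.card_range]; omega)
    (by rw [Nat.card_Ico]; omega) (by rw [Nat.card_Ico]; omega)))
  have h2' := h2.trans (ENNReal.ofReal_le_ofReal (hr
    (by rw [Nat.card_Ico]; omega) (by rw [Nat.card_Ico]; omega)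
    (by rw [Finset.card_range]; omega) (by rw [Finset.card_range]; omega)
    (by rw [Nat.card_Ico]; omega) (by rw [Nat.card_Ico]; omega)
    (by rw [Finset.card_range]; omega) (by rw [Finset.card_range]; omega)))
  have hhalf : ∀ e : Ω → ℝ, ∫⁻ ω, ENNReal.ofReal ((e ω / 2) ^ 2) ∂P
      = ENNReal.ofReal (1 / 4) * ∫⁻ ω, ENNReal.ofReal (e ω ^ 2) ∂P := fun e => by
    rw [← lintegral_const_mul' _ _ ENNReal.ofReal_ne_top]
    refine lintegral_congr fun ω => ?_
    rw [← ENNReal.ofReal_mul (by norm_num)]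
    congr 1
    ring
  refine (lintegral_ofReal_add_sq_le (hm₁.div_const 2) (hm₂.div_const 2)).trans ?_
  rw [hhalf e₁, hhalf e₂]
  have hR0 : 0 ≤ remainderBound d s n m n m := by
    have := rate_nonneg (d := d) (s := s) n
    have := rate_nonneg (d := d) (s := s) m
    unfold remainderBound
    positivity
  set R := remainderBound d s n m n m
  calc _ ≤ 3 * (ENNReal.ofReal (1 / 4) * ENNReal.ofReal (16 * Q * R)
        + ENNReal.ofReal (1 / 4) * ENNReal.ofReal (16 * Q * R)
        + ENNReal.ofReal (V * (4 * (n : ℝ)⁻¹ ^ 2 + 4 * (m : ℝ)⁻¹ ^ 2))) := by gcongr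
    _ = ENNReal.ofReal (3 * (1 / 4 * (16 * Q * R) + 1 / 4 * (16 * Q * R)
        + V * (4 * (n : ℝ)⁻¹ ^ 2 + 4 * (m : ℝ)⁻¹ ^ 2))) := by
        rw [ENNReal.ofReal_mul (p := 3) (by norm_num), ENNReal.ofReal_add (by positivity) (by positivity),
          ENNReal.ofReal_add (by positivity) (by positivity),
          ENNReal.ofReal_mul (p := 1 / 4) (by norm_num)]
        norm_num
    _ ≤ _ := by
        refine ENNReal.ofReal_le_ofReal ?_
        have h5 : 0 ≤ Q * ((n : ℝ)⁻¹ ^ 2 + (m : ℝ)⁻¹ ^ 2) := by positivity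
        have h6 : 0 ≤ V * R := by positivity
        linarith

/-- The mean squared error of the data-split estimator. -/
lemma exists_lintegral_sq_dsEstimator_le [IsProbabilityMeasure P] (hs : 0 < s) :
    ∃ K n₀, 0 ≤ K ∧ 1 ≤ n₀ ∧ ∀ n m : ℕ, n₀ ≤ n → n₀ ≤ m →
      ∫⁻ ω, ENNReal.ofReal ((dsEstimator 𝒳 φ ν ψf ψg F G n m (fun i => X i ω) (fun j => Y j ω)
          - T 𝒳 φ ν f g) ^ 2) ∂P
        ≤ ENNReal.ofReal (K * (rate d s n ^ 2 + rate d s m ^ 2 + ((n : ℝ)⁻¹ + (m : ℝ)⁻¹))) := by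
  obtain ⟨K, n₀, hK, hn₀, h⟩ := S.exists_lintegral_sq_dsEstimator_sub_le hs
  set V := 3 * (∫ x, ψf f g x ^ 2 ∂(law 𝒳 f) + ∫ x, ψg f g x ^ 2 ∂(law 𝒳 g)) with hV
  have hV0 : 0 ≤ V := mul_nonneg (by norm_num)
    (add_nonneg (integral_nonneg fun x => sq_nonneg _) (integral_nonneg fun x => sq_nonneg _))
  refine ⟨3 * (3 * K + V), n₀, by positivity, hn₀, fun n m hn hm => ?_⟩
  have h1 := h n m hn hm
  have h2 := S.lintegral_sq_influenceAverage_le n m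
  rw [← hV] at h2
  have hmeas := S.measurable_influenceAverage (Finset.range n) (Finset.range m)
  have hmeas' := ((S.measurable_dsEstimator n m).sub (measurable_const (a := T 𝒳 φ ν f g))).sub hmeas
  have h3 := lintegral_ofReal_add_sq_le (P := P) (c := fun _ => 0) hmeas' hmeas
  simp only [Pi.sub_apply, sub_add_cancel, add_zero, ne_eq, OfNat.ofNat_ne_zero, not_false_eq_true,
    zero_pow, ENNReal.ofReal_zero, lintegral_zero] at h3
  refine h3.trans ?_
  have hrate : ∀ n : ℕ, 1 ≤ n → rate d s n ≤ 1 := fun n hn => by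
    have hd : (0 : ℝ) ≤ d := Nat.cast_nonneg d
    refine Real.rpow_le_one_of_one_le_of_nonpos (by exact_mod_cast hn) ?_
    rw [neg_div]
    have : 0 ≤ 2 * s / (2 * s + d) := by positivity
    linarith
  -- Rates and inverse sample sizes are at most one, so the mixed products and the squares are
  -- absorbed by the inverse sample sizes.
  have hle : remainderBound d s n m n m + ((n : ℝ)⁻¹ ^ 2 + (m : ℝ)⁻¹ ^ 2)
      ≤ 3 * (rate d s n ^ 2 + rate d s m ^ 2 + ((n : ℝ)⁻¹ + (m : ℝ)⁻¹)) := by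
    have r1 := hrate n (by omega)
    have r2 := hrate m (by omega)
    have i1 : (0 : ℝ) ≤ (n : ℝ)⁻¹ := by positivity
    have i2 : (0 : ℝ) ≤ (m : ℝ)⁻¹ := by positivity
    have j1 : (n : ℝ)⁻¹ ≤ 1 := inv_le_one_of_one_le₀ (by exact_mod_cast (by omega : 1 ≤ n))
    have j2 : (m : ℝ)⁻¹ ≤ 1 := inv_le_one_of_one_le₀ (by exact_mod_cast (by omega : 1 ≤ m))
    have k1 : (n : ℝ)⁻¹ ^ 2 ≤ (n : ℝ)⁻¹ := pow_le_of_le_one i1 j1 two_ne_zero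
    have k2 : (m : ℝ)⁻¹ ^ 2 ≤ (m : ℝ)⁻¹ := pow_le_of_le_one i2 j2 two_ne_zero
    have k3 : ((n : ℝ)⁻¹ + (m : ℝ)⁻¹) * (rate d s n + rate d s m)
        ≤ ((n : ℝ)⁻¹ + (m : ℝ)⁻¹) * 2 := by gcongr; linarith
    unfold remainderBound
    nlinarith [sq_nonneg (rate d s n), sq_nonneg (rate d s m)]
  have hp : 0 ≤ rate d s n ^ 2 + rate d s m ^ 2 := by positivity
  have hi : (0 : ℝ) ≤ (n : ℝ)⁻¹ + (m : ℝ)⁻¹ := by positivity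
  calc _ ≤ 3 * (ENNReal.ofReal
          (K * (3 * (rate d s n ^ 2 + rate d s m ^ 2 + ((n : ℝ)⁻¹ + (m : ℝ)⁻¹))))
        + ENNReal.ofReal (V * ((n : ℝ)⁻¹ + (m : ℝ)⁻¹))) := by
        gcongr
        exact h1.trans (ENNReal.ofReal_le_ofReal (by gcongr))
    _ = ENNReal.ofReal
          (3 * (K * (3 * (rate d s n ^ 2 + rate d s m ^ 2 + ((n : ℝ)⁻¹ + (m : ℝ)⁻¹)))
          + V * ((n : ℝ)⁻¹ + (m : ℝ)⁻¹))) := by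
        rw [ENNReal.ofReal_mul (p := 3) (by norm_num), ENNReal.ofReal_add (by positivity) (by positivity)]
        norm_num
    _ ≤ _ := by
        refine ENNReal.ofReal_le_ofReal ?_
        nlinarith [mul_nonneg hV0 hp]

end SplitSetting

end Linearization

/-! ### Asymptotic normality of the data-split estimator -/

lemma tendsto_sampleSize_ratio {n m : ℕ → ℕ} {ζ : ℝ} (hζ : ζ ∈ Set.Ioo (0 : ℝ) 1)
    (hn : Tendsto n atTop atTop)
    (h : Tendsto (fun k => (n k : ℝ) / ((n k : ℝ) + (m k : ℝ))) atTop (𝓝 ζ)) :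
    Tendsto (fun k => ((n k : ℝ) + (m k : ℝ)) / (n k : ℝ)) atTop (𝓝 (1 / ζ)) ∧
    Tendsto (fun k => ((n k : ℝ) + (m k : ℝ)) / (m k : ℝ)) atTop (𝓝 (1 / (1 - ζ))) := by
  have h1 : Tendsto (fun k => (m k : ℝ) / ((n k : ℝ) + (m k : ℝ))) atTop (𝓝 (1 - ζ)) := by
    refine (tendsto_const_nhds.sub h).congr' ?_
    filter_upwards [hn.eventually_ge_atTop 1] with k hk
    have hk' : (1 : ℝ) ≤ n k := by exact_mod_cast hk
    have : (n k : ℝ) + m k ≠ 0 := by positivity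
    field_simp
    ring
  constructor
  · have := h.inv₀ hζ.1.ne'
    simpa only [inv_div, one_div] using this
  · have := h1.inv₀ (sub_pos.2 hζ.2).ne'
    simpa only [inv_div, one_div] using this

lemma tendsto_rate {d : ℕ} {s : ℝ} (hs : 0 < s) : Tendsto (rate d s) atTop (𝓝 0) := by
  have hd : (0 : ℝ) ≤ d := Nat.cast_nonneg d
  have h := (tendsto_rpow_neg_atTop (show 0 < 2 * s / (2 * s + d) by positivity)).comp
    tendsto_natCast_atTop_atTop
  refine h.congr fun n => ?_
  rw [rate, neg_div]
  rfl

/-- The threshold of the limit theorem originates here: `4 s / (2 s + d)` exceeds one if and only if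
`s > d / 2`. -/
lemma tendsto_mul_rate_sq {d : ℕ} {s : ℝ} (hs : 0 < s) (hds : (d : ℝ) / 2 < s) :
    Tendsto (fun n : ℕ => (n : ℝ) * rate d s n ^ 2) atTop (𝓝 0) := by
  have hd : (0 : ℝ) ≤ d := Nat.cast_nonneg d
  have h := (tendsto_rpow_neg_atTop
    (show 0 < 4 * s / (2 * s + d) - 1 by
      rw [sub_pos, lt_div_iff₀ (by positivity)]; linarith)).comp tendsto_natCast_atTop_atTop
  refine h.congr' ?_
  filter_upwards [eventually_ge_atTop 1] with n hn
  have hn' : (0 : ℝ) < n := by exact_mod_cast hn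
  rw [rate_sq, Function.comp_apply, neg_sub, neg_div, sub_eq_add_neg, Real.rpow_add hn',
    Real.rpow_one]

/-- The remainder of the linearization is negligible above the critical smoothness. -/
lemma tendsto_mul_remainderBound {d : ℕ} {s : ℝ} (hs : 0 < s) (hds : (d : ℝ) / 2 < s)
    {n m : ℕ → ℕ} {ζ : ℝ} (hζ : ζ ∈ Set.Ioo (0 : ℝ) 1) (hn : Tendsto n atTop atTop)
    (hm : Tendsto m atTop atTop)
    (h : Tendsto (fun k => (n k : ℝ) / ((n k : ℝ) + (m k : ℝ))) atTop (𝓝 ζ)) :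
    Tendsto (fun k => ((n k : ℝ) + (m k : ℝ)) * (remainderBound d s (n k) (m k) (n k) (m k)
      + ((n k : ℝ)⁻¹ ^ 2 + (m k : ℝ)⁻¹ ^ 2))) atTop (𝓝 0) := by
  obtain ⟨h1, h2⟩ := tendsto_sampleSize_ratio hζ hn h
  have r1 := (tendsto_rate (d := d) hs).comp hn
  have r2 := (tendsto_rate (d := d) hs).comp hm
  have q1 := (tendsto_mul_rate_sq hs hds).comp hn
  have q2 := (tendsto_mul_rate_sq hs hds).comp hm
  have i1 := tendsto_inv_atTop_nhds_zero_nat (𝕜 := ℝ).comp hn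
  have i2 := tendsto_inv_atTop_nhds_zero_nat (𝕜 := ℝ).comp hm
  -- With `N = n + m`, every term is regrouped as a convergent ratio `N / n` or `N / m` times a null
  -- sequence.
  have key := (((h1.mul q1).add (h2.mul q2)).add ((h1.add h2).mul (r1.add r2))).add
    ((h1.mul i1).add (h2.mul i2))
  simp only [mul_zero, add_zero] at key
  refine key.congr' ?_
  filter_upwards [hn.eventually_ge_atTop 1, hm.eventually_ge_atTop 1] with k hk hk'
  have : (n k : ℝ) ≠ 0 := by exact_mod_cast (by omega : n k ≠ 0)
  have : (m k : ℝ) ≠ 0 := by exact_mod_cast (by omega : m k ≠ 0)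
  simp only [Function.comp_apply, remainderBound]
  field_simp

section AsymptoticNormality

variable {d : ℕ} {Ω : Type*} [MeasurableSpace Ω] {P : Measure Ω}

/-- The central limit theorem for a centered function of an i.i.d. sequence. -/
lemma tendstoInDistribution_scaled_sum_comp [IsProbabilityMeasure P] {α : Type*}
    [MeasurableSpace α] {μ : Measure α} {X : ℕ → Ω → α} (hX : ∀ i, Measurable (X i))
    (hlaw : ∀ i, P.map (X i) = μ) (hind : iIndepFun X P) {u : α → ℝ} (hu : Measurable u)
    (hL : MemLp u 2 μ) (h0 : ∫ x, u x ∂μ = 0) {n : ℕ → ℕ} (hn : Tendsto n atTop atTop)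
    {a : ℕ → ℝ} {c : ℝ} (ha : Tendsto a atTop (𝓝 c)) :
    TendstoInDistribution
      (fun k ω => a k * ((√(n k : ℝ))⁻¹ * ∑ i ∈ Finset.range (n k), u (X i ω)))
      atTop (id : ℝ → ℝ) (fun _ => P) (gaussianReal 0 (c ^ 2 * variance u μ).toNNReal) := by
  have hmap : ∀ i, P.map (fun ω => u (X i ω)) = μ.map u := fun i => by
    rw [← hlaw i, Measure.map_map hu (hX i)]
    rfl
  have hvar : variance (fun ω => u (X 0 ω)) P = variance u μ := by
    rw [← hlaw 0, variance_map hu.aemeasurable (hX 0).aemeasurable]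
    rfl
  rw [← hvar]
  refine tendstoInDistribution_scaled_sum (U := fun i ω => u (X i ω))
    (hind.comp (fun _ => u) fun _ => hu)
    (fun i => ⟨(hu.comp (hX i)).aemeasurable, (hu.comp (hX 0)).aemeasurable, by
      rw [hmap i, hmap 0]⟩) ?_ ?_ hn ha
  · rw [← hlaw 0] at hL
    exact (memLp_map_measure_iff hu.aestronglyMeasurable (hX 0).aemeasurable).1 hL
  · rw [← h0, ← hlaw 0, integral_map (hX 0).aemeasurable hu.aestronglyMeasurable]

variable {s B' B : ℝ} {𝒳 : Set (E d)} {trunc : Bool} {φ : ℝ → ℝ} {ν : ℝ × ℝ → ℝ}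
  {ψf ψg : (E d → ℝ) → (E d → ℝ) → E d → ℝ} {f g : E d → ℝ}
  {F G : Finset ℕ → (ℕ → E d) → E d → ℝ} {X Y : ℕ → Ω → E d} {I : Set ℝ} {C M : ℝ} {k₀ : ℕ}

namespace SplitSetting

variable (S : SplitSetting P s B' B 𝒳 trunc φ ν ψf ψg f g F G X Y I C M k₀)
include S

lemma indepFun_sum_influence [IsProbabilityMeasure P] (n m : ℕ) (a b : ℝ) :
    IndepFun (fun ω => a * ∑ i ∈ Finset.range n, ψf f g (X i ω))
      (fun ω => b * ∑ j ∈ Finset.range m, ψg f g (Y j ω)) P := by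
  obtain ⟨hmf, hmg⟩ := S.measurable_influence_true
  -- With no points retained from the second sample, the masked data carry the first sample alone
  -- and are independent of the whole second block.
  have h := (indepFun_maskedData (P := P) S.measurable_X S.measurable_Y S.indep
    (A := Finset.range n) (C := ∅) (A' := ∅) (C' := Finset.range m)
    (Finset.disjoint_empty_right _) (Finset.disjoint_empty_left _)).2
  have h1 : Measurable fun z : (ℕ → E d) × (ℕ → E d) =>
      a * ∑ i ∈ Finset.range n, ψf f g (z.1 i) :=
    (Finset.measurable_fun_sum _ fun i _ =>
      hmf.comp ((measurable_pi_apply i).comp measurable_fst)).const_mul a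
  have h2 : Measurable fun z : Finset.range m → E d => b * ∑ j, ψg f g (z j) :=
    (Finset.measurable_fun_sum _ fun j _ => hmg.comp (measurable_pi_apply j)).const_mul b
  convert h.comp h1 h2 using 1
  · ext ω
    simp only [Function.comp_apply, maskedData]
    congr 1
    exact Finset.sum_congr rfl fun i hi => by simp [Finset.mem_range.1 hi]
  · ext ω
    simp only [Function.comp_apply]
    rw [Finset.sum_coe_sort (Finset.range m) fun j => ψg f g (Y j ω)]

/-- Asymptotic normality of the averages of the influence functions. -/
lemma tendstoInDistribution_influenceAverage [IsProbabilityMeasure P] {n m : ℕ → ℕ} {ζ : ℝ}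
    (hζ : ζ ∈ Set.Ioo (0 : ℝ) 1) (hn : Tendsto n atTop atTop) (hm : Tendsto m atTop atTop)
    (h : Tendsto (fun k => (n k : ℝ) / ((n k : ℝ) + (m k : ℝ))) atTop (𝓝 ζ)) :
    TendstoInDistribution (fun k ω => √((n k : ℝ) + (m k : ℝ))
        * influenceAverage ψf ψg f g (Finset.range (n k)) (Finset.range (m k)) X Y ω)
      atTop (id : ℝ → ℝ) (fun _ => P)
      (gaussianReal 0 (Real.toNNReal (1 / ζ * variance (ψf f g) (law 𝒳 f)
        + 1 / (1 - ζ) * variance (ψg f g) (law 𝒳 g)))) := by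
  obtain ⟨hmf, hmg⟩ := S.measurable_influence_true
  obtain ⟨h1, h2⟩ := tendsto_sampleSize_ratio hζ hn h
  have hf := tendstoInDistribution_scaled_sum_comp S.measurable_X S.law_X S.indep_X hmf
    (S.memLp_influence_f S.mem_f S.mem_g) S.bounds_f.centered hn h1.sqrt
  have hg := tendstoInDistribution_scaled_sum_comp S.measurable_Y S.law_Y S.indep_Y hmg
    (S.memLp_influence_g S.mem_f S.mem_g) S.bounds_g.centered hm h2.sqrt
  have hζ1 : 0 ≤ 1 / ζ := one_div_nonneg.2 hζ.1.le
  have hζ2 : 0 ≤ 1 / (1 - ζ) := one_div_nonneg.2 (sub_pos.2 hζ.2).le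
  rw [Real.sq_sqrt hζ1] at hf
  rw [Real.sq_sqrt hζ2] at hg
  have key := tendstoInDistribution_add_gaussian (mul_nonneg hζ1 (variance_nonneg _ _))
    (mul_nonneg hζ2 (variance_nonneg _ _)) hf hg fun k => by
      simp only [← mul_assoc]
      exact S.indepFun_sum_influence (n k) (m k) _ _
  -- The factors `√(N / n)` tend to `√(1 / ζ)`; combined with the normalization `1 / √n` they
  -- produce `√N / n`, the weight of a point in the scaled average.
  have hscale : ∀ N n : ℝ, 0 ≤ N → 0 ≤ n → √(N / n) * (√n)⁻¹ = √N * (1 / n) := fun N n hN hn => by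
    rw [Real.sqrt_div hN, div_mul_eq_mul_div, mul_div_assoc]
    congr 1
    rw [div_eq_mul_inv, ← mul_inv, Real.mul_self_sqrt hn, one_div]
  convert key using 3 with k ω
  have e1 := hscale ((n k : ℝ) + m k) (n k) (by positivity) (by positivity)
  have e2 := hscale ((n k : ℝ) + m k) (m k) (by positivity) (by positivity)
  rw [influenceAverage, Finset.card_range, Finset.card_range, ← mul_assoc, ← mul_assoc, e1, e2]
  ring

/-- Asymptotic normality of the data-split estimator. -/
lemma tendstoInDistribution_dsEstimator [IsProbabilityMeasure P] (hs : 0 < s)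
    (hds : (d : ℝ) / 2 < s) {n m : ℕ → ℕ} {ζ : ℝ}
    (hζ : ζ ∈ Set.Ioo (0 : ℝ) 1) (hn : Tendsto n atTop atTop) (hm : Tendsto m atTop atTop)
    (h : Tendsto (fun k => (n k : ℝ) / ((n k : ℝ) + (m k : ℝ))) atTop (𝓝 ζ)) :
    TendstoInDistribution (fun k ω => √((n k : ℝ) + (m k : ℝ))
        * (dsEstimator 𝒳 φ ν ψf ψg F G (n k) (m k) (fun i => X i ω) (fun j => Y j ω)
          - T 𝒳 φ ν f g))
      atTop (id : ℝ → ℝ) (fun _ => P)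
      (gaussianReal 0 (Real.toNNReal (1 / ζ * variance (ψf f g) (law 𝒳 f)
        + 1 / (1 - ζ) * variance (ψg f g) (law 𝒳 g)))) := by
  have hlin := S.tendstoInDistribution_influenceAverage hζ hn hm h
  obtain ⟨K, n₀, hK, hn₀, hrem⟩ := S.exists_lintegral_sq_dsEstimator_sub_le hs
  have hmeas : ∀ k, Measurable fun ω => √((n k : ℝ) + (m k : ℝ))
      * (dsEstimator 𝒳 φ ν ψf ψg F G (n k) (m k) (fun i => X i ω) (fun j => Y j ω)
        - T 𝒳 φ ν f g) := fun k =>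
    ((S.measurable_dsEstimator (n k) (m k)).sub measurable_const).const_mul _
  -- By Slutsky's lemma the linear part decides the limit once `√N` times the linearization error
  -- vanishes in mean square, which means that `N` times the remainder bound tends to zero.
  refine tendstoInDistribution_of_tendstoInMeasure_sub _ id hlin ?_ fun k => (hmeas k).aemeasurable
  refine tendstoInMeasure_zero_of_lintegral_sq (fun k => (hmeas k).sub
    ((S.measurable_influenceAverage _ _).const_mul _)) ?_
  have h0 := ENNReal.tendsto_ofReal
    ((tendsto_mul_remainderBound hs hds hζ hn hm h).const_mul K)
  rw [mul_zero, ENNReal.ofReal_zero] at h0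
  refine tendsto_of_tendsto_of_tendsto_of_le_of_le' tendsto_const_nhds h0
    (Eventually.of_forall fun _ => zero_le) ?_
  filter_upwards [hn.eventually_ge_atTop n₀, hm.eventually_ge_atTop n₀] with k hk hk'
  have hN : (0 : ℝ) ≤ (n k : ℝ) + m k := by positivity
  have h1 := hrem (n k) (m k) hk hk'
  have h2 : ∀ ω, ENNReal.ofReal ((√((n k : ℝ) + (m k : ℝ))
      * (dsEstimator 𝒳 φ ν ψf ψg F G (n k) (m k) (fun i => X i ω) (fun j => Y j ω)
        - T 𝒳 φ ν f g) - √((n k : ℝ) + (m k : ℝ))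
      * influenceAverage ψf ψg f g (Finset.range (n k)) (Finset.range (m k)) X Y ω) ^ 2)
      = ENNReal.ofReal ((n k : ℝ) + m k) * ENNReal.ofReal
        ((dsEstimator 𝒳 φ ν ψf ψg F G (n k) (m k) (fun i => X i ω) (fun j => Y j ω)
          - T 𝒳 φ ν f g
          - influenceAverage ψf ψg f g (Finset.range (n k)) (Finset.range (m k)) X Y ω) ^ 2) :=
    fun ω => by rw [← ENNReal.ofReal_mul hN, ← mul_sub, mul_pow, Real.sq_sqrt hN]
  simp only [Pi.sub_apply, h2]
  rw [lintegral_const_mul' _ _ ENNReal.ofReal_ne_top]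
  refine (mul_le_mul_right h1 _).trans (le_of_eq ?_)
  rw [← ENNReal.ofReal_mul hN]
  congr 1
  ring

end SplitSetting

/-- The data-split estimator which is based on kernel density estimates. -/
lemma exists_splitSetting [IsProbabilityMeasure P] {s L B' B : ℝ} (hs : 0 < s) {𝒳 𝒮 : Set (E d)}
    (h𝒳 : IsCompact 𝒳) (h𝒮 : IsClosed 𝒮) (h𝒮' : UniqueDiffOn ℝ 𝒮) (h𝒳𝒮 : 𝒳 ⊆ 𝒮)
    (hf : f ∈ BoundedHolderClass s L B' B 𝒳 𝒮) (hg : g ∈ BoundedHolderClass s L B' B 𝒳 𝒮)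
    (hfd : IsDensity 𝒳 f) (hgd : IsDensity 𝒳 g) (trunc : Bool) {Kf Kg : ℝ → E d → E d → ℝ}
    {bf bg : ℕ → ℝ} (hKf : IsSmoothingKernel s 𝒳 𝒮 Kf) (hKg : IsSmoothingKernel s 𝒳 𝒮 Kg)
    (hbf : IsOptimalBandwidth d s bf) (hbg : IsOptimalBandwidth d s bg)
    (hT : IsRegularFunctional 𝒳 (valueRange trunc B' B) φ ν)
    (hψf : IsInfluenceFst 𝒳 (valueRange trunc B' B) φ ν ψf)
    (hψg : IsInfluenceSnd 𝒳 (valueRange trunc B' B) φ ν ψg)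
    (hmf : JointlyMeasurable 𝒳 (valueRange trunc B' B) ψf)
    (hmg : JointlyMeasurable 𝒳 (valueRange trunc B' B) ψg)
    (hrf : InfluenceRegular 𝒳 (valueRange trunc B' B) ψf f g f)
    (hrg : InfluenceRegular 𝒳 (valueRange trunc B' B) ψg f g g)
    (hX : ∀ i, Measurable (X i)) (hY : ∀ j, Measurable (Y j))
    (hXlaw : ∀ i, P.map (X i) = law 𝒳 f) (hYlaw : ∀ j, P.map (Y j) = law 𝒳 g)
    (hindep : iIndepFun (Sum.elim X Y) P) :
    ∃ I C M k₀, SplitSetting P s B' B 𝒳 trunc φ ν ψf ψg f g (densEst trunc B' B Kf bf)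
      (densEst trunc B' B Kg bg) X Y I C M k₀ := by
  have hf' := isBoundedDensity_of_mem_boundedHolderClass h𝒳 h𝒳𝒮 hf hfd
  have hg' := isBoundedDensity_of_mem_boundedHolderClass h𝒳 h𝒳𝒮 hg hgd
  obtain ⟨I, C, H⟩ := hT.exists_bounds h𝒳 (convex_valueRange trunc B' B)
    (nontrivial_valueRange trunc hf'.lt)
  obtain ⟨M₁, h₁⟩ := hψf.exists_influenceBounds hf' hg' H hrf
  obtain ⟨M₂, h₂⟩ := hψg.exists_influenceBounds hf' hg' H hrg
  obtain ⟨M₃, k₃, h₃⟩ := exists_isEstimator_densEst hs h𝒮 h𝒮' h𝒳𝒮 hf' hf.1 hKf trunc hbf hX hXlaw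
    (hindep.precomp (g := Sum.inl) Sum.inl_injective)
  obtain ⟨M₄, k₄, h₄⟩ := exists_isEstimator_densEst hs h𝒮 h𝒮' h𝒳𝒮 hg' hg.1 hKg trunc hbg hY hYlaw
    (hindep.precomp (g := Sum.inr) Sum.inr_injective)
  exact ⟨I, C, max (max M₁ M₂) (max M₃ M₄), max k₃ k₄, hf', hg', H, hψf, hψg, hmf, hmg,
    h₁.mono (le_max_of_le_left (le_max_left _ _)), h₂.mono (le_max_of_le_left (le_max_right _ _)),
    h₃.mono (le_max_of_le_right (le_max_left _ _)) (le_max_left _ _),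
    h₄.mono (le_max_of_le_right (le_max_right _ _)) (le_max_right _ _), hX, hY, hXlaw, hYlaw,
    hindep⟩

end AsymptoticNormality

/-! ### Comparison of the nonparametric and the parametric rate -/

lemma inv_le_rate_sq {d : ℕ} {s : ℝ} (hs : 0 < s) (h : s ≤ (d : ℝ) / 2) {n : ℕ} (hn : 1 ≤ n) :
    (n : ℝ)⁻¹ ≤ rate d s n ^ 2 := by
  rw [rate_sq, ← Real.rpow_neg_one]
  refine Real.rpow_le_rpow_of_exponent_le (by exact_mod_cast hn) ?_
  rw [neg_div, neg_le_neg_iff]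
  exact div_le_one_of_le₀ (by linarith) (by positivity)

lemma rate_sq_le_inv {d : ℕ} {s : ℝ} (hs : 0 < s) (h : (d : ℝ) / 2 ≤ s) {n : ℕ} (hn : 1 ≤ n) :
    rate d s n ^ 2 ≤ (n : ℝ)⁻¹ := by
  rw [rate_sq, ← Real.rpow_neg_one]
  refine Real.rpow_le_rpow_of_exponent_le (by exact_mod_cast hn) ?_
  rw [neg_div, neg_le_neg_iff, one_le_div (by positivity)]
  linarith

end VonMises

end

theorem theorem2 {d : ℕ} (hd : 0 < d) {s L B' B : ℝ} (hs : 0 < s)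
    -- the sample space, and the set on which the densities (extended by zero) are smooth
    (𝒳 𝒮 : Set (VonMises.E d)) (h𝒳 : IsCompact 𝒳) (h𝒮 : IsClosed 𝒮) (h𝒮' : UniqueDiffOn ℝ 𝒮)
    (h𝒳𝒮 : 𝒳 ⊆ 𝒮)
    -- the densities
    (f g : VonMises.E d → ℝ)
    (hf : f ∈ VonMises.BoundedHolderClass s L B' B 𝒳 𝒮)
    (hg : g ∈ VonMises.BoundedHolderClass s L B' B 𝒳 𝒮)
    (hfd : VonMises.IsDensity 𝒳 f) (hgd : VonMises.IsDensity 𝒳 g)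
    -- the kernel density estimators, truncated or not
    (trunc : Bool) (Kf Kg : ℝ → VonMises.E d → VonMises.E d → ℝ) (bf bg : ℕ → ℝ)
    (hKf : VonMises.IsSmoothingKernel s 𝒳 𝒮 Kf) (hKg : VonMises.IsSmoothingKernel s 𝒳 𝒮 Kg)
    (hbf : VonMises.IsOptimalBandwidth d s bf) (hbg : VonMises.IsOptimalBandwidth d s bg)
    -- the functional and its influence functions
    (φ : ℝ → ℝ) (ν : ℝ × ℝ → ℝ)
    (hT : VonMises.IsRegularFunctional 𝒳 (VonMises.valueRange trunc B' B) φ ν)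
    (ψf ψg : (VonMises.E d → ℝ) → (VonMises.E d → ℝ) → VonMises.E d → ℝ)
    (hψf : VonMises.IsInfluenceFst 𝒳 (VonMises.valueRange trunc B' B) φ ν ψf)
    (hψg : VonMises.IsInfluenceSnd 𝒳 (VonMises.valueRange trunc B' B) φ ν ψg)
    (hmf : VonMises.JointlyMeasurable 𝒳 (VonMises.valueRange trunc B' B) ψf)
    (hmg : VonMises.JointlyMeasurable 𝒳 (VonMises.valueRange trunc B' B) ψg)
    (hrf : VonMises.InfluenceRegular 𝒳 (VonMises.valueRange trunc B' B) ψf f g f)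
    (hrg : VonMises.InfluenceRegular 𝒳 (VonMises.valueRange trunc B' B) ψg f g g)
    -- the two independent samples
    {Ω : Type*} [MeasurableSpace Ω] (P : Measure Ω) [IsProbabilityMeasure P]
    (X Y : ℕ → Ω → VonMises.E d)
    (hX : ∀ i, Measurable (X i)) (hY : ∀ j, Measurable (Y j))
    (hXlaw : ∀ i, P.map (X i) = VonMises.law 𝒳 f) (hYlaw : ∀ j, P.map (Y j) = VonMises.law 𝒳 g)
    (hindep : iIndepFun (Sum.elim X Y) P)
    -- the data-split estimator from `n` and `m` observations
    (That : ℕ → ℕ → Ω → ℝ)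
    (hThat : ∀ n m ω, That n m ω = VonMises.dsEstimator 𝒳 φ ν ψf ψg
      (VonMises.densEst trunc B' B Kf bf) (VonMises.densEst trunc B' B Kg bg) n m
      (fun i => X i ω) (fun j => Y j ω)) :
    (s < (d : ℝ) / 2 → ∃ (C : ℝ) (n₀ : ℕ), ∀ n m : ℕ, n₀ ≤ n → n₀ ≤ m →
      ∫⁻ ω, ENNReal.ofReal ((That n m ω - VonMises.T 𝒳 φ ν f g) ^ 2) ∂P
        ≤ ENNReal.ofReal (C * ((n : ℝ) ^ (-(4 * s) / (2 * s + d))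
            + (m : ℝ) ^ (-(4 * s) / (2 * s + d))))) ∧
    ((d : ℝ) / 2 ≤ s → ∃ (C : ℝ) (n₀ : ℕ), ∀ n m : ℕ, n₀ ≤ n → n₀ ≤ m →
      ∫⁻ ω, ENNReal.ofReal ((That n m ω - VonMises.T 𝒳 φ ν f g) ^ 2) ∂P
        ≤ ENNReal.ofReal (C * ((n : ℝ)⁻¹ + (m : ℝ)⁻¹))) ∧
    ((d : ℝ) / 2 < s →
      ¬ (ψf f g =ᵐ[volume.restrict 𝒳] 0 ∧ ψg f g =ᵐ[volume.restrict 𝒳] 0) →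
      ∀ (n m : ℕ → ℕ) (ζ : ℝ), ζ ∈ Set.Ioo (0 : ℝ) 1 →
        Tendsto n atTop atTop → Tendsto m atTop atTop →
        Tendsto (fun k => (n k : ℝ) / ((n k : ℝ) + (m k : ℝ))) atTop (𝓝 ζ) →
        TendstoInDistribution
          (fun k ω => Real.sqrt ((n k : ℝ) + (m k : ℝ))
            * (That (n k) (m k) ω - VonMises.T 𝒳 φ ν f g))
          atTop (id : ℝ → ℝ) (fun _ => P)
          (gaussianReal 0 (Real.toNNReal
            (1 / ζ * variance (ψf f g) (VonMises.law 𝒳 f)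
              + 1 / (1 - ζ) * variance (ψg f g) (VonMises.law 𝒳 g))))) := by
  obtain ⟨I, C, M, k₀, S⟩ := VonMises.exists_splitSetting hs h𝒳 h𝒮 h𝒮' h𝒳𝒮 hf hg hfd hgd trunc
    hKf hKg hbf hbg hT hψf hψg hmf hmg hrf hrg hX hY hXlaw hYlaw hindep
  obtain ⟨K, n₀, hK, hn₀, hrisk⟩ := S.exists_lintegral_sq_dsEstimator_le hs
  simp only [hThat]
  -- The risk bound is the sum of both rates. Their exponents `4 s / (2 s + d)` and `1` cross at `s
  -- = d / 2`, so on either side one rate absorbs the other at the price of a factor two.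
  refine ⟨fun h => ⟨2 * K, n₀, fun n m hn hm => (hrisk n m hn hm).trans
    (ENNReal.ofReal_le_ofReal ?_)⟩, fun h => ⟨2 * K, n₀, fun n m hn hm =>
    (hrisk n m hn hm).trans (ENNReal.ofReal_le_ofReal ?_)⟩, fun h _ n m ζ hζ hn hm hnm =>
    S.tendstoInDistribution_dsEstimator hs h hζ hn hm hnm⟩
  · rw [← VonMises.rate_sq, ← VonMises.rate_sq, mul_comm 2 K, mul_assoc]
    have h1 := VonMises.inv_le_rate_sq hs h.le (hn₀.trans hn)
    have h2 := VonMises.inv_le_rate_sq hs h.le (hn₀.trans hm)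
    gcongr
    linarith
  · rw [mul_comm 2 K, mul_assoc]
    have h1 := VonMises.rate_sq_le_inv hs h (hn₀.trans hn)
    have h2 := VonMises.rate_sq_le_inv hs h (hn₀.trans hm)
    gcongr
    linarith
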